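/- \textbf{Setting.} Signature $(-+++)$; Riemann tensor $R_{abc}{}^{d}\omega_d=(\nabla_a\nabla_b-\nabla_b\nabla_a)\omega_c$, Ricci tensor $R_{ac}=R_{abc}{}^{b}$, Einstein tensor $G_{ab}=R_{ab}-\tfrac12Rg_{ab}$. A non-extremal Killing horizon in adapted normal coordinates $(t,n,\varphi,z)$ (horizon at $n=0$, exterior $n>0$) is one of the following; all metric functions are smooth up to $n=0$ and the horizon section is connected. (S) \emph{Static:} $ds^2=-N^2dt^2+dn^2+g_{\varphi\varphi}d\varphi^2+2g_{\varphi z}d\varphi\,dz+g_{zz}dz^2$, with $N,g_{\varphi\varphi},g_{\varphi z},g_{zz}$ functions of $(n,\varphi,z)$ and the $(\varphi,z)$ block positive definite. (A) \emph{Stationary axisymmetric, time-reversible:} $ds^2=-(N^2-\omega^2g_{\varphi\varphi})dt^2-2\omega g_{\varphi\varphi}\,dt\,d\varphi+g_{\varphi\varphi}d\varphi^2+dn^2+g_{zz}dz^2$, with $N,\omega,g_{\varphi\varphi}>0,g_{zz}>0$ functions of $(n,z)$. In both cases $N=\kappa_h n+\tfrac12\kappa_2n^2+\cdots$, where $\kappa_h\neq0$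 everywhere on the horizon, and in case (A) $\omega=\omega|_{n=0}+\omega_1n+\tfrac12\omega_2n^2+\tfrac16\omega_3n^3+\cdots$; the coefficients are functions on the horizon section. Suppose that $R$, $R_{ab}R^{ab}$ and $R_{abcd}R^{abcd}$ remain bounded as each point of the horizon is approached along its normal line, $n\to0^+$. \textbf{Conclusions.} \begin{enumerate} \item $\kappa_h$ is constant (zeroth law), $\kappa_2=0$, and $\partial_ng_{zz}=\partial_ng_{\varphi\varphi}=0$ at $n=0$. In case (S) also $\partial_ng_{\varphi z}=0$ at $n=0$. In case (A) also $\omega_1=0$ and $\omega|_{n=0}=\Omega_h$ is constant. \item Let $\chi=\partial_t+\Omega_h\partial_\varphi$ (with $\Omega_h=0$ in case (S)), and let $\hat\chi,\hat n,\hat\varphi,\hat z$ be $\chi,\partial_n,\partial_\varphi,\partial_z$ normalised to length $\pm1$. As $n\to0^+$ along a normal line, all components of $G$ in this tetrad have finite limits, and in the limit $G_{\hat\chi\hat\chi}=-G_{\hat n\hat n}$ and $G_{\hat\chi\hat n}=G_{\hat\chi\hat z}=G_{\hat n\hat\varphi}=G_{\hat n\hat z}=0$. \item The remaining entry between the blocks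 $(\hat\chi,\hat n)$ and $(\hat\varphi,\hat z)$: in case (S), $G_{\hat\chi\hat\varphi}\to0$. In case (A), the limit of $G_{\hat\chi\hat\varphi}$ is zero at a horizon point if and only if $\omega_3=0$ there, and it is zero whenever the spacetime extends smoothly to the horizon there, i.e. whenever near that point there are coordinates $(v,x,\psi,y)=(t+A(n,z),\,X(n,z),\,\varphi+B(n,z),\,Y(n,z))$, with $A,B$ smooth for $n>0$, $X,Y$ smooth up to $n=0$, and $X=0$, $Y=z$ at $n=0$, in which the metric components extend to a smooth nondegenerate function of $(x,y)$ on a neighbourhood of the horizon. So the Einstein tensor block-diagonalises on every static horizon and on every axisymmetric horizon of a smooth spacetime. \item If $T_{ab}$ satisfies $G_{ab}=8\pi T_{ab}$ for $n>0$, then $\rho=T_{\hat\chi\hat\chi}$ and $p_n=T_{\hat n\hat n}$ have finite limits at the horizon, and there $\rho=-p_n$. \end{enumerate} -/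

import Mathlib

open Filter Topology Set

noncomputable section

namespace NearHorizon

/-! ### Coordinate tensor calculus on a four-dimensional chart

Coordinates are `x : Fin 4 → ℝ`; a metric is a matrix-valued function of the coordinates. -/

/-- The partial derivative `∂f/∂x^μ` at `x`. -/
def pd (μ : Fin 4) (f : (Fin 4 → ℝ) → ℝ) (x : Fin 4 → ℝ) : ℝ :=
  deriv (fun s => f (Function.update x μ s)) (x μ)

/-- A covariant 2-tensor field in coordinates. -/
abbrev Tensor2 := (Fin 4 → ℝ) → Matrix (Fin 4) (Fin 4) ℝ

/-- Christoffel symbols `Γ^l_{mk}` of the metric `g`. -/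
def christoffel (g : Tensor2) (l m k : Fin 4) (x : Fin 4 → ℝ) : ℝ :=
  (1 / 2) * ∑ s, (g x)⁻¹ l s *
    (pd m (fun y => g y s k) x + pd k (fun y => g y s m) x - pd s (fun y => g y m k) x)

/-- The Riemann tensor `R_{abc}{}^d`, with the convention
`R_{abc}{}^d ω_d = (∇_a ∇_b - ∇_b ∇_a) ω_c`. -/
def riemann (g : Tensor2) (a b c d : Fin 4) (x : Fin 4 → ℝ) : ℝ :=
  pd b (christoffel g d a c) x - pd a (christoffel g d b c) x
    + ∑ e, (christoffel g e a c x * christoffel g d e b x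
      - christoffel g e b c x * christoffel g d e a x)

/-- The fully covariant Riemann tensor `R_{abcd}`. -/
def riemannLow (g : Tensor2) (a b c d : Fin 4) (x : Fin 4 → ℝ) : ℝ :=
  ∑ e, riemann g a b c e x * g x e d

/-- The Ricci tensor `R_{ac} = R_{abc}{}^b`. -/
def ricci (g : Tensor2) : Tensor2 := fun x =>
  Matrix.of fun a c => ∑ b, riemann g a b c b x

/-- The Ricci scalar `R`. -/
def scalarCurv (g : Tensor2) (x : Fin 4 → ℝ) : ℝ :=
  ∑ a, ∑ b, (g x)⁻¹ a b * ricci g x a b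

/-- The scalar `R_{ab} R^{ab}`. -/
def ricciSq (g : Tensor2) (x : Fin 4 → ℝ) : ℝ :=
  ∑ a, ∑ b, ∑ c, ∑ d, (g x)⁻¹ a c * (g x)⁻¹ b d * ricci g x a b * ricci g x c d

/-- The Kretschmann scalar `R_{abcd} R^{abcd}`. -/
def riemannSq (g : Tensor2) (x : Fin 4 → ℝ) : ℝ :=
  ∑ a, ∑ b, ∑ c, ∑ d, ∑ a', ∑ b', ∑ c', ∑ d',
    (g x)⁻¹ a a' * (g x)⁻¹ b b' * (g x)⁻¹ c c' * (g x)⁻¹ d d' *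
      riemannLow g a b c d x * riemannLow g a' b' c' d' x

/-- The Einstein tensor `G_{ab} = R_{ab} - R g_{ab} / 2`. -/
def einstein (g : Tensor2) : Tensor2 := fun x =>
  ricci g x - (scalarCurv g x / 2) • g x

/-- `T(u, v) = T_{ab} u^a v^b` at `x`. -/
def eval2 (T : Tensor2) (x u v : Fin 4 → ℝ) : ℝ :=
  ∑ a, ∑ b, T x a b * u a * v b

/-- The vector `v` scaled to `g(v, v) = ± 1` (if it is not null). -/
def normalize (g : Tensor2) (x v : Fin 4 → ℝ) : Fin 4 → ℝ :=
  (Real.sqrt |eval2 g x v v|)⁻¹ • v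

/-! From here on the coordinates are `(x 0, x 1, x 2, x 3) = (t, n, φ, z)`, the exterior being
`n > 0` and the horizon sitting at `n = 0`. -/

/-- The normalised tetrad `(χ̂, n̂, φ̂, ẑ)` built from the Killing field `χ = ∂_t + Ω ∂_φ` and
`∂_n`, `∂_φ`, `∂_z`. -/
def tetrad (g : Tensor2) (Ω : ℝ) (x : Fin 4 → ℝ) (a : Fin 4) : Fin 4 → ℝ :=
  normalize g x
    ((![![1, 0, Ω, 0], ![0, 1, 0, 0], ![0, 0, 1, 0], ![0, 0, 0, 1]] : Fin 4 → Fin 4 → ℝ) a)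

/-- The components `T_{âb̂}` of `T` in the tetrad `(χ̂, n̂, φ̂, ẑ)`. -/
def frameComp (g : Tensor2) (Ω : ℝ) (T : Tensor2) (a b : Fin 4) (x : Fin 4 → ℝ) : ℝ :=
  eval2 T x (tetrad g Ω x a) (tetrad g Ω x b)

/-- `f` remains finite as the point `p` of the horizon is approached along the normal line. -/
def FiniteAt (f : (Fin 4 → ℝ) → ℝ) (p : Fin 4 → ℝ) : Prop :=
  ∃ C : ℝ, ∀ᶠ n in 𝓝[>] (0 : ℝ), |f (Function.update p 1 n)| ≤ C

/-- `f` tends to `l` as the point `p` of the horizon is approached along the normal line. -/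
def HasHorizonLimit (f : (Fin 4 → ℝ) → ℝ) (p : Fin 4 → ℝ) (l : ℝ) : Prop :=
  Tendsto (fun n : ℝ => f (Function.update p 1 n)) (𝓝[>] 0) (𝓝 l)

/-- `R`, `R_{ab} R^{ab}` and `R_{abcd} R^{abcd}` remain finite at every point of the horizon. -/
def FiniteCurvatureScalars (g : Tensor2) (horizon : Set (Fin 4 → ℝ)) : Prop :=
  ∀ p ∈ horizon, FiniteAt (scalarCurv g) p ∧ FiniteAt (ricciSq g) p ∧ FiniteAt (riemannSq g) p

/-- The Einstein equations `G_{ab} = 8π T_{ab}` on a region. -/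
def EinsteinEquations (g T : Tensor2) (region : Set (Fin 4 → ℝ)) : Prop :=
  ∀ x ∈ region, einstein g x = (8 * Real.pi) • T x

/-! ### Static Killing horizons -/

/-- A non-extremal static Killing horizon in adapted normal coordinates `(t, n, φ, z)`. The metric
functions depend on `(n, φ, z)` and are smooth up to the horizon, that is, they are restrictions of
functions smooth on an open set `U` around the horizon section `{(φ, z) | (0, φ, z) ∈ U}`. -/
structure StaticHorizon where
  U : Set (ℝ × ℝ × ℝ)
  isOpen_U : IsOpen U
  connected : IsPreconnected {y : ℝ × ℝ | (0, y) ∈ U}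
  N : ℝ × ℝ × ℝ → ℝ
  gφφ : ℝ × ℝ × ℝ → ℝ
  gφz : ℝ × ℝ × ℝ → ℝ
  gzz : ℝ × ℝ × ℝ → ℝ
  smooth_N : ContDiffOn ℝ (⊤ : ℕ∞) N U
  smooth_gφφ : ContDiffOn ℝ (⊤ : ℕ∞) gφφ U
  smooth_gφz : ContDiffOn ℝ (⊤ : ℕ∞) gφz U
  smooth_gzz : ContDiffOn ℝ (⊤ : ℕ∞) gzz U
  gφφ_pos : ∀ q ∈ U, 0 < gφφ q
  det_pos : ∀ q ∈ U, 0 < gφφ q * gzz q - gφz q ^ 2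
  /-- The lapse, the norm of the Killing field `∂_t`, vanishes on the horizon. -/
  lapse_zero : ∀ y : ℝ × ℝ, (0, y) ∈ U → N (0, y) = 0
  /-- Non-extremality: `κ_h ≠ 0`. -/
  nonextremal : ∀ y : ℝ × ℝ, (0, y) ∈ U → deriv (fun n => N (n, y)) 0 ≠ 0

namespace StaticHorizon

variable (H : StaticHorizon)

/-- The metric `-N² dt² + dn² + g_φφ dφ² + 2 g_φz dφ dz + g_zz dz²`. -/
def metric : Tensor2 := fun x =>
  let q : ℝ × ℝ × ℝ := (x 1, x 2, x 3)
  !![-(H.N q ^ 2), 0, 0, 0;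
     0, 1, 0, 0;
     0, 0, H.gφφ q, H.gφz q;
     0, 0, H.gφz q, H.gzz q]

/-- The horizon `n = 0`. -/
def horizon : Set (Fin 4 → ℝ) := {x | x 1 = 0 ∧ ((x 1, x 2, x 3) : ℝ × ℝ × ℝ) ∈ H.U}

/-- The exterior `n > 0`. -/
def exterior : Set (Fin 4 → ℝ) := {x | 0 < x 1 ∧ ((x 1, x 2, x 3) : ℝ × ℝ × ℝ) ∈ H.U}

/-- `κ_h` in `N = κ_h n + κ₂ n² / 2 + ⋯`. -/
def κh (y : ℝ × ℝ) : ℝ := deriv (fun n => H.N (n, y)) 0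

/-- `κ₂` in `N = κ_h n + κ₂ n² / 2 + ⋯`. -/
def κ₂ (y : ℝ × ℝ) : ℝ := iteratedDeriv 2 (fun n => H.N (n, y)) 0

end StaticHorizon

/-! ### Stationary axisymmetric time-reversible Killing horizons -/

/-- A non-extremal Killing horizon of a stationary axisymmetric time-reversible spacetime in
adapted normal coordinates `(t, n, φ, z)`. The metric functions depend on `(n, z)` and are smooth
up to the horizon, that is, they are restrictions of functions smooth on an open set `U` around the
horizon section `{z | (0, z) ∈ U}`. -/
structure AxisymmetricHorizon where
  U : Set (ℝ × ℝ)
  isOpen_U : IsOpen U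
  connected : IsPreconnected {z : ℝ | (0, z) ∈ U}
  N : ℝ × ℝ → ℝ
  ω : ℝ × ℝ → ℝ
  gφφ : ℝ × ℝ → ℝ
  gzz : ℝ × ℝ → ℝ
  smooth_N : ContDiffOn ℝ (⊤ : ℕ∞) N U
  smooth_ω : ContDiffOn ℝ (⊤ : ℕ∞) ω U
  smooth_gφφ : ContDiffOn ℝ (⊤ : ℕ∞) gφφ U
  smooth_gzz : ContDiffOn ℝ (⊤ : ℕ∞) gzz U
  gφφ_pos : ∀ q ∈ U, 0 < gφφ q
  gzz_pos : ∀ q ∈ U, 0 < gzz q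
  /-- The lapse vanishes on the horizon: `∂_t + ω ∂_φ` is null there. -/
  lapse_zero : ∀ z : ℝ, (0, z) ∈ U → N (0, z) = 0
  /-- Non-extremality: `κ_h ≠ 0`. -/
  nonextremal : ∀ z : ℝ, (0, z) ∈ U → deriv (fun n => N (n, z)) 0 ≠ 0

namespace AxisymmetricHorizon

variable (H : AxisymmetricHorizon)

/-- The metric `-(N² - ω² g_φφ) dt² - 2 ω g_φφ dt dφ + g_φφ dφ² + dn² + g_zz dz²`. -/
def metric : Tensor2 := fun x =>
  let q : ℝ × ℝ := (x 1, x 3)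
  !![-(H.N q ^ 2 - H.ω q ^ 2 * H.gφφ q), 0, -(H.ω q * H.gφφ q), 0;
     0, 1, 0, 0;
     -(H.ω q * H.gφφ q), 0, H.gφφ q, 0;
     0, 0, 0, H.gzz q]

/-- The horizon `n = 0`. -/
def horizon : Set (Fin 4 → ℝ) := {x | x 1 = 0 ∧ ((x 1, x 3) : ℝ × ℝ) ∈ H.U}

/-- The exterior `n > 0`. -/
def exterior : Set (Fin 4 → ℝ) := {x | 0 < x 1 ∧ ((x 1, x 3) : ℝ × ℝ) ∈ H.U}

/-- `κ_h` in `N = κ_h n + κ₂ n² / 2 + ⋯`. -/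
def κh (z : ℝ) : ℝ := deriv (fun n => H.N (n, z)) 0

/-- `κ₂` in `N = κ_h n + κ₂ n² / 2 + ⋯`. -/
def κ₂ (z : ℝ) : ℝ := iteratedDeriv 2 (fun n => H.N (n, z)) 0

/-- `ω₁` in `ω = ω(0, z) + ω₁ n + ω₂ n² / 2 + ω₃ n³ / 6 + ⋯`. -/
def ω₁ (z : ℝ) : ℝ := deriv (fun n => H.ω (n, z)) 0

/-- `ω₃` in `ω = ω(0, z) + ω₁ n + ω₂ n² / 2 + ω₃ n³ / 6 + ⋯`. -/
def ω₃ (z : ℝ) : ℝ := iteratedDeriv 3 (fun n => H.ω (n, z)) 0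

/-- The spacetime extends smoothly to the horizon at the horizon point with coordinate `z₀`: near
it there are horizon-penetrating coordinates
`(v, x, ψ, y) = (t + A(n, z), X(n, z), φ + B(n, z), Y(n, z))`, where `A`, `B` are smooth for
`n > 0` (and usually diverge at `n = 0`), `X`, `Y` are smooth up to the horizon, which is the
hypersurface `x = 0` with `y = z` on it, such that the metric components in the new
coordinates are restrictions of functions `ĝ(x, y)`, smooth and nondegenerate on an open set `V`
containing the horizon points. -/
def ExtendsAcrossHorizonAt (z₀ : ℝ) : Prop :=
  ∃ (W V : Set (ℝ × ℝ)) (A B X Y : ℝ × ℝ → ℝ) (ĝ : ℝ × ℝ → Matrix (Fin 4) (Fin 4) ℝ),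
    IsOpen W ∧ W ⊆ H.U ∧ (0, z₀) ∈ W ∧ IsOpen V ∧
    ContDiffOn ℝ (⊤ : ℕ∞) A (W ∩ {q | 0 < q.1}) ∧ ContDiffOn ℝ (⊤ : ℕ∞) B (W ∩ {q | 0 < q.1}) ∧
    ContDiffOn ℝ (⊤ : ℕ∞) X W ∧ ContDiffOn ℝ (⊤ : ℕ∞) Y W ∧
    (∀ z, (0, z) ∈ W → X (0, z) = 0 ∧ Y (0, z) = z) ∧
    (∀ q ∈ W, 0 ≤ q.1 → (X q, Y q) ∈ V) ∧
    (∀ i j, ContDiffOn ℝ (⊤ : ℕ∞) (fun q => ĝ q i j) V) ∧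
    (∀ q ∈ V, (ĝ q).IsSymm ∧ (ĝ q).det ≠ 0) ∧
    ∀ x : Fin 4 → ℝ, ((x 1, x 3) : ℝ × ℝ) ∈ W → 0 < x 1 →
      let Φ : (Fin 4 → ℝ) → Fin 4 → ℝ := fun s =>
        ![s 0 + A (s 1, s 3), X (s 1, s 3), s 2 + B (s 1, s 3), Y (s 1, s 3)]
      let J : Matrix (Fin 4) (Fin 4) ℝ := Matrix.of fun i j => pd j (fun s => Φ s i) x
      H.metric x = J.transpose * ĝ (X (x 1, x 3), Y (x 1, x 3)) * J

end AxisymmetricHorizon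

end NearHorizon

end

/-!
Both families of horizons are instances of one metric,
`-(N² - ω² p) dt² - 2 ω p dt dφ + dn² + p dφ² + 2 q dφ dz + r dz²`, with either `ω = 0` or `q = 0`
and no dependence on `φ` (`KillingData`). Off the horizon it has the orthogonal frame
`e₀ = (∂_t + ω ∂_φ) / N`, `e₁ = ∂_n`, `e₂ = ∂_φ`, `e₃ = ∂_z - (q / p) ∂_φ`, of which only `e₀` is
singular at `N = 0`. The frame components of the Riemann tensor come from its expression through
the first and second derivatives of the metric (`riemannLow_eq_metric`, `frameRiemann_eq`), and
split into an electric, a spatial and a magnetic part (`Rm_electric`, `Rm_spatial`, `Rm_magnetic`)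
in which all singular terms are explicit quotients by powers of `N`.

Boundedness of the scalars is used as follows. The limit of `N² R` is a positive multiple of
`(∂_n ω)² + g^{zz} (∂_z ω)²` on the horizon (`limit_sq_scalarCurv`), so `ω` is constant there to
first order. Then the magnetic components `R_{0jkl}` have limits (`converges_magnetic`). In the
Kretschmann scalar the squares of the magnetic components are the only ones with a negative sign,
so every electric component `R_{0i0j}` is bounded. As `N R_{0i0j}` tends to the Hessian of `N`, this
Hessian vanishes on the horizon (`hessN_eq_zero`). Its components are `κ₂`, the derivatives of
`κ_h`, and `κ_h` times the normal derivatives of the metric of the sections, so that all of these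
vanish (`regularHorizon`).

With this information every curvature component converges (`converges_Rm`). The limits of the
components of the Einstein tensor follow from Taylor expansion: `G₀₀ + G₁₁` and `G₁₂`, `G₁₃` tend to
zero, `G₀₁` and `G₀₃` vanish by time reversal, and `G₀₂` tends to `p ω₃ / (4 κ_h)`
(`limit_electric_add_spatial`, `limit_Ric_mixed`, `Ric_time_reversal`, `limit_Ric_two`). Normalised,
`∂_t + Ω ∂_φ` tends to `± e₀` relative to the frame, so that the same holds in the tetrad
(`einstein_limit`).

Finally suppose that the metric extends in coordinates `x = X(n, z)`, `y = Y(n, z)`. The functions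
`ĝ^{xx} = X_n² + X_z² / g_zz` and `ĝ^{xy} = X_n Y_n + X_z Y_z / g_zz`, and the determinant, are smooth
functions of `(x, y)`. Since the determinant vanishes exactly to second order, `X_n = 0 ≠ X_nn` on
the horizon; comparing Taylor coefficients in `n` of the other two gives `Y_n = 0` and `X_nnn = 0`.
As `(ω - Ω) g_φφ` is also a smooth function of `(x, y)`, vanishing at `x = 0`, its third normal
derivative is a multiple of `X_nnn`, whence `ω₃ = 0` (`ω₃_eq_zero_of_extends`).
-/

noncomputable section

namespace NearHorizon

/-! ### Partial derivatives of smooth functions -/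

theorem hasDerivAt_update_line {f : (Fin 4 → ℝ) → ℝ} {x : Fin 4 → ℝ} (μ : Fin 4)
    (hf : DifferentiableAt ℝ f x) :
    HasDerivAt (fun s => f (Function.update x μ s)) (fderiv ℝ f x (Pi.single μ 1)) (x μ) := by
  have h1 : HasFDerivAt f (fderiv ℝ f x) (Function.update x μ (x μ)) := by
    rw [Function.update_eq_self]; exact hf.hasFDerivAt
  exact HasFDerivAt.comp_hasDerivAt (x μ) h1 (hasDerivAt_update x μ (x μ))

theorem pd_eq_fderiv {f : (Fin 4 → ℝ) → ℝ} {x : Fin 4 → ℝ} (μ : Fin 4)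
    (hf : DifferentiableAt ℝ f x) : pd μ f x = fderiv ℝ f x (Pi.single μ 1) :=
  (hasDerivAt_update_line μ hf).deriv

theorem hasDerivAt_pd {f : (Fin 4 → ℝ) → ℝ} {x : Fin 4 → ℝ} (μ : Fin 4)
    (hf : DifferentiableAt ℝ f x) :
    HasDerivAt (fun s => f (Function.update x μ s)) (pd μ f x) (x μ) := by
  rw [pd_eq_fderiv μ hf]; exact hasDerivAt_update_line μ hf

theorem pd_eq_of_hasDerivAt {f : (Fin 4 → ℝ) → ℝ} {x : Fin 4 → ℝ} {μ : Fin 4} {d : ℝ}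
    (h : HasDerivAt (fun s => f (Function.update x μ s)) d (x μ)) : pd μ f x = d := h.deriv

theorem pd_congr {f g : (Fin 4 → ℝ) → ℝ} {x : Fin 4 → ℝ} (μ : Fin 4) (h : f =ᶠ[𝓝 x] g) :
    pd μ f x = pd μ g x := by
  refine Filter.EventuallyEq.deriv_eq ?_
  have hc : Tendsto (fun s => Function.update x μ s) (𝓝 (x μ)) (𝓝 x) := by
    have := (hasDerivAt_update x μ (x μ)).continuousAt.tendsto
    rwa [Function.update_eq_self] at this
  exact hc.eventually h

theorem pd_congr_on {S : Set (Fin 4 → ℝ)} (hS : IsOpen S) {f g : (Fin 4 → ℝ) → ℝ}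
    {x : Fin 4 → ℝ} (hx : x ∈ S) (μ : Fin 4) (h : ∀ y ∈ S, f y = g y) : pd μ f x = pd μ g x :=
  pd_congr μ (Filter.eventually_of_mem (hS.mem_nhds hx) h)

/-- Smooth functions on a set. -/
abbrev SmoothOn (S : Set (Fin 4 → ℝ)) (f : (Fin 4 → ℝ) → ℝ) : Prop :=
  ContDiffOn ℝ (⊤ : ℕ∞) f S

section
variable {S : Set (Fin 4 → ℝ)} {f g : (Fin 4 → ℝ) → ℝ} {x : Fin 4 → ℝ}

theorem SmoothOn.differentiableAt (hS : IsOpen S) (hf : SmoothOn S f) (hx : x ∈ S) :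
    DifferentiableAt ℝ f x :=
  (hf.differentiableOn (by simp)).differentiableAt (hS.mem_nhds hx)

theorem SmoothOn.pd (hS : IsOpen S) (hf : SmoothOn S f) (μ : Fin 4) : SmoothOn S (pd μ f) := by
  have h1 : ContDiffOn ℝ (⊤ : ℕ∞) (fderiv ℝ f) S := hf.fderiv_of_isOpen hS (by simp)
  have h2 : ContDiffOn ℝ (⊤ : ℕ∞) (fun y => fderiv ℝ f y (Pi.single μ 1)) S :=
    h1.clm_apply contDiffOn_const
  exact h2.congr fun y hy => pd_eq_fderiv μ (hf.differentiableAt hS hy)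

theorem pd_const (μ : Fin 4) (c : ℝ) : NearHorizon.pd μ (fun _ => c) x = 0 := by
  simp [NearHorizon.pd]

theorem pd_sub (μ : Fin 4) (hf : DifferentiableAt ℝ f x) (hg : DifferentiableAt ℝ g x) :
    NearHorizon.pd μ (fun y => f y - g y) x = NearHorizon.pd μ f x - NearHorizon.pd μ g x :=
  pd_eq_of_hasDerivAt ((hasDerivAt_pd μ hf).sub (hasDerivAt_pd μ hg))

theorem pd_neg (μ : Fin 4) :
    NearHorizon.pd μ (fun y => -f y) x = -NearHorizon.pd μ f x := by
  simp only [NearHorizon.pd]; exact deriv.neg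

theorem pd_mul (μ : Fin 4) (hf : DifferentiableAt ℝ f x) (hg : DifferentiableAt ℝ g x) :
    NearHorizon.pd μ (fun y => f y * g y) x
      = NearHorizon.pd μ f x * g x + f x * NearHorizon.pd μ g x := by
  have := pd_eq_of_hasDerivAt (f := fun y => f y * g y)
    ((hasDerivAt_pd μ hf).mul (hasDerivAt_pd μ hg))
  simpa using this

theorem pd_sum {ι : Type*} (s : Finset ι) (F : ι → (Fin 4 → ℝ) → ℝ) (μ : Fin 4)
    (hf : ∀ i ∈ s, DifferentiableAt ℝ (F i) x) :
    NearHorizon.pd μ (fun y => ∑ i ∈ s, F i y) x = ∑ i ∈ s, NearHorizon.pd μ (F i) x :=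
  pd_eq_of_hasDerivAt (HasDerivAt.fun_sum fun i hi => hasDerivAt_pd μ (hf i hi))

theorem pd_comm (hS : IsOpen S) (hf : SmoothOn S f) (hx : x ∈ S) (μ ν : Fin 4) :
    NearHorizon.pd μ (NearHorizon.pd ν f) x = NearHorizon.pd ν (NearHorizon.pd μ f) x := by
  have key : ∀ μ ν : Fin 4, NearHorizon.pd μ (NearHorizon.pd ν f) x
      = fderiv ℝ (fderiv ℝ f) x (Pi.single μ 1) (Pi.single ν 1) := by
    intro μ ν
    have h1 : ContDiffOn ℝ (⊤ : ℕ∞) (fderiv ℝ f) S := hf.fderiv_of_isOpen hS (by simp)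
    have h1' : DifferentiableAt ℝ (fderiv ℝ f) x :=
      (h1.differentiableOn (by simp)).differentiableAt (hS.mem_nhds hx)
    rw [pd_congr_on hS hx μ (fun y hy => pd_eq_fderiv ν (hf.differentiableAt hS hy)),
      pd_eq_fderiv μ (h1'.clm_apply (differentiableAt_const _)),
      fderiv_clm_apply h1' (differentiableAt_const _)]
    simp
  have hsym : IsSymmSndFDerivAt ℝ f x :=
    (hf.contDiffAt (hS.mem_nhds hx)).isSymmSndFDerivAt
      (by rw [minSmoothness_of_isRCLikeNormedField]; exact WithTop.coe_le_coe.2 le_top)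
  rw [key, key]
  exact hsym.eq _ _

end

/-! ### The Riemann tensor in terms of the derivatives of the metric -/

section
variable {F : Type*} [NormedAddCommGroup F] [NormedSpace ℝ F] {S : Set F}
  {g : F → Matrix (Fin 4) (Fin 4) ℝ}

theorem contDiffOn_det (h : ∀ i j, ContDiffOn ℝ (⊤ : ℕ∞) (fun y => g y i j) S) :
    ContDiffOn ℝ (⊤ : ℕ∞) (fun y => (g y).det) S := by
  simp only [Matrix.det_apply]
  exact ContDiffOn.sum fun σ _ => ContDiffOn.const_smul _ (contDiffOn_prod fun i _ => h _ _)

theorem contDiffOn_inv_entry (h : ∀ i j, ContDiffOn ℝ (⊤ : ℕ∞) (fun y => g y i j) S)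
    (hdet : ∀ y ∈ S, (g y).det ≠ 0) (i j : Fin 4) :
    ContDiffOn ℝ (⊤ : ℕ∞) (fun y => (g y)⁻¹ i j) S := by
  have e : ∀ y, (g y)⁻¹ i j = ((g y).det)⁻¹ * ((g y).updateRow j (Pi.single i 1)).det := by
    intro y
    rw [Matrix.inv_def, Matrix.smul_apply, Matrix.adjugate_apply, Ring.inverse_eq_inv', smul_eq_mul]
  simp only [e]
  refine ((contDiffOn_det h).inv hdet).mul (contDiffOn_det fun k l => ?_)
  by_cases hk : k = j
  · simp only [Matrix.updateRow_apply, hk, if_true]; exact contDiffOn_const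
  · simp only [Matrix.updateRow_apply, hk, if_false]; exact h _ _

end

/-- The lowered Christoffel symbols `Γ_{l,mk}`. -/
def christoffelLow (g : Tensor2) (l m k : Fin 4) (x : Fin 4 → ℝ) : ℝ :=
  (1 / 2) * (pd m (fun y => g y l k) x + pd k (fun y => g y l m) x - pd l (fun y => g y m k) x)

/-- The metrics to which the coordinate formulas apply: smooth, symmetric, nondegenerate. -/
structure IsSmoothMetricOn (g : Tensor2) (S : Set (Fin 4 → ℝ)) : Prop where
  isOpen : IsOpen S
  smooth : ∀ i j, SmoothOn S (fun y => g y i j)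
  symm : ∀ y i j, g y i j = g y j i
  det_ne : ∀ y ∈ S, (g y).det ≠ 0

namespace IsSmoothMetricOn
variable {g : Tensor2} {S : Set (Fin 4 → ℝ)}

theorem isUnit_det (h : IsSmoothMetricOn g S) {x : Fin 4 → ℝ} (hx : x ∈ S) :
    IsUnit (g x).det := (h.det_ne x hx).isUnit

theorem smooth_inv (h : IsSmoothMetricOn g S) (i j : Fin 4) : SmoothOn S (fun y => (g y)⁻¹ i j) :=
  contDiffOn_inv_entry h.smooth h.det_ne i j

theorem smooth_christoffelLow (h : IsSmoothMetricOn g S) (l m k : Fin 4) :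
    SmoothOn S (christoffelLow g l m k) :=
  contDiffOn_const.mul ((((h.smooth _ _).pd h.isOpen m).add ((h.smooth _ _).pd h.isOpen k)).sub
    ((h.smooth _ _).pd h.isOpen l))

theorem christoffel_eq (l m k : Fin 4) (x : Fin 4 → ℝ) :
    christoffel g l m k x = ∑ s, (g x)⁻¹ l s * christoffelLow g s m k x := by
  simp only [christoffel, christoffelLow, Finset.mul_sum]
  refine Finset.sum_congr rfl fun s _ => by ring

theorem smooth_christoffel (h : IsSmoothMetricOn g S) (l m k : Fin 4) :
    SmoothOn S (christoffel g l m k) := by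
  have e : christoffel g l m k = fun x => ∑ s, (g x)⁻¹ l s * christoffelLow g s m k x := by
    ext x; exact christoffel_eq l m k x
  rw [e]
  exact ContDiffOn.sum fun s _ => (h.smooth_inv _ _).mul (h.smooth_christoffelLow _ _ _)

theorem lower_christoffel (h : IsSmoothMetricOn g S) {x : Fin 4 → ℝ} (hx : x ∈ S) (d a c : Fin 4) :
    ∑ e, christoffel g e a c x * g x e d = christoffelLow g d a c x := by
  simp only [christoffel_eq]
  have h1 : ∀ s, ∑ e, g x d e * (g x)⁻¹ e s = (1 : Matrix (Fin 4) (Fin 4) ℝ) d s := by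
    intro s
    rw [← Matrix.mul_nonsing_inv _ (h.isUnit_det hx)]; rfl
  simp only [Finset.sum_mul]
  rw [Finset.sum_comm]
  have : ∀ s, ∑ e, (g x)⁻¹ e s * christoffelLow g s a c x * g x e d
      = (1 : Matrix (Fin 4) (Fin 4) ℝ) d s * christoffelLow g s a c x := by
    intro s
    rw [← h1, Finset.sum_mul]
    refine Finset.sum_congr rfl fun e _ => ?_
    rw [h.symm x e d]; ring
  simp only [this, Matrix.one_apply, ite_mul, one_mul, zero_mul, Finset.sum_ite_eq,
    Finset.mem_univ, if_true]

theorem pd_metric (h : IsSmoothMetricOn g S) {x : Fin 4 → ℝ} (b e d : Fin 4) :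
    pd b (fun y => g y e d) x = christoffelLow g e b d x + christoffelLow g d b e x := by
  have h1 : (fun y => g y d e) = fun y => g y e d := by ext y; exact h.symm y d e
  have h2 : (fun y => g y e b) = fun y => g y b e := by ext y; exact h.symm y e b
  have h3 : (fun y => g y d b) = fun y => g y b d := by ext y; exact h.symm y d b
  simp only [christoffelLow, h1, h2, h3]; ring

/-- Differentiating the lowered Christoffel symbols. -/
theorem sum_pd_christoffel (h : IsSmoothMetricOn g S) {x : Fin 4 → ℝ} (hx : x ∈ S)
    (a b c d : Fin 4) :
    ∑ e, pd b (christoffel g e a c) x * g x e d = pd b (christoffelLow g d a c) x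
      - ∑ e, christoffel g e a c x * (christoffelLow g e b d x + christoffelLow g d b e x) := by
  rw [← pd_congr_on h.isOpen hx b (fun y hy => h.lower_christoffel hy d a c),
    pd_sum _ (fun e y => christoffel g e a c y * g y e d) _ fun e _ =>
      ((h.smooth_christoffel e a c).differentiableAt h.isOpen hx).mul
      ((h.smooth e d).differentiableAt h.isOpen hx), ← Finset.sum_sub_distrib]
  refine Finset.sum_congr rfl fun e _ => ?_
  rw [pd_mul _ ((h.smooth_christoffel e a c).differentiableAt h.isOpen hx)
    ((h.smooth e d).differentiableAt h.isOpen hx), h.pd_metric b e d]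
  ring

theorem sum_christoffel_low {x : Fin 4 → ℝ} (a c d b : Fin 4) :
    ∑ e, christoffel g e a c x * christoffelLow g e b d x
      = ∑ e, ∑ f, (g x)⁻¹ e f * (christoffelLow g e b d x * christoffelLow g f a c x) := by
  refine Finset.sum_congr rfl fun e _ => ?_
  rw [christoffel_eq, Finset.sum_mul]
  refine Finset.sum_congr rfl fun f _ => by ring

theorem christoffel_mul_christoffel (h : IsSmoothMetricOn g S) {x : Fin 4 → ℝ} (hx : x ∈ S)
    (a c b d : Fin 4) :
    ∑ f, (∑ e, christoffel g e a c x * christoffel g f e b x) * g x f d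
      = ∑ e, christoffel g e a c x * christoffelLow g d e b x := by
  simp only [Finset.sum_mul]
  rw [Finset.sum_comm]
  refine Finset.sum_congr rfl fun e _ => ?_
  rw [← h.lower_christoffel hx, Finset.mul_sum]
  refine Finset.sum_congr rfl fun f _ => by ring

theorem christoffelLow_symm (h : IsSmoothMetricOn g S) (l m k : Fin 4) (x : Fin 4 → ℝ) :
    christoffelLow g l m k x = christoffelLow g l k m x := by
  have h1 : (fun y => g y m k) = fun y => g y k m := by ext y; exact h.symm y m k
  simp only [christoffelLow, h1]; ring

/-- The covariant Riemann tensor, with the derivatives of the Christoffel symbols lowered. -/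
theorem riemannLow_eq (h : IsSmoothMetricOn g S) {x : Fin 4 → ℝ} (hx : x ∈ S) (a b c d : Fin 4) :
    riemannLow g a b c d x = pd b (christoffelLow g d a c) x - pd a (christoffelLow g d b c) x
      + ∑ e, ∑ f, (g x)⁻¹ e f * (christoffelLow g e a d x * christoffelLow g f b c x
        - christoffelLow g e b d x * christoffelLow g f a c x) := by
  have e1 : riemannLow g a b c d x
      = ∑ e, pd b (christoffel g e a c) x * g x e d - ∑ e, pd a (christoffel g e b c) x * g x e d
        + (∑ f, (∑ e, christoffel g e a c x * christoffel g f e b x) * g x f d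
        - ∑ f, (∑ e, christoffel g e b c x * christoffel g f e a x) * g x f d) := by
    simp only [riemannLow, riemann]
    rw [← Finset.sum_sub_distrib, ← Finset.sum_sub_distrib, ← Finset.sum_add_distrib]
    refine Finset.sum_congr rfl fun e _ => ?_
    rw [Finset.sum_sub_distrib]; ring
  have e2 : ∀ a c b, ∑ e, christoffel g e a c x *
      (christoffelLow g e b d x + christoffelLow g d b e x)
      = ∑ e, christoffel g e a c x * christoffelLow g e b d x
        + ∑ e, christoffel g e a c x * christoffelLow g d e b x := by
    intro a c b
    rw [← Finset.sum_add_distrib]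
    refine Finset.sum_congr rfl fun e _ => ?_
    rw [h.christoffelLow_symm d b e]; ring
  rw [e1, h.sum_pd_christoffel hx, h.sum_pd_christoffel hx, h.christoffel_mul_christoffel hx,
    h.christoffel_mul_christoffel hx, e2, e2, sum_christoffel_low, sum_christoffel_low]
  simp only [mul_sub, Finset.sum_sub_distrib]
  ring

theorem pd_christoffelLow (h : IsSmoothMetricOn g S) {x : Fin 4 → ℝ} (hx : x ∈ S)
    (b d a c : Fin 4) :
    pd b (christoffelLow g d a c) x = (1 / 2) * (pd b (pd a fun y => g y d c) x
      + pd b (pd c fun y => g y d a) x - pd b (pd d fun y => g y a c) x) := by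
  have s : ∀ m i j, DifferentiableAt ℝ (pd m fun y => g y i j) x := fun m i j =>
    ((h.smooth i j).pd h.isOpen m).differentiableAt h.isOpen hx
  exact pd_eq_of_hasDerivAt ((((hasDerivAt_pd b (s a d c)).add (hasDerivAt_pd b (s c d a))).sub
    (hasDerivAt_pd b (s d a c))).const_mul (1 / 2))

/-- The covariant Riemann tensor in terms of the first and second derivatives of the metric. -/
theorem riemannLow_eq_metric (h : IsSmoothMetricOn g S) {x : Fin 4 → ℝ} (hx : x ∈ S)
    (a b c d : Fin 4) :
    riemannLow g a b c d x = (1 / 2) * (pd b (pd c fun y => g y d a) x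
        - pd b (pd d fun y => g y a c) x - pd a (pd c fun y => g y d b) x
        + pd a (pd d fun y => g y b c) x)
      + ∑ e, ∑ f, (g x)⁻¹ e f * (christoffelLow g e a d x * christoffelLow g f b c x
        - christoffelLow g e b d x * christoffelLow g f a c x) := by
  rw [h.riemannLow_eq hx, h.pd_christoffelLow hx, h.pd_christoffelLow hx,
    pd_comm h.isOpen (h.smooth d c) hx b a]
  ring

theorem riemann_eq (h : IsSmoothMetricOn g S) {x : Fin 4 → ℝ} (hx : x ∈ S) (a b c d : Fin 4) :
    riemann g a b c d x = ∑ e, riemannLow g a b c e x * (g x)⁻¹ e d := by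
  have h1 : ∀ s, ∑ e, g x s e * (g x)⁻¹ e d = (1 : Matrix (Fin 4) (Fin 4) ℝ) s d := by
    intro s
    rw [← Matrix.mul_nonsing_inv _ (h.isUnit_det hx)]; rfl
  simp only [riemannLow, Finset.sum_mul]
  rw [Finset.sum_comm]
  have : ∀ s, ∑ e, riemann g a b c s x * g x s e * (g x)⁻¹ e d
      = riemann g a b c s x * (1 : Matrix (Fin 4) (Fin 4) ℝ) s d := by
    intro s
    rw [← h1, Finset.mul_sum]
    refine Finset.sum_congr rfl fun e _ => by ring
  simp only [this, Matrix.one_apply, mul_ite, mul_one, mul_zero, Finset.sum_ite_eq',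
    Finset.mem_univ, if_true]

end IsSmoothMetricOn

/-! ### Curvature in an orthogonal frame -/

/-- The components, in the frame with vectors `E · i`, of a covariant 2-tensor. -/
def contr2 (E : Fin 4 → Fin 4 → ℝ) (F : Fin 4 → Fin 4 → ℝ) (i j : Fin 4) : ℝ :=
  ∑ a, ∑ b, E a i * E b j * F a b

/-- The components, in the frame with vectors `E · i`, of a covariant array with three indices. -/
def contr3 (E : Fin 4 → Fin 4 → ℝ) (F : Fin 4 → Fin 4 → Fin 4 → ℝ) (i j k : Fin 4) : ℝ :=
  ∑ a, ∑ b, ∑ c, E a i * E b j * E c k * F a b c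

/-- The components, in the frame with vectors `E · i`, of a covariant array with four indices. -/
def contr4 (E : Fin 4 → Fin 4 → ℝ) (F : Fin 4 → Fin 4 → Fin 4 → Fin 4 → ℝ) (i j k l : Fin 4) : ℝ :=
  ∑ a, ∑ b, ∑ c, ∑ d, E a i * E b j * E c k * E d l * F a b c d

section contr
variable (E : Fin 4 → Fin 4 → ℝ)

theorem contr3_swap12 (F : Fin 4 → Fin 4 → Fin 4 → ℝ) (i j k : Fin 4) :
    contr3 E (fun a b c => F b a c) i j k = contr3 E F j i k := by
  unfold contr3
  rw [Finset.sum_comm]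
  refine Finset.sum_congr rfl fun a _ => Finset.sum_congr rfl fun b _ =>
    Finset.sum_congr rfl fun c _ => by ring

theorem contr3_swap23 (F : Fin 4 → Fin 4 → Fin 4 → ℝ) (i j k : Fin 4) :
    contr3 E (fun a b c => F a c b) i j k = contr3 E F i k j := by
  unfold contr3
  refine Finset.sum_congr rfl fun a _ => ?_
  rw [Finset.sum_comm]
  refine Finset.sum_congr rfl fun b _ => Finset.sum_congr rfl fun c _ => by ring

theorem contr4_swap12 (F : Fin 4 → Fin 4 → Fin 4 → Fin 4 → ℝ) (i j k l : Fin 4) :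
    contr4 E (fun a b c d => F b a c d) i j k l = contr4 E F j i k l := by
  unfold contr4
  rw [Finset.sum_comm]
  refine Finset.sum_congr rfl fun a _ => Finset.sum_congr rfl fun b _ =>
    Finset.sum_congr rfl fun c _ => Finset.sum_congr rfl fun d _ => by ring

theorem contr4_swap23 (F : Fin 4 → Fin 4 → Fin 4 → Fin 4 → ℝ) (i j k l : Fin 4) :
    contr4 E (fun a b c d => F a c b d) i j k l = contr4 E F i k j l := by
  unfold contr4
  refine Finset.sum_congr rfl fun a _ => ?_
  rw [Finset.sum_comm]
  refine Finset.sum_congr rfl fun b _ =>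
    Finset.sum_congr rfl fun c _ => Finset.sum_congr rfl fun d _ => by ring

theorem contr4_swap34 (F : Fin 4 → Fin 4 → Fin 4 → Fin 4 → ℝ) (i j k l : Fin 4) :
    contr4 E (fun a b c d => F a b d c) i j k l = contr4 E F i j l k := by
  unfold contr4
  refine Finset.sum_congr rfl fun a _ => Finset.sum_congr rfl fun b _ => ?_
  rw [Finset.sum_comm]
  refine Finset.sum_congr rfl fun c _ => Finset.sum_congr rfl fun d _ => by ring

theorem contr4_add (F G : Fin 4 → Fin 4 → Fin 4 → Fin 4 → ℝ) (i j k l : Fin 4) :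
    contr4 E (fun a b c d => F a b c d + G a b c d) i j k l
      = contr4 E F i j k l + contr4 E G i j k l := by
  simp only [contr4, mul_add, Finset.sum_add_distrib]

theorem contr4_sub (F G : Fin 4 → Fin 4 → Fin 4 → Fin 4 → ℝ) (i j k l : Fin 4) :
    contr4 E (fun a b c d => F a b c d - G a b c d) i j k l
      = contr4 E F i j k l - contr4 E G i j k l := by
  simp only [contr4, mul_sub, Finset.sum_sub_distrib]

theorem contr4_const_mul (r : ℝ) (F : Fin 4 → Fin 4 → Fin 4 → Fin 4 → ℝ) (i j k l : Fin 4) :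
    contr4 E (fun a b c d => r * F a b c d) i j k l = r * contr4 E F i j k l := by
  simp only [contr4, Finset.mul_sum, mul_left_comm]

theorem contr4_sum {ι : Type*} [Fintype ι] (F : ι → Fin 4 → Fin 4 → Fin 4 → Fin 4 → ℝ)
    (i j k l : Fin 4) :
    contr4 E (fun a b c d => ∑ e, F e a b c d) i j k l = ∑ e, contr4 E (F e) i j k l := by
  simp only [contr4, Finset.mul_sum]
  symm
  rw [Finset.sum_comm]; refine Finset.sum_congr rfl fun a _ => ?_
  rw [Finset.sum_comm]; refine Finset.sum_congr rfl fun b _ => ?_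
  rw [Finset.sum_comm]; refine Finset.sum_congr rfl fun c _ => ?_
  rw [Finset.sum_comm]

/-- Contracting a product of arrays sharing no index. -/
theorem contr4_prod (P Q : Fin 4 → Fin 4 → ℝ) (i j k l : Fin 4) :
    contr4 E (fun a b c d => P a d * Q b c) i j k l = contr2 E P i l * contr2 E Q j k := by
  have h : ∀ a, ∑ b, ∑ c, ∑ d, E a i * E b j * E c k * E d l * (P a d * Q b c)
      = (∑ d, E a i * E d l * P a d) * ∑ b, ∑ c, E b j * E c k * Q b c := by
    intro a
    rw [Finset.sum_mul]
    simp only [Finset.mul_sum]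
    symm
    rw [Finset.sum_comm]; refine Finset.sum_congr rfl fun b _ => ?_
    rw [Finset.sum_comm]; refine Finset.sum_congr rfl fun c _ => ?_
    refine Finset.sum_congr rfl fun d _ => by ring
  simp only [contr4, contr2, h, Finset.sum_mul]

theorem contr4_prod' (P Q : Fin 4 → Fin 4 → ℝ) (i j k l : Fin 4) :
    contr4 E (fun a b c d => P b d * Q a c) i j k l = contr2 E P j l * contr2 E Q i k := by
  rw [← contr4_prod, contr4_swap12 E (fun a b c d => P a d * Q b c)]

/-- A quadratic form diagonal in the basis `F`: completing the squares. -/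
theorem sum_quadratic {α ι : Type*} [Fintype α] [Fintype ι] (K : α → α → ℝ) (H : ι → ℝ)
    (F : α → ι → ℝ) (hK : ∀ a b, K a b = ∑ i, H i * F a i * F b i) (u v : α → ℝ) :
    ∑ a, ∑ b, K a b * (u a * v b) = ∑ i, H i * ((∑ a, F a i * u a) * ∑ b, F b i * v b) := by
  simp only [hK, Finset.sum_mul, Finset.mul_sum]
  symm
  rw [Finset.sum_comm]; 
  refine (Finset.sum_congr rfl fun b _ => Finset.sum_comm).trans ?_
  rw [Finset.sum_comm]
  refine Finset.sum_congr rfl fun a _ => Finset.sum_congr rfl fun b _ =>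
    Finset.sum_congr rfl fun i _ => by ring

end contr

/-- The columns of `E` form an orthogonal frame at `x`, with `η i` the inverse squared norm of the
`i`-th vector. This is encoded as the expansion of the inverse metric, the form in which
contractions use it. -/
def IsOrthogonalFrame (g : Tensor2) (x : Fin 4 → ℝ) (E : Fin 4 → Fin 4 → ℝ) (η : Fin 4 → ℝ) :
    Prop :=
  ∀ a b, (g x)⁻¹ a b = ∑ i, η i * E a i * E b i

/-- Frame components of the first derivatives of the metric (derivative index first). -/
def frameD1 (g : Tensor2) (x : Fin 4 → ℝ) (E : Fin 4 → Fin 4 → ℝ) : Fin 4 → Fin 4 → Fin 4 → ℝ :=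
  contr3 E fun a b c => pd a (fun y => g y b c) x

/-- Frame components of the second derivatives of the metric (derivative indices first). -/
def frameD2 (g : Tensor2) (x : Fin 4 → ℝ) (E : Fin 4 → Fin 4 → ℝ) :
    Fin 4 → Fin 4 → Fin 4 → Fin 4 → ℝ :=
  contr4 E fun a b c d => pd a (pd b fun y => g y c d) x

/-- The lowered Christoffel array `γ_{m,ij}` built from the array `d` of first derivatives. -/
def gam (d : Fin 4 → Fin 4 → Fin 4 → ℝ) (m i j : Fin 4) : ℝ :=
  (1 / 2) * (d i m j + d j m i - d m i j)

/-- The expression of the covariant Riemann tensor through the first and second derivatives of the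
metric in an orthogonal frame. -/
def riemannExpr (η : Fin 4 → ℝ) (d1 : Fin 4 → Fin 4 → Fin 4 → ℝ)
    (d2 : Fin 4 → Fin 4 → Fin 4 → Fin 4 → ℝ) (i j k l : Fin 4) : ℝ :=
  (1 / 2) * (d2 j k l i - d2 j l i k - d2 i k l j + d2 i l j k)
    + ∑ m, η m * (gam d1 m i l * gam d1 m j k - gam d1 m j l * gam d1 m i k)

/-- Frame components of the covariant Riemann tensor. -/
def frameRiemann (g : Tensor2) (x : Fin 4 → ℝ) (E : Fin 4 → Fin 4 → ℝ) :
    Fin 4 → Fin 4 → Fin 4 → Fin 4 → ℝ :=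
  contr4 E fun a b c d => riemannLow g a b c d x

theorem contr3_christoffelLow (g : Tensor2) (x : Fin 4 → ℝ) (E : Fin 4 → Fin 4 → ℝ)
    (m i j : Fin 4) :
    contr3 E (fun l a c => christoffelLow g l a c x) m i j = gam (frameD1 g x E) m i j := by
  have h1 := contr3_swap12 E (fun a b c => pd a (fun y => g y b c) x) m i j
  have h2 := contr3_swap23 E (fun l a c => pd c (fun y => g y l a) x) m i j
  have h3 := contr3_swap12 E (fun a b c => pd a (fun y => g y b c) x) m j i
  have h4 : contr3 E (fun l a c => pd c (fun y => g y l a) x) m i j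
      = contr3 E (fun l c a => pd c (fun y => g y l a) x) m j i := (contr3_swap23 E
        (fun l c a => pd c (fun y => g y l a) x) m i j)
  rw [gam, frameD1, ← h1, ← h3, ← h4]
  simp only [contr3, christoffelLow, Finset.mul_sum, ← Finset.sum_add_distrib,
    ← Finset.sum_sub_distrib]
  refine Finset.sum_congr rfl fun a _ => Finset.sum_congr rfl fun b _ =>
    Finset.sum_congr rfl fun c _ => by ring

theorem sum_contr2 (E : Fin 4 → Fin 4 → ℝ) (F : Fin 4 → Fin 4 → Fin 4 → ℝ) (m i j : Fin 4) :
    ∑ e, E e m * contr2 E (F e) i j = contr3 E F m i j := by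
  simp only [contr2, contr3, Finset.mul_sum]
  refine Finset.sum_congr rfl fun a _ => Finset.sum_congr rfl fun b _ =>
    Finset.sum_congr rfl fun c _ => by ring

theorem frameRiemann_eq {g : Tensor2} {S : Set (Fin 4 → ℝ)} (h : IsSmoothMetricOn g S)
    {x : Fin 4 → ℝ} (hx : x ∈ S) {E : Fin 4 → Fin 4 → ℝ} {η : Fin 4 → ℝ}
    (hE : IsOrthogonalFrame g x E η) (i j k l : Fin 4) :
    frameRiemann g x E i j k l = riemannExpr η (frameD1 g x E) (frameD2 g x E) i j k l := by
  let D : Fin 4 → Fin 4 → Fin 4 → Fin 4 → ℝ := fun a b c d => pd a (pd b fun y => g y c d) x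
  have p1 : contr4 E (fun a b c d => pd b (pd c fun y => g y d a) x) i j k l
      = frameD2 g x E j k l i :=
    (contr4_swap12 E (fun a b c d => D a c d b) i j k l).trans
      ((contr4_swap23 E (fun a b c d => D a b d c) j i k l).trans (contr4_swap34 E D j k i l))
  have p2 : contr4 E (fun a b c d => pd b (pd d fun y => g y a c) x) i j k l
      = frameD2 g x E j l i k :=
    (contr4_swap12 E (fun a b c d => D a d b c) i j k l).trans
      ((contr4_swap34 E (fun a b c d => D a c b d) j i k l).trans (contr4_swap23 E D j i l k))
  have p3 : contr4 E (fun a b c d => pd a (pd c fun y => g y d b) x) i j k l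
      = frameD2 g x E i k l j :=
    (contr4_swap23 E (fun a b c d => D a b d c) i j k l).trans (contr4_swap34 E D i k j l)
  have p4 : contr4 E (fun a b c d => pd a (pd d fun y => g y b c) x) i j k l
      = frameD2 g x E i l j k :=
    (contr4_swap34 E (fun a b c d => D a c b d) i j k l).trans (contr4_swap23 E D i j l k)
  have hq : ∀ (P Q : Fin 4 → Fin 4 → Fin 4 → ℝ) (i j k l : Fin 4),
      ∑ e, ∑ f, (g x)⁻¹ e f * (contr2 E (P e) i l * contr2 E (Q f) j k)
        = ∑ m, η m * (contr3 E P m i l * contr3 E Q m j k) := by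
    intro P Q i j k l
    rw [sum_quadratic _ η E hE]
    simp only [sum_contr2]
  simp only [frameRiemann, riemannExpr]
  rw [show (fun a b c d => riemannLow g a b c d x) = _ from
    funext fun a => funext fun b => funext fun c => funext fun d =>
      h.riemannLow_eq_metric hx a b c d]
  rw [contr4_add, contr4_const_mul, contr4_add, contr4_sub, contr4_sub, p1, p2, p3, p4,
    contr4_sum]
  congr 1
  have : ∀ e, contr4 E (fun a b c d => ∑ f, (g x)⁻¹ e f *
      (christoffelLow g e a d x * christoffelLow g f b c x
        - christoffelLow g e b d x * christoffelLow g f a c x)) i j k l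
      = ∑ f, ((g x)⁻¹ e f * (contr2 E (fun a d => christoffelLow g e a d x) i l
          * contr2 E (fun a d => christoffelLow g f a d x) j k)
        - (g x)⁻¹ e f * (contr2 E (fun a d => christoffelLow g e a d x) j l
          * contr2 E (fun a d => christoffelLow g f a d x) i k)) := by
    intro e
    rw [contr4_sum]
    refine Finset.sum_congr rfl fun f _ => ?_
    rw [contr4_const_mul, contr4_sub, contr4_prod E (fun a d => christoffelLow g e a d x)
      (fun a d => christoffelLow g f a d x), contr4_prod' E (fun a d => christoffelLow g e a d x)
      (fun a d => christoffelLow g f a d x)]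
    ring
  simp only [this, Finset.sum_sub_distrib]
  rw [hq (fun e a d => christoffelLow g e a d x) (fun e a d => christoffelLow g e a d x),
    hq (fun e a d => christoffelLow g e a d x) (fun e a d => christoffelLow g e a d x)]
  simp only [contr3_christoffelLow, mul_sub, Finset.sum_sub_distrib]

theorem sum_mul_sum_mul_sum_mul_sum {ι : Type*} [Fintype ι] (f₁ f₂ f₃ f₄ : ι → ℝ) :
    (∑ i, f₁ i) * (∑ i, f₂ i) * (∑ i, f₃ i) * ∑ i, f₄ i
      = ∑ i, ∑ j, ∑ k, ∑ l, f₁ i * f₂ j * f₃ k * f₄ l := by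
  simp only [← Finset.mul_sum, ← Finset.sum_mul]

theorem riemannSq_eq_frame {g : Tensor2} {x : Fin 4 → ℝ} {E : Fin 4 → Fin 4 → ℝ} {η : Fin 4 → ℝ}
    (hE : IsOrthogonalFrame g x E η) :
    riemannSq g x = ∑ i, ∑ j, ∑ k, ∑ l, η i * η j * η k * η l * frameRiemann g x E i j k l ^ 2 := by
  let α := Fin 4 × Fin 4 × Fin 4 × Fin 4
  let K : α → α → ℝ := fun a b => (g x)⁻¹ a.1 b.1 * (g x)⁻¹ a.2.1 b.2.1 *
    (g x)⁻¹ a.2.2.1 b.2.2.1 * (g x)⁻¹ a.2.2.2 b.2.2.2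
  let H : α → ℝ := fun i => η i.1 * η i.2.1 * η i.2.2.1 * η i.2.2.2
  let F : α → α → ℝ := fun a i => E a.1 i.1 * E a.2.1 i.2.1 * E a.2.2.1 i.2.2.1 *
    E a.2.2.2 i.2.2.2
  have hK : ∀ a b, K a b = ∑ i, H i * F a i * F b i := by
    intro a b
    have hE' : ∀ a b, (g x)⁻¹ a b = ∑ i, η i * E a i * E b i := hE
    simp only [K, H, F, hE', α, Fintype.sum_prod_type, sum_mul_sum_mul_sum_mul_sum]
    refine Finset.sum_congr rfl fun i _ => Finset.sum_congr rfl fun j _ =>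
      Finset.sum_congr rfl fun k _ => Finset.sum_congr rfl fun l _ => by ring
  have := sum_quadratic K H F hK (fun a => riemannLow g a.1 a.2.1 a.2.2.1 a.2.2.2 x)
    (fun a => riemannLow g a.1 a.2.1 a.2.2.1 a.2.2.2 x)
  simp only [α, Fintype.sum_prod_type, K, H, F] at this
  simp only [riemannSq, frameRiemann, contr4, sq, ← mul_assoc] at this ⊢
  exact this

theorem ricci_frame {g : Tensor2} {S : Set (Fin 4 → ℝ)} (h : IsSmoothMetricOn g S)
    {x : Fin 4 → ℝ} (hx : x ∈ S) {E : Fin 4 → Fin 4 → ℝ} {η : Fin 4 → ℝ}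
    (hE : IsOrthogonalFrame g x E η) (i k : Fin 4) :
    contr2 E (ricci g x) i k = ∑ j, η j * frameRiemann g x E i j k j := by
  have hE' : ∀ a b, (g x)⁻¹ a b = ∑ i, η i * E a i * E b i := hE
  have e1 : ∀ a c, ricci g x a c = ∑ m, η m * ∑ b, ∑ d, E b m * E d m * riemannLow g a b c d x := by
    intro a c
    simp only [ricci, Matrix.of_apply, h.riemann_eq hx, hE', Finset.mul_sum]
    symm
    rw [Finset.sum_comm]; refine Finset.sum_congr rfl fun b _ => ?_
    rw [Finset.sum_comm]; refine Finset.sum_congr rfl fun d _ => ?_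
    refine Finset.sum_congr rfl fun m _ => by ring
  simp only [contr2, e1, frameRiemann, contr4, Finset.mul_sum]
  symm
  rw [Finset.sum_comm]; refine Finset.sum_congr rfl fun a _ => ?_
  calc _ = ∑ m, ∑ c, ∑ b, ∑ d, η m * (E a i * E b m * E c k * E d m * riemannLow g a b c d x) :=
        Finset.sum_congr rfl fun m _ => Finset.sum_comm
    _ = _ := by
      rw [Finset.sum_comm]
      refine Finset.sum_congr rfl fun c _ => Finset.sum_congr rfl fun m _ =>
        Finset.sum_congr rfl fun b _ => Finset.sum_congr rfl fun d _ => by ring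

theorem scalarCurv_frame {g : Tensor2} {x : Fin 4 → ℝ} {E : Fin 4 → Fin 4 → ℝ} {η : Fin 4 → ℝ}
    (hE : IsOrthogonalFrame g x E η) :
    scalarCurv g x = ∑ i, η i * contr2 E (ricci g x) i i := by
  have hE' : ∀ a b, (g x)⁻¹ a b = ∑ i, η i * E a i * E b i := hE
  simp only [scalarCurv, hE', contr2, Finset.sum_mul, Finset.mul_sum]
  symm
  rw [Finset.sum_comm]; refine Finset.sum_congr rfl fun b _ => ?_
  rw [Finset.sum_comm]; refine Finset.sum_congr rfl fun d _ => ?_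
  refine Finset.sum_congr rfl fun m _ => by ring

theorem contr2_einstein (g : Tensor2) (x : Fin 4 → ℝ) (E : Fin 4 → Fin 4 → ℝ) (i j : Fin 4) :
    contr2 E (einstein g x) i j
      = contr2 E (ricci g x) i j - scalarCurv g x / 2 * contr2 E (g x) i j := by
  simp only [contr2, einstein, Matrix.sub_apply, Matrix.smul_apply, smul_eq_mul, Finset.mul_sum,
    ← Finset.sum_sub_distrib]
  refine Finset.sum_congr rfl fun b _ => Finset.sum_congr rfl fun d _ => by ring

theorem riemannExpr_antisymm_left (η : Fin 4 → ℝ) (d1 : Fin 4 → Fin 4 → Fin 4 → ℝ)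
    (d2 : Fin 4 → Fin 4 → Fin 4 → Fin 4 → ℝ) (i j k l : Fin 4)
    (h34 : ∀ i j k l, d2 i j k l = d2 i j l k) :
    riemannExpr η d1 d2 j i k l = -riemannExpr η d1 d2 i j k l := by
  have e : ∑ m, η m * (gam d1 m j l * gam d1 m i k - gam d1 m i l * gam d1 m j k)
      = -∑ m, η m * (gam d1 m i l * gam d1 m j k - gam d1 m j l * gam d1 m i k) := by
    rw [← Finset.sum_neg_distrib]; exact Finset.sum_congr rfl fun m _ => by ring
  simp only [riemannExpr]
  rw [e, h34 i k l j, h34 i l j k, h34 j k l i, h34 j l i k]; ring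

theorem gam_symm (d : Fin 4 → Fin 4 → Fin 4 → ℝ) (h : ∀ i j k, d i j k = d i k j) (m i j : Fin 4) :
    gam d m i j = gam d m j i := by
  simp only [gam]; rw [h m i j]; ring

theorem riemannExpr_pair_symm (η : Fin 4 → ℝ) (d1 : Fin 4 → Fin 4 → Fin 4 → ℝ)
    (d2 : Fin 4 → Fin 4 → Fin 4 → Fin 4 → ℝ) (i j k l : Fin 4)
    (h1 : ∀ i j k, d1 i j k = d1 i k j)
    (h12 : ∀ i j k l, d2 i j k l = d2 j i k l) (h34 : ∀ i j k l, d2 i j k l = d2 i j l k) :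
    riemannExpr η d1 d2 k l i j = riemannExpr η d1 d2 i j k l := by
  have e : ∑ m, η m * (gam d1 m k j * gam d1 m l i - gam d1 m l j * gam d1 m k i)
      = ∑ m, η m * (gam d1 m i l * gam d1 m j k - gam d1 m j l * gam d1 m i k) := by
    refine Finset.sum_congr rfl fun m _ => ?_
    rw [gam_symm d1 h1 m k j, gam_symm d1 h1 m l i, gam_symm d1 h1 m l j, gam_symm d1 h1 m k i]
    ring
  simp only [riemannExpr]
  rw [e, h12 l i j k, h12 l j k i, h12 k i j l, h12 k j l i, h34 j l k i, h34 i l j k,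
    h34 j k l i, h34 i k j l]; ring

/-! ### Horizons in adapted normal coordinates, and their orthogonal frame -/

/-- A common frame for the two families of horizons: metrics
`-(N² - ω² p) dt² - 2 ω p dt dφ + dn² + p dφ² + 2 q dφ dz + r dz²` whose coefficients, now seen as
functions of all four coordinates, do not depend on `t`, and for which either `ω = 0` (static) or
`q = 0` and nothing depends on `φ` (axisymmetric). -/
structure KillingData where
  S : Set (Fin 4 → ℝ)
  isOpen : IsOpen S
  N : (Fin 4 → ℝ) → ℝ
  ω : (Fin 4 → ℝ) → ℝ
  p : (Fin 4 → ℝ) → ℝ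
  q : (Fin 4 → ℝ) → ℝ
  r : (Fin 4 → ℝ) → ℝ
  smooth_N : SmoothOn S N
  smooth_ω : SmoothOn S ω
  smooth_p : SmoothOn S p
  smooth_q : SmoothOn S q
  smooth_r : SmoothOn S r
  p_pos : ∀ x ∈ S, 0 < p x
  det_pos : ∀ x ∈ S, 0 < p x * r x - q x ^ 2
  pd_zero : ∀ x, pd 0 N x = 0 ∧ pd 0 ω x = 0 ∧ pd 0 p x = 0 ∧ pd 0 q x = 0 ∧ pd 0 r x = 0
  static_or_axisymmetric : (∀ x, ω x = 0) ∨
    ((∀ x, q x = 0) ∧ ∀ x, pd 2 N x = 0 ∧ pd 2 ω x = 0 ∧ pd 2 p x = 0 ∧ pd 2 r x = 0)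
  lapse_zero : ∀ x ∈ S, x 1 = 0 → N x = 0
  nonextremal : ∀ x ∈ S, x 1 = 0 → pd 1 N x ≠ 0

namespace KillingData
variable (K : KillingData)

/-- The metric. -/
def metric : Tensor2 := fun x =>
  !![-(K.N x ^ 2 - K.ω x ^ 2 * K.p x), 0, -(K.ω x * K.p x), 0;
     0, 1, 0, 0;
     -(K.ω x * K.p x), 0, K.p x, K.q x;
     0, 0, K.q x, K.r x]

/-- The region where the metric is nondegenerate. -/
def reg : Set (Fin 4 → ℝ) := {x | x ∈ K.S ∧ K.N x ≠ 0}

/-- The coefficient `g_φz / g_φφ` which makes `∂_z - b ∂_φ` orthogonal to `∂_φ`. -/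
def b (x : Fin 4 → ℝ) : ℝ := K.q x / K.p x

/-- The orthogonal frame `(∂_t + ω ∂_φ) / N`, `∂_n`, `∂_φ`, `∂_z - b ∂_φ`, as a matrix of
columns. -/
def E (x : Fin 4 → ℝ) : Fin 4 → Fin 4 → ℝ :=
  ![![1 / K.N x, 0, 0, 0], ![0, 1, 0, 0], ![K.ω x / K.N x, 0, 1, -K.b x], ![0, 0, 0, 1]]

/-- The inverse squared norms of the frame vectors. -/
def η (x : Fin 4 → ℝ) : Fin 4 → ℝ :=
  ![-1, 1, 1 / K.p x, K.p x / (K.p x * K.r x - K.q x ^ 2)]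

variable {K} {x : Fin 4 → ℝ}

theorem isOpen_reg : IsOpen K.reg :=
  K.smooth_N.continuousOn.isOpen_inter_preimage K.isOpen isOpen_ne

theorem reg_sub (hx : x ∈ K.reg) : x ∈ K.S := hx.1

theorem p_ne (hx : x ∈ K.S) : K.p x ≠ 0 := (K.p_pos x hx).ne'

theorem det_ne (hx : x ∈ K.S) : K.p x * K.r x - K.q x ^ 2 ≠ 0 := (K.det_pos x hx).ne'

theorem det_metric (x : Fin 4 → ℝ) (h : K.ω x * K.q x = 0) :
    (K.metric x).det = -(K.N x ^ 2 * (K.p x * K.r x - K.q x ^ 2)) := by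
  simp [metric, Matrix.det_succ_row_zero, Fin.sum_univ_succ, Fin.succAbove]
  linear_combination -(K.ω x * K.p x * K.q x) * h

theorem ω_mul_q (x : Fin 4 → ℝ) : K.ω x * K.q x = 0 := by
  rcases K.static_or_axisymmetric with h | ⟨h, -⟩ <;> simp [h]

theorem isSmoothMetricOn : IsSmoothMetricOn K.metric K.reg where
  isOpen := isOpen_reg
  smooth := by
    have hN : SmoothOn K.reg K.N := K.smooth_N.mono fun _ => reg_sub
    have hω : SmoothOn K.reg K.ω := K.smooth_ω.mono fun _ => reg_sub
    have hp : SmoothOn K.reg K.p := K.smooth_p.mono fun _ => reg_sub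
    have hq : SmoothOn K.reg K.q := K.smooth_q.mono fun _ => reg_sub
    have hr : SmoothOn K.reg K.r := K.smooth_r.mono fun _ => reg_sub
    have h00 : SmoothOn K.reg fun y => -(K.N y ^ 2 - K.ω y ^ 2 * K.p y) :=
      ((hN.pow 2).sub ((hω.pow 2).mul hp)).neg
    have h02 : SmoothOn K.reg fun y => -(K.ω y * K.p y) := (hω.mul hp).neg
    intro i j
    fin_cases i <;> fin_cases j <;> first
      | exact contDiffOn_const | exact h00 | exact h02 | exact hp | exact hq | exact hr
  symm := by intro y i j; fin_cases i <;> fin_cases j <;> rfl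
  det_ne := by
    intro y hy
    rw [det_metric y (ω_mul_q y), neg_ne_zero]
    exact mul_ne_zero (pow_ne_zero 2 hy.2) (det_ne hy.1)

theorem isOrthogonalFrame (hx : x ∈ K.reg) : IsOrthogonalFrame K.metric x (K.E x) (K.η x) := by
  have hN := hx.2
  have hp := p_ne hx.1
  have hd := det_ne hx.1
  have hωq := ω_mul_q (K := K) x
  have key : (K.metric x)⁻¹ = Matrix.of fun a b => ∑ i, K.η x i * K.E x a i * K.E x b i := by
    refine Matrix.inv_eq_left_inv ?_
    rcases mul_eq_zero.1 hωq with h0 | h0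
    · ext i j
      fin_cases i <;> fin_cases j <;>
        simp [Matrix.mul_apply, Fin.sum_univ_four, metric, E, η, b, h0] <;> field_simp <;> ring
    · have hr : K.r x ≠ 0 := fun h => hd (by simp [h, h0])
      ext i j
      fin_cases i <;> fin_cases j <;>
        simp [Matrix.mul_apply, Fin.sum_univ_four, metric, E, η, b, h0] <;> field_simp <;> try ring1
  intro a b
  rw [key]; rfl

end KillingData

/-! ### Derivatives of the metric of a horizon in its orthogonal frame -/

theorem contr3_eq_sum (E : Fin 4 → Fin 4 → ℝ) (F : Fin 4 → Fin 4 → Fin 4 → ℝ) (i j k : Fin 4) :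
    contr3 E F i j k = ∑ a, E a i * contr2 E (F a) j k := by
  simp only [contr2, contr3, Finset.mul_sum]
  refine Finset.sum_congr rfl fun a _ => Finset.sum_congr rfl fun b _ =>
    Finset.sum_congr rfl fun c _ => by ring

theorem contr4_eq_sum (E : Fin 4 → Fin 4 → ℝ) (F : Fin 4 → Fin 4 → Fin 4 → Fin 4 → ℝ)
    (i j k l : Fin 4) :
    contr4 E F i j k l = ∑ a, ∑ b, E a i * E b j * contr2 E (F a b) k l := by
  simp only [contr2, contr4, Finset.mul_sum]
  refine Finset.sum_congr rfl fun a _ => Finset.sum_congr rfl fun b _ =>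
    Finset.sum_congr rfl fun c _ => Finset.sum_congr rfl fun d _ => by ring

namespace KillingData
variable {K : KillingData} {x : Fin 4 → ℝ}

variable (K) in
/-- The derivative of `f` along the `i`-th frame vector. -/
def fd (f : (Fin 4 → ℝ) → ℝ) (i : Fin 4) (x : Fin 4 → ℝ) : ℝ := ∑ a, K.E x a i * pd a f x

variable (K) in
/-- The second coordinate derivatives of `f`, contracted with two frame vectors. -/
def fdd (f : (Fin 4 → ℝ) → ℝ) (i j : Fin 4) (x : Fin 4 → ℝ) : ℝ :=
  ∑ a, ∑ b, K.E x a i * K.E x b j * pd a (pd b f) x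

variable (K) in
/-- Frame components of a derivative of the metric, in terms of the derivatives of `N`, `ω`, `p`,
`q`, `r` in the same direction. -/
def tab1 (x : Fin 4 → ℝ) (N' ω' p' q' r' : ℝ) : Matrix (Fin 4) (Fin 4) ℝ :=
  !![-(2 * N' / K.N x), 0, -(K.p x * ω' / K.N x), 0;
     0, 0, 0, 0;
     -(K.p x * ω' / K.N x), 0, p', q' - K.b x * p';
     0, 0, q' - K.b x * p', r' - 2 * K.b x * q' + K.b x ^ 2 * p']

variable (K) in
/-- Frame components of a second derivative of the metric. -/
def tab2 (x : Fin 4 → ℝ) (Ni Nj Nij ωi ωj ωij pi pj pij qij rij : ℝ) :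
    Matrix (Fin 4) (Fin 4) ℝ :=
  !![-(2 * (Ni * Nj + K.N x * Nij) / K.N x ^ 2) + 2 * K.p x * (ωi * ωj) / K.N x ^ 2, 0,
       -((ωij * K.p x + ωi * pj + ωj * pi) / K.N x), 0;
     0, 0, 0, 0;
     -((ωij * K.p x + ωi * pj + ωj * pi) / K.N x), 0, pij, qij - K.b x * pij;
     0, 0, qij - K.b x * pij, rij - 2 * K.b x * qij + K.b x ^ 2 * pij]

theorem pd_metric (hx : x ∈ K.S) (a i j : Fin 4) :
    pd a (fun y => K.metric y i j) x =
    (!![-(2 * K.N x * pd a K.N x) + 2 * K.ω x * pd a K.ω x * K.p x + K.ω x ^ 2 * pd a K.p x, 0,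
          -(pd a K.ω x * K.p x + K.ω x * pd a K.p x), 0;
        0, 0, 0, 0;
        -(pd a K.ω x * K.p x + K.ω x * pd a K.p x), 0, pd a K.p x, pd a K.q x;
        0, 0, pd a K.q x, pd a K.r x] : Matrix (Fin 4) (Fin 4) ℝ) i j := by
  have hN := K.smooth_N.differentiableAt K.isOpen hx
  have hω := K.smooth_ω.differentiableAt K.isOpen hx
  have hp := K.smooth_p.differentiableAt K.isOpen hx
  have h02 : pd a (fun y => -(K.ω y * K.p y)) x = -(pd a K.ω x * K.p x + K.ω x * pd a K.p x) := by
    rw [pd_neg, pd_mul _ hω hp]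
  have h00 : pd a (fun y => -(K.N y ^ 2 - K.ω y ^ 2 * K.p y)) x
      = -(2 * K.N x * pd a K.N x) + 2 * K.ω x * pd a K.ω x * K.p x + K.ω x ^ 2 * pd a K.p x := by
    refine pd_eq_of_hasDerivAt ((((hasDerivAt_pd a hN).pow 2).sub
      (((hasDerivAt_pd a hω).pow 2).mul (hasDerivAt_pd a hp))).neg.congr_deriv ?_)
    simp only [Function.update_eq_self, Pi.pow_apply]
    push_cast; ring
  fin_cases i <;> fin_cases j <;> first | exact pd_const _ _ | exact h00 | exact h02 | rfl

theorem pd_pd_metric (hx : x ∈ K.S) (a b i j : Fin 4) :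
    pd a (pd b fun y => K.metric y i j) x =
    (!![-(2 * (pd a K.N x * pd b K.N x + K.N x * pd a (pd b K.N) x))
          + 2 * (pd a K.ω x * pd b K.ω x * K.p x + K.ω x * pd a (pd b K.ω) x * K.p x
            + K.ω x * pd b K.ω x * pd a K.p x + K.ω x * pd a K.ω x * pd b K.p x)
            + K.ω x ^ 2 * pd a (pd b K.p) x, 0,
          -(pd a (pd b K.ω) x * K.p x + pd b K.ω x * pd a K.p x
            + pd a K.ω x * pd b K.p x + K.ω x * pd a (pd b K.p) x), 0;
        0, 0, 0, 0;
        -(pd a (pd b K.ω) x * K.p x + pd b K.ω x * pd a K.p x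
            + pd a K.ω x * pd b K.p x + K.ω x * pd a (pd b K.p) x), 0,
          pd a (pd b K.p) x, pd a (pd b K.q) x;
        0, 0, pd a (pd b K.q) x, pd a (pd b K.r) x] : Matrix (Fin 4) (Fin 4) ℝ) i j := by
  rw [pd_congr_on K.isOpen hx a fun y hy => pd_metric hy b i j]
  have hN := hasDerivAt_pd a (K.smooth_N.differentiableAt K.isOpen hx)
  have hω := hasDerivAt_pd a (K.smooth_ω.differentiableAt K.isOpen hx)
  have hp := hasDerivAt_pd a (K.smooth_p.differentiableAt K.isOpen hx)
  have hN' := hasDerivAt_pd a ((K.smooth_N.pd K.isOpen b).differentiableAt K.isOpen hx)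
  have hω' := hasDerivAt_pd a ((K.smooth_ω.pd K.isOpen b).differentiableAt K.isOpen hx)
  have hp' := hasDerivAt_pd a ((K.smooth_p.pd K.isOpen b).differentiableAt K.isOpen hx)
  have h02 : pd a (fun x => -(pd b K.ω x * K.p x + K.ω x * pd b K.p x)) x
      = -(pd a (pd b K.ω) x * K.p x + pd b K.ω x * pd a K.p x
            + pd a K.ω x * pd b K.p x + K.ω x * pd a (pd b K.p) x) := by
    refine pd_eq_of_hasDerivAt (((hω'.mul hp).add (hω.mul hp')).neg.congr_deriv ?_)
    simp only [Function.update_eq_self]; ring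
  have h00 : pd a (fun x => -(2 * K.N x * pd b K.N x) + 2 * K.ω x * pd b K.ω x * K.p x
        + K.ω x ^ 2 * pd b K.p x) x
      = -(2 * (pd a K.N x * pd b K.N x + K.N x * pd a (pd b K.N) x))
          + 2 * (pd a K.ω x * pd b K.ω x * K.p x + K.ω x * pd a (pd b K.ω) x * K.p x
            + K.ω x * pd b K.ω x * pd a K.p x + K.ω x * pd a K.ω x * pd b K.p x)
            + K.ω x ^ 2 * pd a (pd b K.p) x := by
    refine pd_eq_of_hasDerivAt (((((hN.const_mul 2).mul hN').neg.add
      (((hω.const_mul 2).mul hω').mul hp)).add ((hω.pow 2).mul hp')).congr_deriv ?_)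
    simp only [Function.update_eq_self, Pi.pow_apply, Pi.mul_apply]
    push_cast; ring
  fin_cases i <;> fin_cases j <;> first | exact pd_const _ _ | exact h00 | exact h02 | rfl

theorem pd_eq_zero_of_forall {f : (Fin 4 → ℝ) → ℝ} (h : ∀ x, f x = 0) (a : Fin 4) (x : Fin 4 → ℝ) :
    pd a f x = 0 := by
  rw [show f = fun _ => 0 from funext h, pd_const]

theorem ω_mul_pd_q (a : Fin 4) (x : Fin 4 → ℝ) : K.ω x * pd a K.q x = 0 := by
  rcases K.static_or_axisymmetric with h | ⟨h, -⟩
  · rw [h, zero_mul]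
  · rw [pd_eq_zero_of_forall h, mul_zero]

theorem ω_mul_pd_pd_q (a b : Fin 4) (x : Fin 4 → ℝ) : K.ω x * pd a (pd b K.q) x = 0 := by
  rcases K.static_or_axisymmetric with h | ⟨h, -⟩
  · rw [h, zero_mul]
  · rw [pd_eq_zero_of_forall (pd_eq_zero_of_forall h b), mul_zero]

theorem b_mul_pd_ω (a : Fin 4) (x : Fin 4 → ℝ) : K.b x * pd a K.ω x = 0 := by
  rcases K.static_or_axisymmetric with h | ⟨h, -⟩
  · rw [pd_eq_zero_of_forall h, mul_zero]
  · rw [b, h, zero_div, zero_mul]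

theorem b_mul_pd_pd_ω (a b : Fin 4) (x : Fin 4 → ℝ) : K.b x * pd a (pd b K.ω) x = 0 := by
  rcases K.static_or_axisymmetric with h | ⟨h, -⟩
  · rw [pd_eq_zero_of_forall (pd_eq_zero_of_forall h b), mul_zero]
  · rw [KillingData.b, h, zero_div, zero_mul]

theorem contr2_pd_metric (hx : x ∈ K.reg) (a k l : Fin 4) :
    contr2 (K.E x) (fun i j => pd a (fun y => K.metric y i j) x) k l
      = K.tab1 x (pd a K.N x) (pd a K.ω x) (pd a K.p x) (pd a K.q x) (pd a K.r x) k l := by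
  have hN := hx.2
  have h1 := ω_mul_pd_q (K := K) a x
  have h2 := b_mul_pd_ω (K := K) a x
  simp only [pd_metric hx.1, contr2, tab1]
  fin_cases k <;> fin_cases l <;> simp [Fin.sum_univ_four, E] <;> field_simp <;> try ring1
  all_goals linear_combination K.p x * h2 + h1

theorem contr2_pd_pd_metric (hx : x ∈ K.reg) (a b k l : Fin 4) :
    contr2 (K.E x) (fun i j => pd a (pd b fun y => K.metric y i j) x) k l
      = K.tab2 x (pd a K.N x) (pd b K.N x) (pd a (pd b K.N) x) (pd a K.ω x) (pd b K.ω x)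
        (pd a (pd b K.ω) x) (pd a K.p x) (pd b K.p x) (pd a (pd b K.p) x) (pd a (pd b K.q) x)
        (pd a (pd b K.r) x) k l := by
  have hN := hx.2
  have h1 := ω_mul_pd_pd_q (K := K) a b x
  have h2 := b_mul_pd_ω (K := K) a x
  have h3 := b_mul_pd_ω (K := K) b x
  have h4 := b_mul_pd_pd_ω (K := K) a b x
  simp only [pd_pd_metric hx.1, contr2, tab2]
  fin_cases k <;> fin_cases l <;> simp [Fin.sum_univ_four, E] <;> field_simp <;> try ring1
  all_goals linear_combination K.p x * h4 + h1 + pd b K.p x * h2 + pd a K.p x * h3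

theorem frameD1_eq (hx : x ∈ K.reg) (i k l : Fin 4) :
    frameD1 K.metric x (K.E x) i k l = K.tab1 x (K.fd K.N i x) (K.fd K.ω i x) (K.fd K.p i x)
      (K.fd K.q i x) (K.fd K.r i x) k l := by
  rw [frameD1, contr3_eq_sum]
  simp only [contr2_pd_metric hx, fd, Fin.sum_univ_four]
  fin_cases k <;> fin_cases l <;> simp [tab1] <;> ring

set_option maxHeartbeats 1000000 in
theorem frameD2_eq (hx : x ∈ K.reg) (i j k l : Fin 4) :
    frameD2 K.metric x (K.E x) i j k l = K.tab2 x (K.fd K.N i x) (K.fd K.N j x) (K.fdd K.N i j x)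
      (K.fd K.ω i x) (K.fd K.ω j x) (K.fdd K.ω i j x) (K.fd K.p i x) (K.fd K.p j x)
      (K.fdd K.p i j x) (K.fdd K.q i j x) (K.fdd K.r i j x) k l := by
  rw [frameD2, contr4_eq_sum]
  simp only [contr2_pd_pd_metric hx, fd, fdd, Fin.sum_univ_four]
  fin_cases k <;> fin_cases l <;> simp [tab2] <;> ring

end KillingData

/-! ### The Riemann tensor of a horizon in its orthogonal frame -/

theorem frameD1_symm {g : Tensor2} {S : Set (Fin 4 → ℝ)} (h : IsSmoothMetricOn g S)
    (x : Fin 4 → ℝ) (E : Fin 4 → Fin 4 → ℝ) (i j k : Fin 4) :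
    frameD1 g x E i j k = frameD1 g x E i k j := by
  have e : (fun a b c => pd a (fun y => g y b c) x) = fun a b c => pd a (fun y => g y c b) x := by
    ext a b c; congr 1; ext y; exact h.symm y b c
  rw [frameD1, e, contr3_swap23 E (fun a b c => pd a (fun y => g y b c) x), ← e]

theorem frameD2_symm_right {g : Tensor2} {S : Set (Fin 4 → ℝ)} (h : IsSmoothMetricOn g S)
    (x : Fin 4 → ℝ) (E : Fin 4 → Fin 4 → ℝ) (i j k l : Fin 4) :
    frameD2 g x E i j k l = frameD2 g x E i j l k := by
  have e : (fun a b c d => pd a (pd b fun y => g y c d) x)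
      = fun a b c d => pd a (pd b fun y => g y d c) x := by
    ext a b c d; congr 2; ext y; exact h.symm y c d
  rw [frameD2, e, contr4_swap34 E (fun a b c d => pd a (pd b fun y => g y c d) x), ← e]

theorem frameD2_symm_left {g : Tensor2} {S : Set (Fin 4 → ℝ)} (h : IsSmoothMetricOn g S)
    {x : Fin 4 → ℝ} (hx : x ∈ S) (E : Fin 4 → Fin 4 → ℝ) (i j k l : Fin 4) :
    frameD2 g x E i j k l = frameD2 g x E j i k l := by
  have e : (fun a b c d => pd a (pd b fun y => g y c d) x)
      = fun a b c d => pd b (pd a fun y => g y c d) x := by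
    ext a b c d; exact pd_comm h.isOpen (h.smooth c d) hx a b
  rw [frameD2, e, contr4_swap12 E (fun a b c d => pd a (pd b fun y => g y c d) x), ← e]

namespace KillingData
variable {K : KillingData} {x : Fin 4 → ℝ}

variable (K) in
/-- The functions to which the two symmetries apply: smooth, independent of `t`, and independent of
`φ` unless the metric is static. -/
def Inv (f : (Fin 4 → ℝ) → ℝ) : Prop :=
  SmoothOn K.S f ∧ (∀ x, pd 0 f x = 0) ∧ ((∀ x, K.ω x = 0) ∨ ∀ x, pd 2 f x = 0)

theorem inv_N : K.Inv K.N :=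
  ⟨K.smooth_N, fun x => (K.pd_zero x).1, K.static_or_axisymmetric.imp id fun h x => (h.2 x).1⟩

theorem inv_ω : K.Inv K.ω :=
  ⟨K.smooth_ω, fun x => (K.pd_zero x).2.1, K.static_or_axisymmetric.imp id fun h x => (h.2 x).2.1⟩

theorem inv_p : K.Inv K.p :=
  ⟨K.smooth_p, fun x => (K.pd_zero x).2.2.1,
    K.static_or_axisymmetric.imp id fun h x => (h.2 x).2.2.1⟩

theorem inv_q : K.Inv K.q :=
  ⟨K.smooth_q, fun x => (K.pd_zero x).2.2.2.1,
    K.static_or_axisymmetric.imp id fun h => pd_eq_zero_of_forall h.1 2⟩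

theorem inv_r : K.Inv K.r :=
  ⟨K.smooth_r, fun x => (K.pd_zero x).2.2.2.2,
    K.static_or_axisymmetric.imp id fun h x => (h.2 x).2.2.2⟩

theorem fd_zero {f : (Fin 4 → ℝ) → ℝ} (hf : K.Inv f) (x : Fin 4 → ℝ) : K.fd f 0 x = 0 := by
  rcases hf.2.2 with h | h <;> simp [fd, Fin.sum_univ_four, E, hf.2.1, h]

theorem fdd_zero_left {f : (Fin 4 → ℝ) → ℝ} (hf : K.Inv f) (hx : x ∈ K.S) (j : Fin 4) :
    K.fdd f 0 j x = 0 := by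
  have h0 : ∀ b, pd 0 (pd b f) x = 0 := fun b => by
    rw [pd_comm K.isOpen hf.1 hx, pd_eq_zero_of_forall hf.2.1]
  rcases hf.2.2 with h | h
  · simp [fdd, Fin.sum_univ_four, E, h0, h]
  · have h2 : ∀ b, pd 2 (pd b f) x = 0 := fun b => by
      rw [pd_comm K.isOpen hf.1 hx, pd_eq_zero_of_forall h]
    simp [fdd, Fin.sum_univ_four, E, h0, h2]

theorem fdd_symm {f : (Fin 4 → ℝ) → ℝ} (hf : SmoothOn K.S f) (hx : x ∈ K.S) (i j : Fin 4) :
    K.fdd f i j x = K.fdd f j i x := by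
  unfold fdd
  rw [Finset.sum_comm]
  refine Finset.sum_congr rfl fun a _ => Finset.sum_congr rfl fun b _ => ?_
  rw [pd_comm K.isOpen hf hx]; ring

theorem fdd_zero_right {f : (Fin 4 → ℝ) → ℝ} (hf : K.Inv f) (hx : x ∈ K.S) (i : Fin 4) :
    K.fdd f i 0 x = 0 := by rw [fdd_symm hf.1 hx, fdd_zero_left hf hx]

variable (K) in
/-- Frame components of the first derivatives of the metric. -/
def G1 (i j k : Fin 4) (x : Fin 4 → ℝ) : ℝ :=
  K.tab1 x (K.fd K.N i x) (K.fd K.ω i x) (K.fd K.p i x) (K.fd K.q i x) (K.fd K.r i x) j k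

variable (K) in
/-- Frame components of the second derivatives of the metric. -/
def G2 (i j k l : Fin 4) (x : Fin 4 → ℝ) : ℝ :=
  K.tab2 x (K.fd K.N i x) (K.fd K.N j x) (K.fdd K.N i j x)
      (K.fd K.ω i x) (K.fd K.ω j x) (K.fdd K.ω i j x) (K.fd K.p i x) (K.fd K.p j x)
      (K.fdd K.p i j x) (K.fdd K.q i j x) (K.fdd K.r i j x) k l

variable (K) in
/-- The Christoffel array of the frame. -/
def Γ (m i j : Fin 4) (x : Fin 4 → ℝ) : ℝ := gam (fun i j k => K.G1 i j k x) m i j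

variable (K) in
/-- Frame components of the Riemann tensor. -/
def Rm (i j k l : Fin 4) (x : Fin 4 → ℝ) : ℝ := frameRiemann K.metric x (K.E x) i j k l

theorem Rm_eq (hx : x ∈ K.reg) (i j k l : Fin 4) : K.Rm i j k l x =
    (1 / 2) * (K.G2 j k l i x - K.G2 j l i k x - K.G2 i k l j x + K.G2 i l j k x)
    + ∑ m, K.η x m * (K.Γ m i l x * K.Γ m j k x - K.Γ m j l x * K.Γ m i k x) := by
  have e1 : frameD1 K.metric x (K.E x) = fun i j k => K.G1 i j k x := by
    ext i j k; exact frameD1_eq hx i j k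
  have e2 : frameD2 K.metric x (K.E x) = fun i j k l => K.G2 i j k l x := by
    ext i j k l; exact frameD2_eq hx i j k l
  rw [Rm, frameRiemann_eq isSmoothMetricOn hx (isOrthogonalFrame hx), e1, e2]
  rfl

theorem Rm_swap (hx : x ∈ K.reg) (i j k l : Fin 4) : K.Rm j i k l x = -K.Rm i j k l x := by
  simp only [Rm, frameRiemann_eq isSmoothMetricOn hx (isOrthogonalFrame hx)]
  exact riemannExpr_antisymm_left _ _ _ _ _ _ _
    fun i j k l => frameD2_symm_right isSmoothMetricOn x _ i j k l

theorem Rm_pair (hx : x ∈ K.reg) (i j k l : Fin 4) : K.Rm k l i j x = K.Rm i j k l x := by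
  simp only [Rm, frameRiemann_eq isSmoothMetricOn hx (isOrthogonalFrame hx)]
  exact riemannExpr_pair_symm _ _ _ _ _ _ _
    (fun i j k => frameD1_symm isSmoothMetricOn x _ i j k)
    (fun i j k l => frameD2_symm_left isSmoothMetricOn hx _ i j k l)
    fun i j k l => frameD2_symm_right isSmoothMetricOn x _ i j k l

theorem Rm_swap' (hx : x ∈ K.reg) (i j k l : Fin 4) : K.Rm i j l k x = -K.Rm i j k l x := by
  rw [← Rm_pair hx, Rm_swap hx, Rm_pair hx]

theorem Rm_self (hx : x ∈ K.reg) (i k l : Fin 4) : K.Rm i i k l x = 0 := by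
  have := Rm_swap hx i i k l; linarith

theorem Rm_self' (hx : x ∈ K.reg) (i j k : Fin 4) : K.Rm i j k k x = 0 := by
  rw [← Rm_pair hx, Rm_self hx]

theorem G1_zero (x : Fin 4 → ℝ) (j k : Fin 4) : K.G1 0 j k x = 0 := by
  simp only [G1, fd_zero inv_N, fd_zero inv_ω, fd_zero inv_p, fd_zero inv_q, fd_zero inv_r, tab1]
  fin_cases j <;> fin_cases k <;> simp

theorem G1_symm (x : Fin 4 → ℝ) (i j k : Fin 4) : K.G1 i j k x = K.G1 i k j x := by
  simp only [G1, tab1]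
  fin_cases j <;> fin_cases k <;> rfl

theorem G2_zero_left (hx : x ∈ K.S) (j k l : Fin 4) : K.G2 0 j k l x = 0 := by
  simp only [G2, fd_zero inv_N, fd_zero inv_ω, fd_zero inv_p, fdd_zero_left inv_N hx,
    fdd_zero_left inv_ω hx, fdd_zero_left inv_p hx, fdd_zero_left inv_q hx,
    fdd_zero_left inv_r hx, tab2]
  fin_cases k <;> fin_cases l <;> simp

theorem G2_zero_right (hx : x ∈ K.S) (j k l : Fin 4) : K.G2 j 0 k l x = 0 := by
  simp only [G2, fd_zero inv_N, fd_zero inv_ω, fd_zero inv_p, fdd_zero_right inv_N hx,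
    fdd_zero_right inv_ω hx, fdd_zero_right inv_p hx, fdd_zero_right inv_q hx,
    fdd_zero_right inv_r hx, tab2]
  fin_cases k <;> fin_cases l <;> simp

theorem G1_00 (x : Fin 4 → ℝ) (i : Fin 4) : K.G1 i 0 0 x = -(2 * K.fd K.N i x / K.N x) := rfl

theorem G1_0 (x : Fin 4 → ℝ) (i : Fin 4) {k : Fin 4} (hk : k ≠ 0) :
    K.G1 i 0 k x = if k = 2 then -(K.p x * K.fd K.ω i x / K.N x) else 0 := by
  fin_cases k <;> first | exact absurd rfl hk | rfl

theorem G2_00 (x : Fin 4 → ℝ) (i j : Fin 4) : K.G2 i j 0 0 x =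
    -(2 * (K.fd K.N i x * K.fd K.N j x + K.N x * K.fdd K.N i j x) / K.N x ^ 2)
      + 2 * K.p x * (K.fd K.ω i x * K.fd K.ω j x) / K.N x ^ 2 := rfl

theorem G2_0 (x : Fin 4 → ℝ) (i j : Fin 4) {k : Fin 4} (hk : k ≠ 0) :
    K.G2 i j 0 k x = if k = 2 then -((K.fdd K.ω i j x * K.p x + K.fd K.ω i x * K.fd K.p j x
      + K.fd K.ω j x * K.fd K.p i x) / K.N x) else 0 := by
  fin_cases k <;> first | exact absurd rfl hk | rfl

theorem G2_symm (x : Fin 4 → ℝ) (i j k l : Fin 4) : K.G2 i j k l x = K.G2 i j l k x := by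
  simp only [G2, tab2]
  fin_cases k <;> fin_cases l <;> rfl

variable (K) in
/-- The Hessian of the lapse in the frame. -/
def hessN (i j : Fin 4) (x : Fin 4 → ℝ) : ℝ :=
  K.fdd K.N i j x - (K.η x 1 * K.Γ 1 i j x * K.fd K.N 1 x + K.η x 2 * K.Γ 2 i j x * K.fd K.N 2 x
    + K.η x 3 * K.Γ 3 i j x * K.fd K.N 3 x)

variable (K) in
/-- The antisymmetrised mixed derivatives of the metric, caused by the differential rotation. -/
def twist (i j : Fin 4) (x : Fin 4 → ℝ) : ℝ := K.G1 i 0 j x - K.G1 j 0 i x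

variable (K) in
/-- The symmetrised mixed derivatives of the metric: the extrinsic curvature of the slices of
constant `t`, up to a factor. -/
def shear (i j : Fin 4) (x : Fin 4 → ℝ) : ℝ := K.G1 i 0 j x + K.G1 j 0 i x

theorem Γ_zero (x : Fin 4 → ℝ) (i j : Fin 4) : K.Γ 0 i j x = (1 / 2) * K.shear i j x := by
  simp only [Γ, gam, G1_zero, shear]; ring

theorem Γ_0right (x : Fin 4 → ℝ) (m i : Fin 4) : K.Γ m 0 i x = (1 / 2) * K.twist i m x := by
  simp only [Γ, gam, G1_zero, twist]; rw [G1_symm x i m 0]; ring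

theorem Γ_symm (x : Fin 4 → ℝ) (m i j : Fin 4) : K.Γ m i j x = K.Γ m j i x :=
  gam_symm _ (fun i j k => G1_symm x i j k) m i j

/-- The electric part of the Riemann tensor: the Hessian of the lapse plus rotation terms. -/
theorem Rm_electric (hx : x ∈ K.reg) (i j : Fin 4) : K.Rm 0 i 0 j x =
    K.hessN i j x / K.N x - K.p x * (K.fd K.ω i x / K.N x) * (K.fd K.ω j x / K.N x)
    + (1 / 4) * (K.η x 1 * K.twist i 1 x * K.twist j 1 x + K.η x 2 * K.twist i 2 x * K.twist j 2 x
      + K.η x 3 * K.twist i 3 x * K.twist j 3 x) := by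
  have hN := hx.2
  have hη : K.η x 0 = -1 := rfl
  rw [Rm_eq hx, Fin.sum_univ_four, Γ_symm x _ i 0, G2_zero_left hx.1, G2_zero_right hx.1,
    G2_zero_left hx.1, G2_00]
  have t0 : ∀ i, K.twist i 0 x = -(2 * K.fd K.N i x / K.N x) := by
    intro i; simp only [twist, G1_zero, G1_00, sub_zero]
  have t1 : ∀ i, K.twist 0 i x = 2 * K.fd K.N i x / K.N x := by
    intro i; simp only [twist, G1_zero, G1_00, zero_sub, neg_neg]
  simp only [hη, Γ_symm x _ i 0, Γ_0right, hessN, Γ_zero, t0, t1, fd_zero inv_N]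
  field_simp
  ring

/-- The spatial part of the Riemann tensor: the Riemann tensor of the slice and the terms of the
Gauss equation. -/
theorem Rm_spatial (hx : x ∈ K.reg) (i j k l : Fin 4) : K.Rm i j k l x =
    (1 / 2) * (K.G2 j k l i x - K.G2 j l i k x - K.G2 i k l j x + K.G2 i l j k x)
    + (K.η x 1 * (K.Γ 1 i l x * K.Γ 1 j k x - K.Γ 1 j l x * K.Γ 1 i k x)
      + K.η x 2 * (K.Γ 2 i l x * K.Γ 2 j k x - K.Γ 2 j l x * K.Γ 2 i k x)
      + K.η x 3 * (K.Γ 3 i l x * K.Γ 3 j k x - K.Γ 3 j l x * K.Γ 3 i k x))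
    - (1 / 4) * (K.shear i l x * K.shear j k x - K.shear j l x * K.shear i k x) := by
  have hη : K.η x 0 = -1 := rfl
  rw [Rm_eq hx, Fin.sum_univ_four]
  simp only [hη, Γ_zero]; ring

variable (K) in
/-- Frame components of the coordinate derivatives of `∂ω / N`. -/
def rot (i j : Fin 4) (x : Fin 4 → ℝ) : ℝ :=
  (K.fdd K.ω i j x * K.N x - K.fd K.ω i x * K.fd K.N j x) / K.N x ^ 2

variable (K) in
/-- The products of derivatives of `ω` and `p` which enter the magnetic part of the Riemann
tensor. -/
def rotp (i j : Fin 4) (x : Fin 4 → ℝ) : ℝ :=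
  K.fd K.ω i x / K.N x * K.fd K.p j x + K.fd K.ω j x / K.N x * K.fd K.p i x

/-- The magnetic part of the Riemann tensor: the Codazzi equation. -/
theorem Rm_magnetic (hx : x ∈ K.reg) {j k l : Fin 4} (hj : j ≠ 0) (hk : k ≠ 0) (hl : l ≠ 0) :
    K.Rm 0 j k l x =
    (1 / 2) * ((if k = 2 then K.p x * K.rot j l x + K.rotp j l x else 0)
      - (if l = 2 then K.p x * K.rot j k x + K.rotp j k x else 0)
      + if j = 2 then K.p x * (K.rot k l x - K.rot l k x) else 0)
    + (1 / 2) * (K.η x 1 * (K.twist l 1 x * K.Γ 1 j k x - K.twist k 1 x * K.Γ 1 j l x)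
      + K.η x 2 * (K.twist l 2 x * K.Γ 2 j k x - K.twist k 2 x * K.Γ 2 j l x)
      + K.η x 3 * (K.twist l 3 x * K.Γ 3 j k x - K.twist k 3 x * K.Γ 3 j l x)) := by
  have hN := hx.2
  have hη : K.η x 0 = -1 := rfl
  have t0 : ∀ i, K.twist i 0 x = -(2 * K.fd K.N i x / K.N x) := by
    intro i; simp only [twist, G1_zero, G1_00, sub_zero]
  have s := fdd_symm K.smooth_ω hx.1 l k
  rw [Rm_eq hx, Fin.sum_univ_four, G2_zero_left hx.1, G2_zero_left hx.1, G2_symm x j k l 0,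
    G2_0 x j k hl, G2_0 x j l hk]
  simp only [hη, Γ_0right, Γ_zero, t0, shear, G1_0 x _ hj, G1_0 x _ hk, G1_0 x _ hl, rot, rotp]
  rw [s]
  split_ifs <;> field_simp <;> ring

end KillingData

/-! ### Limits along the normal lines -/

section limits
variable {f g : (Fin 4 → ℝ) → ℝ} {y : Fin 4 → ℝ} {l m : ℝ}

theorem HasHorizonLimit.add (hf : HasHorizonLimit f y l) (hg : HasHorizonLimit g y m) :
    HasHorizonLimit (fun x => f x + g x) y (l + m) := Tendsto.add hf hg

theorem HasHorizonLimit.sub (hf : HasHorizonLimit f y l) (hg : HasHorizonLimit g y m) :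
    HasHorizonLimit (fun x => f x - g x) y (l - m) := Tendsto.sub hf hg

theorem HasHorizonLimit.mul (hf : HasHorizonLimit f y l) (hg : HasHorizonLimit g y m) :
    HasHorizonLimit (fun x => f x * g x) y (l * m) := Tendsto.mul hf hg

theorem HasHorizonLimit.pow (hf : HasHorizonLimit f y l) (n : ℕ) :
    HasHorizonLimit (fun x => f x ^ n) y (l ^ n) := Tendsto.pow hf n

theorem HasHorizonLimit.neg (hf : HasHorizonLimit f y l) :
    HasHorizonLimit (fun x => -f x) y (-l) := Tendsto.neg hf

theorem HasHorizonLimit.const (c : ℝ) : HasHorizonLimit (fun _ => c) y c := tendsto_const_nhds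

theorem HasHorizonLimit.sum {ι : Type*} (s : Finset ι) {F : ι → (Fin 4 → ℝ) → ℝ} {L : ι → ℝ}
    (h : ∀ i ∈ s, HasHorizonLimit (F i) y (L i)) :
    HasHorizonLimit (fun x => ∑ i ∈ s, F i x) y (∑ i ∈ s, L i) := tendsto_finsetSum s h

theorem HasHorizonLimit.unique (hf : HasHorizonLimit f y l) (hg : HasHorizonLimit f y m) :
    l = m := tendsto_nhds_unique hf hg

/-- `f` has a finite limit as `y` is approached along the normal line. -/
def Converges (f : (Fin 4 → ℝ) → ℝ) (y : Fin 4 → ℝ) : Prop := ∃ l, HasHorizonLimit f y l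

theorem HasHorizonLimit.converges (hf : HasHorizonLimit f y l) : Converges f y := ⟨l, hf⟩

theorem Converges.add (hf : Converges f y) (hg : Converges g y) :
    Converges (fun x => f x + g x) y := by
  obtain ⟨_, hf⟩ := hf; obtain ⟨_, hg⟩ := hg; exact ⟨_, hf.add hg⟩

theorem Converges.sub (hf : Converges f y) (hg : Converges g y) :
    Converges (fun x => f x - g x) y := by
  obtain ⟨_, hf⟩ := hf; obtain ⟨_, hg⟩ := hg; exact ⟨_, hf.sub hg⟩

theorem Converges.mul (hf : Converges f y) (hg : Converges g y) :
    Converges (fun x => f x * g x) y := by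
  obtain ⟨_, hf⟩ := hf; obtain ⟨_, hg⟩ := hg; exact ⟨_, hf.mul hg⟩

theorem Converges.pow (hf : Converges f y) (n : ℕ) : Converges (fun x => f x ^ n) y := by
  obtain ⟨_, hf⟩ := hf; exact ⟨_, hf.pow n⟩

theorem Converges.neg (hf : Converges f y) : Converges (fun x => -f x) y := by
  obtain ⟨_, hf⟩ := hf; exact ⟨_, hf.neg⟩

theorem Converges.const (c : ℝ) : Converges (fun _ => c) y := ⟨c, .const c⟩

theorem Converges.sum {ι : Type*} (s : Finset ι) {F : ι → (Fin 4 → ℝ) → ℝ}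
    (h : ∀ i ∈ s, Converges (F i) y) : Converges (fun x => ∑ i ∈ s, F i x) y := by
  choose! L hL using h
  exact ⟨_, HasHorizonLimit.sum s hL⟩

end limits

namespace KillingData
variable {K : KillingData} {f g : (Fin 4 → ℝ) → ℝ} {x y : Fin 4 → ℝ} {l : ℝ}

variable (K) in
/-- The horizon `n = 0`. -/
def hor : Set (Fin 4 → ℝ) := {y | y ∈ K.S ∧ y 1 = 0}

theorem update_zero (hy : y ∈ K.hor) : Function.update y 1 (0 : ℝ) = y := by
  conv_lhs => rw [← hy.2, Function.update_eq_self]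

theorem hasDerivAt_normal (hf : SmoothOn K.S f) (hy : y ∈ K.hor) :
    HasDerivAt (fun n => f (Function.update y 1 n)) (pd 1 f y) 0 := by
  have := hasDerivAt_pd 1 (hf.differentiableAt K.isOpen hy.1)
  rwa [hy.2] at this

theorem eventually_S (hy : y ∈ K.hor) : ∀ᶠ n : ℝ in 𝓝 0, Function.update y 1 n ∈ K.S := by
  have hc : ContinuousAt (fun n : ℝ => Function.update y 1 n) 0 :=
    (hasDerivAt_update y 1 (0 : ℝ)).continuousAt
  apply hc.preimage_mem_nhds
  rw [update_zero hy]
  exact K.isOpen.mem_nhds hy.1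

/-- Non-extremality: `N` does not vanish off the horizon, near it. -/
theorem eventually_reg (hy : y ∈ K.hor) :
    ∀ᶠ n : ℝ in 𝓝[>] 0, Function.update y 1 n ∈ K.reg := by
  have h1 := (eventually_S hy).filter_mono (nhdsWithin_le_nhds (s := Ioi (0 : ℝ)))
  have h2 := (hasDerivAt_normal K.smooth_N hy).eventually_ne (c := 0) (K.nonextremal y hy.1 hy.2)
  have h3 : ∀ᶠ n : ℝ in 𝓝[>] 0, K.N (Function.update y 1 n) ≠ 0 :=
    h2.filter_mono (nhdsWithin_mono _ fun n (hn : 0 < n) => hn.ne')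
  filter_upwards [h1, h3] with n a b using ⟨a, b⟩

theorem limit_congr (hy : y ∈ K.hor) (h : ∀ x ∈ K.reg, f x = g x) (hg : HasHorizonLimit g y l) :
    HasHorizonLimit f y l := by
  refine Tendsto.congr' ?_ hg
  filter_upwards [eventually_reg hy] with n hn using (h _ hn).symm

theorem converges_congr (hy : y ∈ K.hor) (h : ∀ x ∈ K.reg, f x = g x) (hg : Converges g y) :
    Converges f y := by
  obtain ⟨l, hg⟩ := hg; exact ⟨l, limit_congr hy h hg⟩

theorem limit_smooth (hy : y ∈ K.hor) (hf : SmoothOn K.S f) : HasHorizonLimit f y (f y) := by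
  have := (hasDerivAt_normal hf hy).continuousAt.tendsto
  rw [update_zero hy] at this
  exact this.mono_left nhdsWithin_le_nhds

theorem converges_smooth (hy : y ∈ K.hor) (hf : SmoothOn K.S f) : Converges f y :=
  (limit_smooth hy hf).converges

theorem N_hor (hy : y ∈ K.hor) : K.N y = 0 := K.lapse_zero y hy.1 hy.2

theorem κ_ne (hy : y ∈ K.hor) : pd 1 K.N y ≠ 0 := K.nonextremal y hy.1 hy.2

theorem limit_div_normal (hy : y ∈ K.hor) (hf : SmoothOn K.S f) (h0 : f y = 0) :
    Tendsto (fun n => f (Function.update y 1 n) / n) (𝓝[>] 0) (𝓝 (pd 1 f y)) := by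
  have h := (hasDerivAt_iff_tendsto_slope_zero.1 (hasDerivAt_normal hf hy)).mono_left
    (nhdsWithin_mono 0 fun n (hn : 0 < n) => hn.ne')
  refine h.congr fun n => ?_
  simp only [zero_add, update_zero hy, h0, sub_zero, smul_eq_mul]
  rw [div_eq_inv_mul]

theorem limit_div (hy : y ∈ K.hor) (hf : SmoothOn K.S f) (h0 : f y = 0) :
    HasHorizonLimit (fun x => f x / K.N x) y (pd 1 f y / pd 1 K.N y) := by
  have h := (limit_div_normal hy hf h0).div (limit_div_normal hy K.smooth_N (N_hor hy)) (κ_ne hy)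
  refine h.congr' ?_
  filter_upwards [self_mem_nhdsWithin] with n (hn : 0 < n)
  have := hn.ne'
  simp only [Pi.div_apply]
  exact div_div_div_cancel_right₀ this _ _

/-- L'Hôpital's rule for functions vanishing to second order on the horizon. -/
theorem limit_div_sq (hy : y ∈ K.hor) (hf : SmoothOn K.S f) (h0 : f y = 0) (h1 : pd 1 f y = 0) :
    HasHorizonLimit (fun x => f x / K.N x ^ 2) y
      (pd 1 (pd 1 f) y / (2 * pd 1 K.N y ^ 2)) := by
  have hd : Tendsto (fun n => pd 1 f (Function.update y 1 n) / (2 * n)) (𝓝[>] 0)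
      (𝓝 (pd 1 (pd 1 f) y / 2)) := by
    refine ((limit_div_normal hy (hf.pd K.isOpen 1) h1).div_const 2).congr fun n => ?_
    rw [div_div, mul_comm]
  have hsq : Tendsto (fun n => f (Function.update y 1 n) / n ^ 2) (𝓝[>] 0)
      (𝓝 (pd 1 (pd 1 f) y / 2)) := by
    refine HasDerivAt.lhopital_zero_nhdsGT (f' := fun n => pd 1 f (Function.update y 1 n))
      (g' := fun n => 2 * n) ?_ ?_ ?_ ?_ ?_ hd
    · filter_upwards [eventually_reg hy] with n hn
      have := hasDerivAt_pd 1 (hf.differentiableAt K.isOpen hn.1)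
      simpa using this
    · exact Eventually.of_forall fun n => by simpa using hasDerivAt_pow 2 n
    · filter_upwards [self_mem_nhdsWithin] with n (hn : 0 < n)
      positivity
    · have := limit_smooth hy hf
      rwa [h0] at this
    · have : Tendsto (fun n : ℝ => n ^ 2) (𝓝 0) (𝓝 (0 ^ 2)) := tendsto_id.pow 2
      simpa using this.mono_left (nhdsWithin_le_nhds (s := Ioi (0 : ℝ)))
  have hN := (limit_div_normal hy K.smooth_N (N_hor hy)).pow 2
  have h := hsq.div hN (pow_ne_zero 2 (κ_ne hy))
  rw [div_div] at h
  refine h.congr' ?_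
  filter_upwards [self_mem_nhdsWithin] with n (hn : 0 < n)
  have := hn.ne'
  simp only [Pi.div_apply, div_pow]
  exact div_div_div_cancel_right₀ (pow_ne_zero 2 this) _ _

theorem limit_N (hy : y ∈ K.hor) : HasHorizonLimit K.N y 0 := by
  have := limit_smooth hy K.smooth_N
  rwa [N_hor hy] at this

/-- Derivatives along the horizon of functions which vanish on it. -/
theorem pd_tangent (hf : ∀ y ∈ K.hor, f y = 0) (hy : y ∈ K.hor) {a : Fin 4} (ha : a ≠ 1) :
    pd a f y = 0 := by
  have hc : ContinuousAt (fun n : ℝ => Function.update y a n) (y a) :=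
    (hasDerivAt_update y a (y a)).continuousAt
  have h1 : ∀ᶠ n : ℝ in 𝓝 (y a), Function.update y a n ∈ K.S := by
    apply hc.preimage_mem_nhds
    rw [Function.update_eq_self]
    exact K.isOpen.mem_nhds hy.1
  have h2 : (fun s => f (Function.update y a s)) =ᶠ[𝓝 (y a)] fun _ => 0 := by
    filter_upwards [h1] with n hn
    refine hf _ ⟨hn, ?_⟩
    rw [Function.update_of_ne ha.symm, hy.2]
  unfold pd
  rw [h2.deriv_eq, deriv_const]

/-! ### Regularity of the frame components -/

theorem smooth_b : SmoothOn K.S K.b := K.smooth_q.div K.smooth_p fun _ hx => p_ne hx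

theorem smooth_E (a : Fin 4) {i : Fin 4} (hi : i ≠ 0) : SmoothOn K.S fun x => K.E x a i := by
  have h : SmoothOn K.S fun x => -K.b x := smooth_b.neg
  fin_cases i
  · exact absurd rfl hi
  all_goals fin_cases a <;> first | exact contDiffOn_const | exact h

theorem smooth_η (i : Fin 4) : SmoothOn K.S fun x => K.η x i := by
  fin_cases i
  · exact contDiffOn_const
  · exact contDiffOn_const
  · exact contDiffOn_const.div K.smooth_p fun _ hx => p_ne hx
  · exact K.smooth_p.div ((K.smooth_p.mul K.smooth_r).sub (K.smooth_q.pow 2)) fun _ hx => det_ne hx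

theorem η_pos (hx : x ∈ K.S) {i : Fin 4} (hi : i ≠ 0) : 0 < K.η x i := by
  have h1 := K.p_pos x hx
  have h2 := K.det_pos x hx
  fin_cases i
  · exact absurd rfl hi
  · exact one_pos
  · exact div_pos one_pos h1
  · exact div_pos h1 h2

theorem smooth_fd (hf : SmoothOn K.S f) {i : Fin 4} (hi : i ≠ 0) : SmoothOn K.S (K.fd f i) :=
  ContDiffOn.sum fun a _ => (smooth_E a hi).mul (hf.pd K.isOpen a)

theorem smooth_fdd (hf : SmoothOn K.S f) {i j : Fin 4} (hi : i ≠ 0) (hj : j ≠ 0) :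
    SmoothOn K.S (K.fdd f i j) :=
  ContDiffOn.sum fun a _ => ContDiffOn.sum fun b _ =>
    ((smooth_E a hi).mul (smooth_E b hj)).mul ((hf.pd K.isOpen b).pd K.isOpen a)

theorem smooth_G1 {i j k : Fin 4} (hi : i ≠ 0) (hj : j ≠ 0) (hk : k ≠ 0) :
    SmoothOn K.S (K.G1 i j k) := by
  have hp := smooth_fd K.smooth_p hi
  have hq := smooth_fd K.smooth_q hi
  have hr := smooth_fd K.smooth_r hi
  have h23 : SmoothOn K.S fun x => K.fd K.q i x - K.b x * K.fd K.p i x :=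
    hq.sub (smooth_b.mul hp)
  have h33 : SmoothOn K.S fun x => K.fd K.r i x - 2 * K.b x * K.fd K.q i x
      + K.b x ^ 2 * K.fd K.p i x :=
    (hr.sub ((contDiffOn_const.mul smooth_b).mul hq)).add ((smooth_b.pow 2).mul hp)
  fin_cases j
  · exact absurd rfl hj
  all_goals
    fin_cases k
    · exact absurd rfl hk
    all_goals first | exact contDiffOn_const | exact hp | exact h23 | exact h33

theorem smooth_G2 {i j k l : Fin 4} (hi : i ≠ 0) (hj : j ≠ 0) (hk : k ≠ 0) (hl : l ≠ 0) :
    SmoothOn K.S (K.G2 i j k l) := by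
  have hp := smooth_fdd K.smooth_p hi hj
  have hq := smooth_fdd K.smooth_q hi hj
  have hr := smooth_fdd K.smooth_r hi hj
  have h23 : SmoothOn K.S fun x => K.fdd K.q i j x - K.b x * K.fdd K.p i j x :=
    hq.sub (smooth_b.mul hp)
  have h33 : SmoothOn K.S fun x => K.fdd K.r i j x - 2 * K.b x * K.fdd K.q i j x
      + K.b x ^ 2 * K.fdd K.p i j x :=
    (hr.sub ((contDiffOn_const.mul smooth_b).mul hq)).add ((smooth_b.pow 2).mul hp)
  fin_cases k
  · exact absurd rfl hk
  all_goals
    fin_cases l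
    · exact absurd rfl hl
    all_goals first | exact contDiffOn_const | exact hp | exact h23 | exact h33

theorem smooth_Γ {i j k : Fin 4} (hi : i ≠ 0) (hj : j ≠ 0) (hk : k ≠ 0) :
    SmoothOn K.S (K.Γ i j k) :=
  contDiffOn_const.mul (((smooth_G1 hj hi hk).add (smooth_G1 hk hi hj)).sub (smooth_G1 hi hj hk))

theorem smooth_hessN {i j : Fin 4} (hi : i ≠ 0) (hj : j ≠ 0) : SmoothOn K.S (K.hessN i j) := by
  have h : ∀ k : Fin 4, k ≠ 0 → SmoothOn K.S fun x => K.η x k * K.Γ k i j x * K.fd K.N k x :=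
    fun k hk => ((smooth_η k).mul (smooth_Γ hk hi hj)).mul (smooth_fd K.smooth_N hk)
  exact (smooth_fdd K.smooth_N hi hj).sub
    (((h 1 (by decide)).add (h 2 (by decide))).add (h 3 (by decide)))

theorem fd_one (f : (Fin 4 → ℝ) → ℝ) (x : Fin 4 → ℝ) : K.fd f 1 x = pd 1 f x := by
  simp [fd, Fin.sum_univ_four, E]

theorem fd_two (f : (Fin 4 → ℝ) → ℝ) (x : Fin 4 → ℝ) : K.fd f 2 x = pd 2 f x := by
  simp [fd, Fin.sum_univ_four, E]

theorem fd_three (f : (Fin 4 → ℝ) → ℝ) (x : Fin 4 → ℝ) :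
    K.fd f 3 x = pd 3 f x - K.b x * pd 2 f x := by
  simp [fd, Fin.sum_univ_four, E]; ring

theorem pd2_ω (x : Fin 4 → ℝ) : pd 2 K.ω x = 0 := by
  rcases K.static_or_axisymmetric with h | h
  · exact pd_eq_zero_of_forall h 2 x
  · exact (h.2 x).2.1

variable (K) in
/-- The numerator of `twist`, regular up to the horizon. -/
def ntwist (i j : Fin 4) (x : Fin 4 → ℝ) : ℝ :=
  K.p x * ((if i = 2 then K.fd K.ω j x else 0) - if j = 2 then K.fd K.ω i x else 0)

variable (K) in
/-- The numerator of `shear`, regular up to the horizon. -/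
def nshear (i j : Fin 4) (x : Fin 4 → ℝ) : ℝ :=
  -K.p x * ((if i = 2 then K.fd K.ω j x else 0) + if j = 2 then K.fd K.ω i x else 0)

theorem twist_eq (x : Fin 4 → ℝ) {i j : Fin 4} (hi : i ≠ 0) (hj : j ≠ 0) :
    K.twist i j x = K.ntwist i j x / K.N x := by
  rw [twist, ntwist, G1_0 x i hj, G1_0 x j hi]; split_ifs <;> ring

theorem shear_eq (x : Fin 4 → ℝ) {i j : Fin 4} (hi : i ≠ 0) (hj : j ≠ 0) :
    K.shear i j x = K.nshear i j x / K.N x := by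
  rw [shear, nshear, G1_0 x i hj, G1_0 x j hi]; split_ifs <;> ring

theorem smooth_ite (c : Prop) [Decidable c] (hf : SmoothOn K.S f) :
    SmoothOn K.S fun x => if c then f x else 0 := by
  split_ifs
  · exact hf
  · exact contDiffOn_const

theorem smooth_ntwist {i j : Fin 4} (hi : i ≠ 0) (hj : j ≠ 0) : SmoothOn K.S (K.ntwist i j) :=
  K.smooth_p.mul ((smooth_ite _ (smooth_fd K.smooth_ω hj)).sub
    (smooth_ite _ (smooth_fd K.smooth_ω hi)))

theorem smooth_nshear {i j : Fin 4} (hi : i ≠ 0) (hj : j ≠ 0) : SmoothOn K.S (K.nshear i j) :=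
  K.smooth_p.neg.mul ((smooth_ite _ (smooth_fd K.smooth_ω hj)).add
    (smooth_ite _ (smooth_fd K.smooth_ω hi)))

end KillingData

namespace KillingData
variable {K : KillingData} {f g : (Fin 4 → ℝ) → ℝ} {x y : Fin 4 → ℝ} {l : ℝ}

/-! ### Rigidity: a bounded scalar curvature forbids differential rotation of the horizon -/

theorem scalarCurv_eq (hx : x ∈ K.reg) : scalarCurv K.metric x =
    2 * (-(K.η x 1 * K.Rm 0 1 0 1 x + K.η x 2 * K.Rm 0 2 0 2 x + K.η x 3 * K.Rm 0 3 0 3 x)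
      + K.η x 1 * K.η x 2 * K.Rm 1 2 1 2 x + K.η x 1 * K.η x 3 * K.Rm 1 3 1 3 x
      + K.η x 2 * K.η x 3 * K.Rm 2 3 2 3 x) := by
  have hη : K.η x 0 = -1 := rfl
  have h : ∀ i j : Fin 4, K.Rm j i j i x = K.Rm i j i j x := by
    intro i j; rw [Rm_swap hx i j j i, Rm_swap' hx i j i j]; ring
  rw [scalarCurv_frame (isOrthogonalFrame hx)]
  have e : ∀ i, contr2 (K.E x) (ricci K.metric x) i i = ∑ j, K.η x j * K.Rm i j i j x :=
    fun i => ricci_frame isSmoothMetricOn hx (isOrthogonalFrame hx) i i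
  simp only [e, Fin.sum_univ_four, Rm_self hx, hη, h 0 1, h 0 2, h 0 3, h 1 2, h 1 3, h 2 3]
  ring

theorem limit_sq_electric (hy : y ∈ K.hor) {i : Fin 4} (hi : i ≠ 0) :
    HasHorizonLimit (fun x => K.N x ^ 2 * K.Rm 0 i 0 i x) y
      (-(K.p y * K.fd K.ω i y ^ 2) + (1 / 4) * (K.η y 1 * K.ntwist i 1 y ^ 2
        + K.η y 2 * K.ntwist i 2 y ^ 2 + K.η y 3 * K.ntwist i 3 y ^ 2)) := by
  have h : ∀ k : Fin 4, k ≠ 0 → SmoothOn K.S fun x => K.η x k * K.ntwist i k x ^ 2 :=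
    fun k hk => (smooth_η k).mul ((smooth_ntwist hi hk).pow 2)
  have hs : SmoothOn K.S fun x => K.N x * K.hessN i i x - K.p x * K.fd K.ω i x ^ 2
      + (1 / 4) * (K.η x 1 * K.ntwist i 1 x ^ 2
        + K.η x 2 * K.ntwist i 2 x ^ 2 + K.η x 3 * K.ntwist i 3 x ^ 2) :=
    ((K.smooth_N.mul (smooth_hessN hi hi)).sub (K.smooth_p.mul ((smooth_fd K.smooth_ω hi).pow 2))).add
      (contDiffOn_const.mul (((h 1 (by decide)).add (h 2 (by decide))).add (h 3 (by decide))))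
  have hl := limit_smooth hy hs
  rw [N_hor hy, zero_mul, zero_sub] at hl
  refine limit_congr hy (fun x hx => ?_) hl
  have hN := hx.2
  rw [Rm_electric hx, twist_eq x hi (by decide : (1 : Fin 4) ≠ 0),
    twist_eq x hi (by decide : (2 : Fin 4) ≠ 0), twist_eq x hi (by decide : (3 : Fin 4) ≠ 0)]
  field_simp

theorem limit_sq_spatial (hy : y ∈ K.hor) {i j : Fin 4} (hi : i ≠ 0) (hj : j ≠ 0) :
    HasHorizonLimit (fun x => K.N x ^ 2 * K.Rm i j i j x) y
      (-((1 / 4) * (K.nshear i j y * K.nshear j i y - K.nshear j j y * K.nshear i i y))) := by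
  let P : (Fin 4 → ℝ) → ℝ := fun x =>
    (1 / 2) * (K.G2 j i j i x - K.G2 j j i i x - K.G2 i i j j x + K.G2 i j j i x)
    + (K.η x 1 * (K.Γ 1 i j x * K.Γ 1 j i x - K.Γ 1 j j x * K.Γ 1 i i x)
      + K.η x 2 * (K.Γ 2 i j x * K.Γ 2 j i x - K.Γ 2 j j x * K.Γ 2 i i x)
      + K.η x 3 * (K.Γ 3 i j x * K.Γ 3 j i x - K.Γ 3 j j x * K.Γ 3 i i x))
  have hP : SmoothOn K.S P := by
    have h : ∀ k : Fin 4, k ≠ 0 → SmoothOn K.S fun x =>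
        K.η x k * (K.Γ k i j x * K.Γ k j i x - K.Γ k j j x * K.Γ k i i x) := fun k hk =>
      (smooth_η k).mul (((smooth_Γ hk hi hj).mul (smooth_Γ hk hj hi)).sub
        ((smooth_Γ hk hj hj).mul (smooth_Γ hk hi hi)))
    exact (contDiffOn_const.mul ((((smooth_G2 hj hi hj hi).sub (smooth_G2 hj hj hi hi)).sub
      (smooth_G2 hi hi hj hj)).add (smooth_G2 hi hj hj hi))).add
      (((h 1 (by decide)).add (h 2 (by decide))).add (h 3 (by decide)))
  have hs : SmoothOn K.S fun x => K.N x ^ 2 * P x - (1 / 4) * (K.nshear i j x * K.nshear j i x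
      - K.nshear j j x * K.nshear i i x) :=
    ((K.smooth_N.pow 2).mul hP).sub (contDiffOn_const.mul
      (((smooth_nshear hi hj).mul (smooth_nshear hj hi)).sub
        ((smooth_nshear hj hj).mul (smooth_nshear hi hi))))
  have hl := limit_smooth hy hs
  rw [N_hor hy, zero_pow two_ne_zero, zero_mul, zero_sub] at hl
  refine limit_congr hy (fun x hx => ?_) hl
  have hN := hx.2
  rw [Rm_spatial hx, shear_eq x hi hj, shear_eq x hj hi, shear_eq x hj hj, shear_eq x hi hi]
  field_simp
  simp only [P]
  ring

/-- The only terms of the scalar curvature of order `1 / N²` are squares of derivatives of `ω`, and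
they add up with the same sign. -/
theorem limit_sq_scalarCurv (hy : y ∈ K.hor) :
    HasHorizonLimit (fun x => K.N x ^ 2 * scalarCurv K.metric x) y
      ((1 / 2) * K.p y * (pd 1 K.ω y ^ 2 + K.η y 3 * pd 3 K.ω y ^ 2)) := by
  have hη : ∀ i, HasHorizonLimit (fun x => K.η x i) y (K.η y i) := fun i =>
    limit_smooth hy (smooth_η i)
  have n1 : (1 : Fin 4) ≠ 0 := by decide
  have n2 : (2 : Fin 4) ≠ 0 := by decide
  have n3 : (3 : Fin 4) ≠ 0 := by decide
  have hl := (((((((hη 1).mul (limit_sq_electric hy n1)).add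
    ((hη 2).mul (limit_sq_electric hy n2))).add ((hη 3).mul (limit_sq_electric hy n3))).neg.add
    (((hη 1).mul (hη 2)).mul (limit_sq_spatial hy n1 n2))).add
    (((hη 1).mul (hη 3)).mul (limit_sq_spatial hy n1 n3))).add
    (((hη 2).mul (hη 3)).mul (limit_sq_spatial hy n2 n3)))
  have hl2 := (HasHorizonLimit.const (y := y) 2).mul hl
  have hp := p_ne hy.1
  have h3 : K.fd K.ω 3 y = pd 3 K.ω y := by rw [fd_three, pd2_ω, mul_zero, sub_zero]
  have h2 : K.fd K.ω 2 y = 0 := by rw [fd_two, pd2_ω]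
  convert limit_congr hy (fun x hx => ?_) hl2 using 1
  · simp only [ntwist, nshear, h2, h3, fd_one]
    have e1 : K.η y 1 = 1 := rfl
    have e2 : K.η y 2 = 1 / K.p y := rfl
    rw [e1, e2]
    simp
    field_simp
    ring
  · rw [scalarCurv_eq hx]; ring

/-- A function that stays bounded, multiplied by one that tends to zero. -/
theorem limit_zero_of_finite (hf : FiniteAt f y) (hg : HasHorizonLimit g y 0) :
    HasHorizonLimit (fun x => g x * f x) y 0 := by
  obtain ⟨C, hC⟩ := hf
  refine Tendsto.zero_mul_isBoundedUnder_le hg ?_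
  exact ⟨C, by simpa [Filter.eventually_map] using hC⟩

theorem pd_ω_eq_zero (hy : y ∈ K.hor) (hR : FiniteAt (scalarCurv K.metric) y) (a : Fin 4) :
    pd a K.ω y = 0 := by
  have h0 : HasHorizonLimit (fun x => K.N x ^ 2) y 0 := by simpa using (limit_N hy).pow 2
  have h := (limit_sq_scalarCurv hy).unique (limit_zero_of_finite hR h0)
  have hp := K.p_pos y hy.1
  have hη := η_pos hy.1 (i := 3) (by decide)
  have hs : pd 1 K.ω y ^ 2 + K.η y 3 * pd 3 K.ω y ^ 2 = 0 := by
    rcases mul_eq_zero.1 h with h | h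
    · exact absurd h (by positivity)
    · exact h
  have h1 : pd 1 K.ω y = 0 := by
    have : pd 1 K.ω y ^ 2 = 0 := by
      nlinarith [sq_nonneg (pd 1 K.ω y), mul_nonneg hη.le (sq_nonneg (pd 3 K.ω y))]
    exact pow_eq_zero_iff two_ne_zero |>.1 this
  have h3 : pd 3 K.ω y = 0 := by
    rw [h1] at hs
    have : K.η y 3 * pd 3 K.ω y ^ 2 = 0 := by linarith
    rcases mul_eq_zero.1 this with h | h
    · exact absurd h hη.ne'
    · exact pow_eq_zero_iff two_ne_zero |>.1 h
  fin_cases a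
  · exact inv_ω.2.1 y
  · exact h1
  · exact pd2_ω y
  · exact h3

/-! ### Convergence of the magnetic part of the curvature -/

variable (K) in
/-- The rotation is rigid: the derivatives of `ω` vanish on the horizon. -/
def Rigid : Prop := ∀ y ∈ K.hor, ∀ a, pd a K.ω y = 0

theorem fd_eq_zero_of_pd {f : (Fin 4 → ℝ) → ℝ} (h : ∀ a, pd a f y = 0) (i : Fin 4) :
    K.fd f i y = 0 := by simp [fd, h]

theorem converges_ω_div (hω : K.Rigid) (hy : y ∈ K.hor) (i : Fin 4) :
    Converges (fun x => K.fd K.ω i x / K.N x) y := by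
  by_cases hi : i = 0
  · refine converges_congr hy (fun x _ => ?_) (.const 0)
    rw [hi, fd_zero inv_ω, zero_div]
  · exact (limit_div hy (smooth_fd K.smooth_ω hi) (fd_eq_zero_of_pd (hω y hy) i)).converges

theorem converges_ite {c : Prop} [Decidable c] (h : Converges f y) :
    Converges (fun x => if c then f x else 0) y := by
  split_ifs
  · exact h
  · exact .const 0

theorem converges_twist (hω : K.Rigid) (hy : y ∈ K.hor) {i j : Fin 4} (hi : i ≠ 0) (hj : j ≠ 0) :
    Converges (K.twist i j) y := by
  refine converges_congr hy (fun x hx => ?_) ((converges_smooth hy K.smooth_p).mul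
    ((converges_ite (c := i = 2) (converges_ω_div hω hy j)).sub
      (converges_ite (c := j = 2) (converges_ω_div hω hy i))))
  rw [twist_eq x hi hj, ntwist]; split_ifs <;> ring

theorem converges_shear (hω : K.Rigid) (hy : y ∈ K.hor) {i j : Fin 4} (hi : i ≠ 0) (hj : j ≠ 0) :
    Converges (K.shear i j) y := by
  refine converges_congr hy (fun x hx => ?_) ((converges_smooth hy K.smooth_p).neg.mul
    ((converges_ite (c := i = 2) (converges_ω_div hω hy j)).add
      (converges_ite (c := j = 2) (converges_ω_div hω hy i))))
  rw [shear_eq x hi hj, nshear]; split_ifs <;> ring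

theorem converges_Γ (hy : y ∈ K.hor) {i j k : Fin 4} (hi : i ≠ 0) (hj : j ≠ 0)
    (hk : k ≠ 0) : Converges (K.Γ i j k) y := converges_smooth hy (smooth_Γ hi hj hk)

theorem converges_η (hy : y ∈ K.hor) (i : Fin 4) : Converges (fun x => K.η x i) y :=
  converges_smooth hy (smooth_η i)

theorem fdd_eq_of_axisymmetric (hq : ∀ x, K.q x = 0) (f : (Fin 4 → ℝ) → ℝ) (x : Fin 4 → ℝ)
    {i j : Fin 4} (hi : i ≠ 0) (hj : j ≠ 0) : K.fdd f i j x = pd i (pd j f) x := by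
  have hb : K.b x = 0 := by simp [b, hq]
  fin_cases i <;> fin_cases j <;> simp_all [fdd, Fin.sum_univ_four, E]

theorem fd_eq_of_axisymmetric (hq : ∀ x, K.q x = 0) (f : (Fin 4 → ℝ) → ℝ) (x : Fin 4 → ℝ)
    {i : Fin 4} (hi : i ≠ 0) : K.fd f i x = pd i f x := by
  have hb : K.b x = 0 := by simp [b, hq]
  fin_cases i <;> simp_all [fd, Fin.sum_univ_four, E]

theorem pd_mul_sub_mul (μ : Fin 4) {f g h k : (Fin 4 → ℝ) → ℝ} (hf : DifferentiableAt ℝ f x)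
    (hg : DifferentiableAt ℝ g x) (hh : DifferentiableAt ℝ h x) (hk : DifferentiableAt ℝ k x) :
    pd μ (fun x => f x * g x - h x * k x) x
      = pd μ f x * g x + f x * pd μ g x - (pd μ h x * k x + h x * pd μ k x) := by
  have := pd_eq_of_hasDerivAt (f := fun x => f x * g x - h x * k x)
    (((hasDerivAt_pd μ hf).mul (hasDerivAt_pd μ hg)).sub
      ((hasDerivAt_pd μ hh).mul (hasDerivAt_pd μ hk)))
  simpa using this

/-- The numerator of `rot` vanishes to second order. -/
theorem limit_rot_axisymmetric (hω : K.Rigid) (hy : y ∈ K.hor) (hq : ∀ x, K.q x = 0)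
    {i j : Fin 4} (hi : i ≠ 0) (hj : j ≠ 0) :
    HasHorizonLimit (K.rot i j) y (pd 1 (pd 1 fun x => pd i (pd j K.ω) x * K.N x
      - pd i K.ω x * pd j K.N x) y / (2 * pd 1 K.N y ^ 2)) := by
  have s1 : SmoothOn K.S (pd i (pd j K.ω)) := (K.smooth_ω.pd K.isOpen j).pd K.isOpen i
  have s2 : SmoothOn K.S (pd i K.ω) := K.smooth_ω.pd K.isOpen i
  have s3 : SmoothOn K.S (pd j K.N) := K.smooth_N.pd K.isOpen j
  have d : ∀ {f}, SmoothOn K.S f → DifferentiableAt ℝ f y := fun h =>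
    h.differentiableAt K.isOpen hy.1
  refine limit_congr hy (fun x _ => ?_) (limit_div_sq hy ((s1.mul K.smooth_N).sub (s2.mul s3)) ?_ ?_)
  · rw [rot, fdd_eq_of_axisymmetric hq _ _ hi hj, fd_eq_of_axisymmetric hq _ _ hi,
      fd_eq_of_axisymmetric hq _ _ hj]
  · rw [N_hor hy, hω y hy, mul_zero, zero_mul, sub_zero]
  · rw [pd_mul_sub_mul 1 (d s1) (d K.smooth_N) (d s2) (d s3), N_hor hy, hω y hy,
      pd_comm K.isOpen K.smooth_ω hy.1 i j]
    by_cases h1 : j = 1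
    · subst h1
      rw [pd_comm K.isOpen K.smooth_ω hy.1 1 i, pd_comm K.isOpen K.smooth_ω hy.1 i 1]
      ring
    · rw [pd_tangent (f := pd i K.ω) (fun y hy => hω y hy i) hy h1,
        pd_tangent (f := K.N) (fun y hy => N_hor hy) hy h1]
      ring

theorem converges_rot (hω : K.Rigid) (hy : y ∈ K.hor) {i j : Fin 4} (hi : i ≠ 0) (hj : j ≠ 0) :
    Converges (K.rot i j) y := by
  rcases K.static_or_axisymmetric with h | ⟨h, -⟩
  · refine converges_congr hy (fun x _ => ?_) (.const 0)
    have h1 : ∀ a x, pd a K.ω x = 0 := fun a x => pd_eq_zero_of_forall h a x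
    have h2 : ∀ a b x, pd a (pd b K.ω) x = 0 := fun a b x => pd_eq_zero_of_forall (h1 b) a x
    simp [rot, fd, fdd, h1, h2]
  · exact (limit_rot_axisymmetric hω hy h hi hj).converges

theorem converges_rotp (hω : K.Rigid) (hy : y ∈ K.hor) {i j : Fin 4} (hi : i ≠ 0) (hj : j ≠ 0) :
    Converges (K.rotp i j) y :=
  ((converges_ω_div hω hy i).mul (converges_smooth hy (smooth_fd K.smooth_p hj))).add
    ((converges_ω_div hω hy j).mul (converges_smooth hy (smooth_fd K.smooth_p hi)))

/-- Rigidity makes the magnetic part of the curvature regular. -/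
theorem converges_magnetic (hω : K.Rigid) (hy : y ∈ K.hor) {j k l : Fin 4} (hj : j ≠ 0)
    (hk : k ≠ 0) (hl : l ≠ 0) : Converges (K.Rm 0 j k l) y := by
  have hp := converges_smooth hy K.smooth_p
  have r : ∀ {i j : Fin 4}, i ≠ 0 → j ≠ 0 →
      Converges (fun x => K.p x * K.rot i j x + K.rotp i j x) y := fun hi hj =>
    (hp.mul (converges_rot hω hy hi hj)).add (converges_rotp hω hy hi hj)
  have t : ∀ m : Fin 4, m ≠ 0 → Converges (fun x => K.η x m *
      (K.twist l m x * K.Γ m j k x - K.twist k m x * K.Γ m j l x)) y := fun m hm =>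
    (converges_η hy m).mul (((converges_twist hω hy hl hm).mul (converges_Γ hy hm hj hk)).sub
      ((converges_twist hω hy hk hm).mul (converges_Γ hy hm hj hl)))
  exact converges_congr hy (fun x hx => Rm_magnetic hx hj hk hl)
    (((Converges.const (1 / 2)).mul (((converges_ite (c := k = 2) (r hj hl)).sub
      (converges_ite (c := l = 2) (r hj hk))).add (converges_ite (c := j = 2)
        (hp.mul ((converges_rot hω hy hk hl).sub (converges_rot hω hy hl hk)))))).add
    ((Converges.const (1 / 2)).mul (((t 1 (by decide)).add (t 2 (by decide))).add
      (t 3 (by decide)))))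

end KillingData

/-! ### The Kretschmann scalar, the zeroth law and the geometry of the horizon sections -/

/-- If a finite sum is bounded above and each term is bounded below, then each term is bounded
above. -/
theorem bddAbove_term_of_sum {ι : Type*} [Fintype ι] [DecidableEq ι] {F : ι → ℝ → ℝ}
    {u : Filter ℝ} (hsum : ∃ C, ∀ᶠ n in u, ∑ i, F i n ≤ C)
    (hlow : ∀ i, ∃ c, ∀ᶠ n in u, c ≤ F i n) (i : ι) : ∃ C, ∀ᶠ n in u, F i n ≤ C := by
  obtain ⟨C, hC⟩ := hsum
  choose c hc using hlow
  refine ⟨C - ∑ j ∈ Finset.univ.erase i, c j, ?_⟩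
  filter_upwards [hC, eventually_all.2 hc] with n h1 h2
  have h3 := Finset.add_sum_erase Finset.univ (fun j => F j n) (Finset.mem_univ i)
  have h4 : ∑ j ∈ Finset.univ.erase i, c j ≤ ∑ j ∈ Finset.univ.erase i, F j n :=
    Finset.sum_le_sum fun j _ => h2 j
  linarith

namespace KillingData
variable {K : KillingData} {f g : (Fin 4 → ℝ) → ℝ} {x y : Fin 4 → ℝ} {l : ℝ}

variable (K) in
/-- The terms of the Kretschmann scalar. -/
def kretschmannTerm (i j k l : Fin 4) (x : Fin 4 → ℝ) : ℝ :=
  K.η x i * K.η x j * K.η x k * K.η x l * K.Rm i j k l x ^ 2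

theorem converges_kretschmannTerm (hy : y ∈ K.hor) {i j k l : Fin 4}
    (h : Converges (K.Rm i j k l) y) : Converges (K.kretschmannTerm i j k l) y :=
  ((((converges_η hy i).mul (converges_η hy j)).mul (converges_η hy k)).mul
    (converges_η hy l)).mul (h.pow 2)

theorem bddBelow_of_converges (h : Converges f y) :
    ∃ c, ∀ᶠ n : ℝ in 𝓝[>] 0, c ≤ f (Function.update y 1 n) := by
  obtain ⟨L, hL⟩ := h
  exact ⟨L - 1, (Tendsto.eventually hL (lt_mem_nhds (sub_one_lt L))).mono fun n => le_of_lt⟩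

/-- The terms of the Kretschmann scalar with an even number of time indices are nonnegative, and
those with an odd number converge. -/
theorem bddBelow_kretschmannTerm (hω : K.Rigid) (hy : y ∈ K.hor) (i j k l : Fin 4) :
    ∃ c, ∀ᶠ n : ℝ in 𝓝[>] 0, c ≤ K.kretschmannTerm i j k l (Function.update y 1 n) := by
  have nonneg : (∀ x ∈ K.S, 0 ≤ K.η x i * K.η x j * K.η x k * K.η x l) →
      ∃ c, ∀ᶠ n : ℝ in 𝓝[>] 0, c ≤ K.kretschmannTerm i j k l (Function.update y 1 n) := by
    intro h
    refine ⟨0, ?_⟩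
    filter_upwards [eventually_reg hy] with n hn
    exact mul_nonneg (h _ hn.1) (sq_nonneg _)
  have conv : Converges (K.Rm i j k l) y →
      ∃ c, ∀ᶠ n : ℝ in 𝓝[>] 0, c ≤ K.kretschmannTerm i j k l (Function.update y 1 n) :=
    fun h => bddBelow_of_converges (converges_kretschmannTerm hy h)
  have hη : ∀ x, K.η x 0 = -1 := fun _ => rfl
  by_cases hij : i = 0 ∧ j = 0
  · refine conv (converges_congr hy (fun x hx => ?_) (.const 0))
    rw [hij.1, hij.2, Rm_self hx]
  by_cases hkl : k = 0 ∧ l = 0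
  · refine conv (converges_congr hy (fun x hx => ?_) (.const 0))
    rw [hkl.1, hkl.2, Rm_self' hx]
  have pos : ∀ {x}, x ∈ K.S → ∀ {i : Fin 4}, i ≠ 0 → 0 ≤ K.η x i := fun hx _ hi => (η_pos hx hi).le
  by_cases hi : i = 0
  · have hj : j ≠ 0 := fun h => hij ⟨hi, h⟩
    subst hi
    by_cases hk : k = 0
    · have hl : l ≠ 0 := fun h => hkl ⟨hk, h⟩
      subst hk
      refine nonneg fun x hx => ?_
      have := mul_nonneg (pos hx hj) (pos hx hl)
      rw [hη]; linarith
    · by_cases hl : l = 0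
      · subst hl
        refine nonneg fun x hx => ?_
        have := mul_nonneg (pos hx hj) (pos hx hk)
        rw [hη]; linarith
      · exact conv (converges_magnetic hω hy hj hk hl)
  · by_cases hj : j = 0
    · subst hj
      by_cases hk : k = 0
      · have hl : l ≠ 0 := fun h => hkl ⟨hk, h⟩
        subst hk
        refine nonneg fun x hx => ?_
        have := mul_nonneg (pos hx hi) (pos hx hl)
        rw [hη]; linarith
      · by_cases hl : l = 0
        · subst hl
          refine nonneg fun x hx => ?_
          have := mul_nonneg (pos hx hi) (pos hx hk)
          rw [hη]; linarith
        · exact conv (converges_congr hy (fun x hx => Rm_swap hx 0 i k l)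
            (converges_magnetic hω hy hi hk hl).neg)
    · by_cases hk : k = 0
      · have hl : l ≠ 0 := fun h => hkl ⟨hk, h⟩
        subst hk
        exact conv (converges_congr hy (fun x hx => (Rm_pair hx i j 0 l).symm)
          (converges_magnetic hω hy hl hi hj))
      · by_cases hl : l = 0
        · subst hl
          exact conv (converges_congr hy (fun x hx => by
            rw [Rm_swap' hx, ← Rm_pair hx i j 0 k]) (converges_magnetic hω hy hk hi hj).neg)
        · exact nonneg fun x hx => mul_nonneg (mul_nonneg (mul_nonneg (pos hx hi) (pos hx hj))
            (pos hx hk)) (pos hx hl)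

theorem bddAbove_kretschmannTerm (hω : K.Rigid) (hy : y ∈ K.hor)
    (hR : FiniteAt (riemannSq K.metric) y) (i j k l : Fin 4) :
    ∃ C, ∀ᶠ n : ℝ in 𝓝[>] 0, K.kretschmannTerm i j k l (Function.update y 1 n) ≤ C := by
  refine bddAbove_term_of_sum (ι := Fin 4 × Fin 4 × Fin 4 × Fin 4)
    (F := fun a n => K.kretschmannTerm a.1 a.2.1 a.2.2.1 a.2.2.2 (Function.update y 1 n)) ?_
    (fun a => bddBelow_kretschmannTerm hω hy _ _ _ _) (i, j, k, l)
  obtain ⟨C, hC⟩ := hR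
  refine ⟨C, ?_⟩
  filter_upwards [hC, eventually_reg hy] with n h1 h2
  rw [riemannSq_eq_frame (isOrthogonalFrame h2)] at h1
  simp only [Fintype.sum_prod_type]
  exact (le_abs_self _).trans h1

/-- The Hessian of the lapse vanishes on the horizon, since the electric part of the curvature is
the Hessian divided by the lapse. -/
theorem hessN_eq_zero (hω : K.Rigid) (hy : y ∈ K.hor) (hR : FiniteAt (riemannSq K.metric) y)
    {i j : Fin 4} (hi : i ≠ 0) (hj : j ≠ 0) : K.hessN i j y = 0 := by
  obtain ⟨C, hC⟩ := bddAbove_kretschmannTerm hω hy hR 0 i 0 j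
  have hηi := η_pos hy.1 hi
  have hηj := η_pos hy.1 hj
  have lN := limit_N hy
  have hconv : Converges (fun x => -(K.p x * (K.fd K.ω i x / K.N x) * (K.fd K.ω j x / K.N x))
      + (1 / 4) * (K.η x 1 * K.twist i 1 x * K.twist j 1 x + K.η x 2 * K.twist i 2 x * K.twist j 2 x
      + K.η x 3 * K.twist i 3 x * K.twist j 3 x)) y := by
    have t : ∀ m : Fin 4, m ≠ 0 → Converges (fun x => K.η x m * K.twist i m x * K.twist j m x) y :=
      fun m hm => ((converges_η hy m).mul (converges_twist hω hy hi hm)).mul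
        (converges_twist hω hy hj hm)
    exact (((converges_smooth hy K.smooth_p).mul (converges_ω_div hω hy i)).mul
      (converges_ω_div hω hy j)).neg.add ((Converges.const _).mul
        (((t 1 (by decide)).add (t 2 (by decide))).add (t 3 (by decide))))
  obtain ⟨L, hL⟩ := hconv
  have h1 : HasHorizonLimit (fun x => K.N x * K.Rm 0 i 0 j x) y (K.hessN i j y) := by
    have := (limit_smooth hy (smooth_hessN (K := K) hi hj)).add (lN.mul hL)
    rw [zero_mul, add_zero] at this
    refine limit_congr hy (fun x hx => ?_) this
    have hN := hx.2
    rw [Rm_electric hx]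
    field_simp
    ring
  have h2 : HasHorizonLimit (fun x => K.N x ^ 2 * K.kretschmannTerm 0 i 0 j x) y
      (K.η y i * K.η y j * K.hessN i j y ^ 2) := by
    refine limit_congr hy (fun x hx => ?_) (((limit_smooth hy (smooth_η i)).mul
      (limit_smooth hy (smooth_η j))).mul (h1.pow 2))
    have hη : K.η x 0 = -1 := rfl
    rw [kretschmannTerm, hη]; ring
  have h3 : HasHorizonLimit (fun x => K.N x ^ 2 * C) y 0 := by
    simpa using (lN.pow 2).mul (HasHorizonLimit.const C)
  have h4 : K.η y i * K.η y j * K.hessN i j y ^ 2 ≤ 0 := by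
    refine le_of_tendsto_of_tendsto h2 h3 ?_
    filter_upwards [hC] with n hn
    exact mul_le_mul_of_nonneg_left hn (sq_nonneg _)
  have h5 := mul_pos hηi hηj
  have h6 : K.hessN i j y ^ 2 = 0 := by
    refine le_antisymm ?_ (sq_nonneg _)
    by_contra h
    exact absurd (mul_pos h5 (not_le.1 h)) (not_lt.2 h4)
  exact pow_eq_zero_iff two_ne_zero |>.1 h6

theorem pd_N_tangent (hy : y ∈ K.hor) {a : Fin 4} (ha : a ≠ 1) : pd a K.N y = 0 :=
  pd_tangent (fun _ h => N_hor h) hy ha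

theorem hessN_hor (hy : y ∈ K.hor) (i j : Fin 4) :
    K.hessN i j y = K.fdd K.N i j y - K.Γ 1 i j y * pd 1 K.N y := by
  have h2 := pd_N_tangent hy (a := 2) (by decide)
  have h3 := pd_N_tangent hy (a := 3) (by decide)
  have e1 : K.η y 1 = 1 := rfl
  rw [hessN, fd_one, fd_two, fd_three, h2, h3, e1]; ring

theorem fdd_of_ne {f : (Fin 4 → ℝ) → ℝ} (x : Fin 4 → ℝ) :
    K.fdd f 1 1 x = pd 1 (pd 1 f) x ∧ K.fdd f 1 2 x = pd 1 (pd 2 f) x ∧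
    K.fdd f 1 3 x = pd 1 (pd 3 f) x - K.b x * pd 1 (pd 2 f) x := by
  refine ⟨?_, ?_, ?_⟩ <;> simp [fdd, Fin.sum_univ_four, E]
  ring

theorem G1_one (x : Fin 4 → ℝ) (i j : Fin 4) : K.G1 i 1 j x = 0 := by
  simp only [G1, tab1]; fin_cases j <;> rfl

theorem G1_one' (x : Fin 4 → ℝ) (i j : Fin 4) : K.G1 i j 1 x = 0 := by
  rw [G1_symm, G1_one]

theorem G2_one (x : Fin 4 → ℝ) (i j k : Fin 4) : K.G2 i j 1 k x = 0 := by
  simp only [G2, tab2]; fin_cases k <;> rfl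

theorem G2_one' (x : Fin 4 → ℝ) (i j k : Fin 4) : K.G2 i j k 1 x = 0 := by
  rw [G2_symm, G2_one]

theorem Γ_one (x : Fin 4 → ℝ) (i j : Fin 4) : K.Γ 1 i j x = -(1 / 2) * K.G1 1 i j x := by
  simp only [Γ, gam, G1_one]; ring

theorem Γ_one_one (x : Fin 4 → ℝ) (i : Fin 4) : K.Γ 1 1 i x = 0 := by
  rw [Γ_one, G1_one, mul_zero]

theorem Γ_right_one (x : Fin 4 → ℝ) (m i : Fin 4) : K.Γ m 1 i x = (1 / 2) * K.G1 1 m i x := by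
  simp only [Γ, gam, G1_one, G1_one']; ring

theorem Γ_right_one' (x : Fin 4 → ℝ) (m i : Fin 4) : K.Γ m i 1 x = (1 / 2) * K.G1 1 m i x := by
  rw [Γ_symm, Γ_right_one]

/-- What the boundedness of the curvature scalars says about the horizon: `ω` is constant to first
order, the Hessian of the lapse vanishes, and so do its ingredients: the second normal derivative of
the lapse, the derivatives of the surface gravity and the normal derivatives of `p`, `q`, `r`. -/
structure RegularHorizon (K : KillingData) : Prop where
  rigid : K.Rigid
  κ₂ : ∀ y ∈ K.hor, pd 1 (pd 1 K.N) y = 0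
  zeroth_law : ∀ y ∈ K.hor, ∀ a, pd a (pd 1 K.N) y = 0
  p : ∀ y ∈ K.hor, pd 1 K.p y = 0
  q : ∀ y ∈ K.hor, pd 1 K.q y = 0
  r : ∀ y ∈ K.hor, pd 1 K.r y = 0
  hess : ∀ y ∈ K.hor, ∀ i j : Fin 4, i ≠ 0 → j ≠ 0 → K.hessN i j y = 0

theorem regularHorizon (h : FiniteCurvatureScalars K.metric K.hor) : K.RegularHorizon := by
  have hω : K.Rigid := fun y hy a => pd_ω_eq_zero hy (h y hy).1 a
  have n1 : (1 : Fin 4) ≠ 0 := by decide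
  have n2 : (2 : Fin 4) ≠ 0 := by decide
  have n3 : (3 : Fin 4) ≠ 0 := by decide
  have H : ∀ y ∈ K.hor, ∀ i j : Fin 4, i ≠ 0 → j ≠ 0 →
      K.fdd K.N i j y = K.Γ 1 i j y * pd 1 K.N y := fun y hy i j hi hj => by
    have := hessN_eq_zero hω hy (h y hy).2.2 hi hj
    rw [hessN_hor hy] at this
    linarith
  have k2 : ∀ y ∈ K.hor, pd 1 (pd 1 K.N) y = 0 := fun y hy => by
    have := H y hy 1 1 n1 n1
    rwa [Γ_one_one, zero_mul, (fdd_of_ne y).1] at this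
  have k12 : ∀ y ∈ K.hor, pd 1 (pd 2 K.N) y = 0 := fun y hy => by
    have := H y hy 1 2 n1 n2
    rwa [Γ_one_one, zero_mul, (fdd_of_ne y).2.1] at this
  have k13 : ∀ y ∈ K.hor, pd 1 (pd 3 K.N) y = 0 := fun y hy => by
    have := H y hy 1 3 n1 n3
    rwa [Γ_one_one, zero_mul, (fdd_of_ne y).2.2, k12 y hy, mul_zero, sub_zero] at this
  have tt : ∀ y ∈ K.hor, ∀ a b : Fin 4, a ≠ 1 → b ≠ 1 → pd a (pd b K.N) y = 0 :=
    fun y hy a b ha hb => pd_tangent (fun y hy => pd_N_tangent hy hb) hy ha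
  have s : ∀ y ∈ K.hor, ∀ i j : Fin 4, (i = 2 ∨ i = 3) → (j = 2 ∨ j = 3) → K.G1 1 i j y = 0 := by
    intro y hy i j hi hj
    have hi0 : i ≠ 0 := by rcases hi with h | h <;> simp [h]
    have hj0 : j ≠ 0 := by rcases hj with h | h <;> simp [h]
    have h1 := H y hy i j hi0 hj0
    have h2 : K.fdd K.N i j y = 0 := by
      have e := tt y hy
      rcases hi with rfl | rfl <;> rcases hj with rfl | rfl <;>
        simp [fdd, Fin.sum_univ_four, E, e]
    have h3 := Γ_one (K := K) y i j
    rw [h2, h3] at h1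
    rcases mul_eq_zero.1 h1.symm with h | h
    · linarith
    · exact absurd h (κ_ne hy)
  have hp : ∀ y ∈ K.hor, pd 1 K.p y = 0 := fun y hy => by
    have h : K.fd K.p 1 y = 0 := s y hy 2 2 (Or.inl rfl) (Or.inl rfl)
    rwa [fd_one] at h
  have hq : ∀ y ∈ K.hor, pd 1 K.q y = 0 := fun y hy => by
    have h : K.fd K.q 1 y - K.b y * K.fd K.p 1 y = 0 := s y hy 2 3 (Or.inl rfl) (Or.inr rfl)
    rwa [fd_one, fd_one, hp y hy, mul_zero, sub_zero] at h
  have hr : ∀ y ∈ K.hor, pd 1 K.r y = 0 := fun y hy => by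
    have h : K.fd K.r 1 y - 2 * K.b y * K.fd K.q 1 y + K.b y ^ 2 * K.fd K.p 1 y = 0 :=
      s y hy 3 3 (Or.inr rfl) (Or.inr rfl)
    rwa [fd_one, fd_one, fd_one, hp y hy, hq y hy, mul_zero, mul_zero, sub_zero, add_zero] at h
  refine ⟨hω, k2, fun y hy a => ?_, hp, hq, hr,
    fun y hy i j hi hj => hessN_eq_zero hω hy (h y hy).2.2 hi hj⟩
  rw [pd_comm K.isOpen K.smooth_N hy.1]
  fin_cases a
  · exact pd_eq_zero_of_forall inv_N.2.1 1 y
  · exact k2 y hy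
  · exact k12 y hy
  · exact k13 y hy

end KillingData

/-! ### Convergence of all curvature components at a regular horizon -/

theorem HasHorizonLimit.zero_mul {f g : (Fin 4 → ℝ) → ℝ} {y : Fin 4 → ℝ}
    (hf : HasHorizonLimit f y 0) (hg : Converges g y) :
    HasHorizonLimit (fun x => f x * g x) y 0 := by
  obtain ⟨m, hg⟩ := hg; simpa using hf.mul hg

theorem HasHorizonLimit.mul_zero {f g : (Fin 4 → ℝ) → ℝ} {y : Fin 4 → ℝ}
    (hg : Converges g y) (hf : HasHorizonLimit f y 0) :
    HasHorizonLimit (fun x => g x * f x) y 0 := by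
  obtain ⟨m, hg⟩ := hg; simpa using hg.mul hf

theorem HasHorizonLimit.zero_add {f g : (Fin 4 → ℝ) → ℝ} {y : Fin 4 → ℝ}
    (hf : HasHorizonLimit f y 0) (hg : HasHorizonLimit g y 0) :
    HasHorizonLimit (fun x => f x + g x) y 0 := by simpa using hf.add hg

theorem HasHorizonLimit.zero_sub {f g : (Fin 4 → ℝ) → ℝ} {y : Fin 4 → ℝ}
    (hf : HasHorizonLimit f y 0) (hg : HasHorizonLimit g y 0) :
    HasHorizonLimit (fun x => f x - g x) y 0 := by simpa using hf.sub hg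

namespace KillingData
variable {K : KillingData} {f g : (Fin 4 → ℝ) → ℝ} {x y : Fin 4 → ℝ} {l : ℝ}

theorem converges_electric (R : K.RegularHorizon) (hy : y ∈ K.hor) {i j : Fin 4} (hi : i ≠ 0)
    (hj : j ≠ 0) : Converges (K.Rm 0 i 0 j) y := by
  have hω := R.rigid
  have t : ∀ m : Fin 4, m ≠ 0 → Converges (fun x => K.η x m * K.twist i m x * K.twist j m x) y :=
    fun m hm => ((converges_η hy m).mul (converges_twist hω hy hi hm)).mul
      (converges_twist hω hy hj hm)
  exact converges_congr hy (fun x hx => Rm_electric hx i j)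
    (((limit_div hy (smooth_hessN hi hj) (R.hess y hy i j hi hj)).converges.sub
      (((converges_smooth hy K.smooth_p).mul (converges_ω_div hω hy i)).mul
        (converges_ω_div hω hy j))).add ((Converges.const _).mul
          (((t 1 (by decide)).add (t 2 (by decide))).add (t 3 (by decide)))))

theorem converges_spatial (hω : K.Rigid) (hy : y ∈ K.hor) {i j k l : Fin 4} (hi : i ≠ 0)
    (hj : j ≠ 0) (hk : k ≠ 0) (hl : l ≠ 0) : Converges (K.Rm i j k l) y := by
  have g : ∀ {i j k l : Fin 4}, i ≠ 0 → j ≠ 0 → k ≠ 0 → l ≠ 0 → Converges (K.G2 i j k l) y :=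
    fun hi hj hk hl => converges_smooth hy (smooth_G2 hi hj hk hl)
  have t : ∀ m : Fin 4, m ≠ 0 → Converges (fun x => K.η x m *
      (K.Γ m i l x * K.Γ m j k x - K.Γ m j l x * K.Γ m i k x)) y := fun m hm =>
    (converges_η hy m).mul (((converges_Γ hy hm hi hl).mul (converges_Γ hy hm hj hk)).sub
      ((converges_Γ hy hm hj hl).mul (converges_Γ hy hm hi hk)))
  exact converges_congr hy (fun x hx => Rm_spatial hx i j k l)
    ((((Converges.const _).mul ((((g hj hk hl hi).sub (g hj hl hi hk)).sub (g hi hk hl hj)).add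
      (g hi hl hj hk))).add (((t 1 (by decide)).add (t 2 (by decide))).add (t 3 (by decide)))).sub
      ((Converges.const _).mul (((converges_shear hω hy hi hl).mul (converges_shear hω hy hj hk)).sub
        ((converges_shear hω hy hj hl).mul (converges_shear hω hy hi hk)))))

/-- Every frame component of the Riemann tensor has a limit at a regular horizon. -/
theorem converges_Rm (R : K.RegularHorizon) (hy : y ∈ K.hor) (i j k l : Fin 4) :
    Converges (K.Rm i j k l) y := by
  have hω := R.rigid
  -- By antisymmetry it is enough to treat pairs whose second index is spatial.
  have main : ∀ i j k l : Fin 4, j ≠ 0 → l ≠ 0 → Converges (K.Rm i j k l) y := by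
    intro i j k l hj hl
    by_cases hi : i = 0
    · subst hi
      by_cases hk : k = 0
      · subst hk; exact converges_electric R hy hj hl
      · exact converges_magnetic hω hy hj hk hl
    · by_cases hk : k = 0
      · subst hk
        exact converges_congr hy (fun x hx => (Rm_pair hx i j 0 l).symm)
          (converges_magnetic hω hy hl hi hj)
      · exact converges_spatial hω hy hi hj hk hl
  have main2 : ∀ i j k l : Fin 4, j ≠ 0 → Converges (K.Rm i j k l) y := by
    intro i j k l hj
    by_cases hl : l = 0
    · by_cases hk : k = 0
      · exact converges_congr hy (fun x hx => by rw [hk, hl, Rm_self' hx]) (.const 0)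
      · exact converges_congr hy (fun x hx => Rm_swap' hx i j l k) (main i j l k hj hk).neg
    · exact main i j k l hj hl
  by_cases hj : j = 0
  · by_cases hi : i = 0
    · exact converges_congr hy (fun x hx => by rw [hi, hj, Rm_self hx]) (.const 0)
    · exact converges_congr hy (fun x hx => Rm_swap hx j i k l) (main2 j i k l hi).neg
  · exact main2 i j k l hj

variable (K) in
/-- Frame components of the Ricci tensor. -/
def Ric (i k : Fin 4) (x : Fin 4 → ℝ) : ℝ := contr2 (K.E x) (ricci K.metric x) i k

theorem Ric_eq (hx : x ∈ K.reg) (i k : Fin 4) :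
    K.Ric i k x = ∑ j, K.η x j * K.Rm i j k j x :=
  ricci_frame isSmoothMetricOn hx (isOrthogonalFrame hx) i k

theorem converges_Ric (R : K.RegularHorizon) (hy : y ∈ K.hor) (i k : Fin 4) :
    Converges (K.Ric i k) y :=
  converges_congr hy (fun _ hx => Ric_eq hx i k)
    (.sum _ fun j _ => (converges_η hy j).mul (converges_Rm R hy i j k j))

theorem converges_scalarCurv (R : K.RegularHorizon) (hy : y ∈ K.hor) :
    Converges (scalarCurv K.metric) y :=
  converges_congr hy (fun _ hx => scalarCurv_frame (isOrthogonalFrame hx))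
    (.sum _ fun i _ => (converges_η hy i).mul (converges_Ric R hy i i))

/-- The frame is orthogonal also in the sense that the metric is diagonal in it. -/
theorem contr2_metric (hx : x ∈ K.reg) (i j : Fin 4) : contr2 (K.E x) (K.metric x) i j =
    (!![-1, 0, 0, 0; 0, 1, 0, 0; 0, 0, K.p x, 0;
      0, 0, 0, (K.p x * K.r x - K.q x ^ 2) / K.p x] : Matrix (Fin 4) (Fin 4) ℝ) i j := by
  have hN := hx.2
  have hp := p_ne hx.1
  have h := ω_mul_q (K := K) x
  simp only [contr2, metric]
  fin_cases i <;> fin_cases j <;> simp [Fin.sum_univ_four, E, b] <;> field_simp <;> try ring1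
  all_goals linear_combination h

variable (K) in
/-- Frame components of the Einstein tensor. -/
def Ein (i k : Fin 4) (x : Fin 4 → ℝ) : ℝ := contr2 (K.E x) (einstein K.metric x) i k

theorem Ein_eq (x : Fin 4 → ℝ) (i k : Fin 4) : K.Ein i k x =
    K.Ric i k x - scalarCurv K.metric x / 2 * contr2 (K.E x) (K.metric x) i k :=
  contr2_einstein _ _ _ _ _

theorem converges_Ein (R : K.RegularHorizon) (hy : y ∈ K.hor) (i k : Fin 4) :
    Converges (K.Ein i k) y := by
  have h : Converges (fun x => contr2 (K.E x) (K.metric x) i k) y := by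
    refine converges_congr hy (fun x hx => contr2_metric hx i k) ?_
    have hd : SmoothOn K.S fun x => (K.p x * K.r x - K.q x ^ 2) / K.p x :=
      ((K.smooth_p.mul K.smooth_r).sub (K.smooth_q.pow 2)).div K.smooth_p fun _ hx => p_ne hx
    fin_cases i <;> fin_cases k <;> first
      | exact Converges.const _ | exact converges_smooth hy K.smooth_p | exact converges_smooth hy hd
  refine converges_congr hy (g := fun x => K.Ric i k x - scalarCurv K.metric x * (1 / 2) *
    contr2 (K.E x) (K.metric x) i k) (fun x _ => ?_) ?_
  · rw [Ein_eq]; ring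
  · exact (converges_Ric R hy i k).sub (((converges_scalarCurv R hy).mul (.const _)).mul h)

/-! ### The limiting Einstein tensor -/

theorem pd_comm_inner (hf : SmoothOn K.S f) (hx : x ∈ K.S) (a b c : Fin 4) :
    pd a (pd b (pd c f)) x = pd a (pd c (pd b f)) x :=
  pd_congr_on K.isOpen hx a fun _ hz => pd_comm K.isOpen hf hz b c

/-- The angular derivatives of the lapse vanish to second order. -/
theorem limit_fd_N_div (R : K.RegularHorizon) (hy : y ∈ K.hor) {i : Fin 4} (hi : i ≠ 1) :
    HasHorizonLimit (fun x => K.fd K.N i x / K.N x) y 0 := by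
  have h : ∀ a : Fin 4, a ≠ 1 → HasHorizonLimit (fun x => pd a K.N x / K.N x) y 0 := by
    intro a ha
    have := limit_div hy (K.smooth_N.pd K.isOpen a) (pd_N_tangent hy ha)
    rwa [pd_comm K.isOpen K.smooth_N hy.1, R.zeroth_law y hy, zero_div] at this
  fin_cases i
  · exact limit_congr hy (fun x _ => by simp [fd_zero inv_N]) (.const 0)
  · exact absurd rfl hi
  · exact limit_congr hy (fun x _ => by simp only [Fin.reduceFinMk, fd_two]) (h 2 (by decide))
  · refine limit_congr hy (fun x _ => ?_) ((h 3 (by decide)).zero_sub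
      (.mul_zero (converges_smooth hy smooth_b) (h 2 (by decide))))
    simp only [Fin.reduceFinMk, fd_three]; ring

theorem limit_fd_ω_div (R : K.RegularHorizon) (hy : y ∈ K.hor) {i : Fin 4} (hi : i ≠ 1) :
    HasHorizonLimit (fun x => K.fd K.ω i x / K.N x) y 0 := by
  fin_cases i
  · exact limit_congr hy (fun x _ => by simp [fd_zero inv_ω]) (.const 0)
  · exact absurd rfl hi
  · exact limit_congr hy (fun x _ => by simp [fd_two, pd2_ω]) (.const 0)
  · have := limit_div hy (K.smooth_ω.pd K.isOpen 3) (R.rigid y hy 3)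
    rw [pd_comm K.isOpen K.smooth_ω hy.1,
      pd_tangent (f := pd 1 K.ω) (fun y hy => R.rigid y hy 1) hy (by decide), zero_div] at this
    exact limit_congr hy (fun x _ => by simp [fd_three, pd2_ω]) this

theorem twist_self (x : Fin 4 → ℝ) (i : Fin 4) : K.twist i i x = 0 := sub_self _

theorem limit_twist (R : K.RegularHorizon) (hy : y ∈ K.hor) {i j : Fin 4} (hi : i ≠ 0) (hj : j ≠ 0)
    (hi1 : i ≠ 1) (hj1 : j ≠ 1) : HasHorizonLimit (K.twist i j) y 0 := by
  have c : ∀ {c : Prop} [Decidable c] {i : Fin 4}, i ≠ 1 →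
      HasHorizonLimit (fun x => if c then K.fd K.ω i x / K.N x else 0) y 0 := by
    intro c _ i hi
    split_ifs
    · exact limit_fd_ω_div R hy hi
    · exact .const 0
  refine limit_congr hy (fun x hx => ?_) (.mul_zero (converges_smooth hy K.smooth_p)
    ((c (c := i = 2) hj1).zero_sub (c (c := j = 2) hi1)))
  rw [twist_eq x hi hj, ntwist]; split_ifs <;> ring

theorem limit_shear (R : K.RegularHorizon) (hy : y ∈ K.hor) {i j : Fin 4} (hi : i ≠ 0) (hj : j ≠ 0)
    (hi1 : i ≠ 1) (hj1 : j ≠ 1) : HasHorizonLimit (K.shear i j) y 0 := by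
  have c : ∀ {c : Prop} [Decidable c] {i : Fin 4}, i ≠ 1 →
      HasHorizonLimit (fun x => if c then K.fd K.ω i x / K.N x else 0) y 0 := by
    intro c _ i hi
    split_ifs
    · exact limit_fd_ω_div R hy hi
    · exact .const 0
  refine limit_congr hy (fun x hx => ?_) (.mul_zero (converges_smooth hy K.smooth_p.neg)
    ((c (c := i = 2) hj1).zero_add (c (c := j = 2) hi1)))
  rw [shear_eq x hi hj, nshear]; split_ifs <;> ring

theorem twist_one_three (x : Fin 4 → ℝ) : K.twist 1 3 x = 0 ∧ K.twist 3 1 x = 0 := by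
  rw [twist_eq x (by decide) (by decide), twist_eq x (by decide) (by decide), ntwist, ntwist]
  simp

theorem shear_one_three (x : Fin 4 → ℝ) : K.shear 1 3 x = 0 ∧ K.shear 3 1 x = 0 := by
  rw [shear_eq x (by decide) (by decide), shear_eq x (by decide) (by decide), nshear, nshear]
  simp

theorem shear_one_one (x : Fin 4 → ℝ) : K.shear 1 1 x = 0 := by
  rw [shear_eq x (by decide) (by decide), nshear]
  simp

/-- The normal derivative of the intrinsic metric of the horizon sections vanishes on the
horizon. -/
theorem G1_hor (R : K.RegularHorizon) (hy : y ∈ K.hor) {i j : Fin 4} (hi : i ≠ 0) (hj : j ≠ 0) :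
    K.G1 1 i j y = 0 := by
  have hp := R.p y hy
  have hq := R.q y hy
  have hr := R.r y hy
  simp only [G1, tab1, fd_one, hp, hq, hr]
  fin_cases i <;> fin_cases j <;> simp_all

theorem limit_G1 (R : K.RegularHorizon) (hy : y ∈ K.hor) {i j : Fin 4} (hi : i ≠ 0) (hj : j ≠ 0) :
    HasHorizonLimit (K.G1 1 i j) y 0 := by
  have := limit_smooth hy (smooth_G1 (K := K) (i := 1) (by decide) hi hj)
  rwa [G1_hor R hy hi hj] at this

/-- The second normal derivative of the intrinsic metric, as a limit of the first one. -/
theorem limit_G1_div (R : K.RegularHorizon) (hy : y ∈ K.hor) {A : Fin 4} (hA : A = 2 ∨ A = 3) :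
    HasHorizonLimit (fun x => K.G1 1 A A x / K.N x) y (K.G2 1 1 A A y / pd 1 K.N y) := by
  have hp := limit_div hy (K.smooth_p.pd K.isOpen 1) (R.p y hy)
  have hq := limit_div hy (K.smooth_q.pd K.isOpen 1) (R.q y hy)
  have hr := limit_div hy (K.smooth_r.pd K.isOpen 1) (R.r y hy)
  have hb := limit_smooth hy (smooth_b (K := K))
  have e : ∀ f : (Fin 4 → ℝ) → ℝ, K.fdd f 1 1 y = pd 1 (pd 1 f) y := fun f => (fdd_of_ne y).1
  rcases hA with rfl | rfl
  · have h1 : ∀ x, K.G1 1 2 2 x = pd 1 K.p x := fun x => fd_one _ _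
    have h2 : K.G2 1 1 2 2 y = pd 1 (pd 1 K.p) y := e K.p
    rw [h2]
    simpa only [h1] using hp
  · have h1 : ∀ x, K.G1 1 3 3 x
        = pd 1 K.r x - 2 * K.b x * pd 1 K.q x + K.b x ^ 2 * pd 1 K.p x := fun x => by
      rw [← fd_one (K := K), ← fd_one (K := K), ← fd_one (K := K)]; rfl
    have h2 : K.G2 1 1 3 3 y = pd 1 (pd 1 K.r) y - 2 * K.b y * pd 1 (pd 1 K.q) y
        + K.b y ^ 2 * pd 1 (pd 1 K.p) y := by
      rw [← e, ← e, ← e]; rfl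
    rw [h2]
    convert limit_congr hy (fun x hx => ?_) ((hr.sub (((HasHorizonLimit.const 2).mul hb).mul hq)).add
      ((hb.pow 2).mul hp)) using 1
    · ring
    · rw [h1]; ring

/-- Tangential second derivatives of the lapse, divided by the lapse. -/
theorem limit_fdd_N_div (R : K.RegularHorizon) (hy : y ∈ K.hor) {i j : Fin 4} (hj : j ≠ 0)
    (hi : i ≠ 0) (hj1 : j ≠ 1) : HasHorizonLimit (fun x => K.fdd K.N i j x / K.N x) y 0 := by
  have h : ∀ a b : Fin 4, b ≠ 1 → HasHorizonLimit (fun x => pd a (pd b K.N) x / K.N x) y 0 := by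
    intro a b hb
    have h0 : pd a (pd b K.N) y = 0 := by
      by_cases ha : a = 1
      · rw [ha, pd_comm K.isOpen K.smooth_N hy.1, R.zeroth_law y hy]
      · exact pd_tangent (fun y hy => pd_N_tangent hy hb) hy ha
    have := limit_div hy ((K.smooth_N.pd K.isOpen b).pd K.isOpen a) h0
    have e : pd 1 (pd a (pd b K.N)) y = 0 := by
      rw [pd_comm_inner K.smooth_N hy.1, pd_comm K.isOpen (K.smooth_N.pd K.isOpen a) hy.1 1 b]
      refine pd_tangent (fun y hy => ?_) hy hb
      rw [pd_comm K.isOpen K.smooth_N hy.1, R.zeroth_law y hy]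
    rwa [e, zero_div] at this
  have hs : HasHorizonLimit (fun x => ∑ a, ∑ b, (K.E x a i * K.E x b j) *
      (pd a (pd b K.N) x / K.N x)) y 0 := by
    have := HasHorizonLimit.sum (y := y) Finset.univ (F := fun a x => ∑ b, (K.E x a i * K.E x b j) *
      (pd a (pd b K.N) x / K.N x)) (L := fun a => ∑ b : Fin 4, (0 : ℝ)) fun a _ =>
        HasHorizonLimit.sum Finset.univ (L := fun _ => 0) fun b _ => ?_
    · simpa using this
    · by_cases hb : b = 1
      · have h0 : ∀ x, K.E x 1 j = 0 := by
          intro x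
          fin_cases j <;> first | exact absurd rfl hj1 | rfl
        simp only [hb, h0, mul_zero, MulZeroClass.zero_mul]
        exact .const 0
      · exact .mul_zero ((converges_smooth hy (smooth_E a hi)).mul
          (converges_smooth hy (smooth_E b hj))) (h a b hb)
  refine limit_congr hy (fun x _ => ?_) hs
  simp only [fdd, Finset.sum_div]
  refine Finset.sum_congr rfl fun a _ => Finset.sum_congr rfl fun b _ => by ring

end KillingData

namespace KillingData
variable {K : KillingData} {f g : (Fin 4 → ℝ) → ℝ} {x y : Fin 4 → ℝ} {l : ℝ}

theorem hessN_angular_div (hx : x ∈ K.reg) (i j : Fin 4) : K.hessN i j x / K.N x =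
    K.fdd K.N i j x / K.N x + (1 / 2) * (K.G1 1 i j x / K.N x) * K.fd K.N 1 x
    - (K.η x 2 * K.Γ 2 i j x * (K.fd K.N 2 x / K.N x)
      + K.η x 3 * K.Γ 3 i j x * (K.fd K.N 3 x / K.N x)) := by
  have hN := hx.2
  have e1 : K.η x 1 = 1 := rfl
  rw [hessN, Γ_one, e1]
  field_simp
  ring

/-- For a tangential direction `e_A`, the Hessian of the lapse is `½ ∂_n g_AA ∂_n N` to leading
order, and `∂_n g_AA` vanishes on the horizon. -/
theorem limit_hessN_div (R : K.RegularHorizon) (hy : y ∈ K.hor) {A : Fin 4} (hA : A = 2 ∨ A = 3) :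
    HasHorizonLimit (fun x => K.hessN A A x / K.N x) y ((1 / 2) * K.G2 1 1 A A y) := by
  have h0 : A ≠ 0 := by rcases hA with rfl | rfl <;> decide
  have h1 : A ≠ 1 := by rcases hA with rfl | rfl <;> decide
  have t : ∀ k : Fin 4, k ≠ 0 → k ≠ 1 → HasHorizonLimit (fun x => K.η x k * K.Γ k A A x *
      (K.fd K.N k x / K.N x)) y 0 := fun k hk hk1 =>
    .mul_zero ((converges_η hy k).mul (converges_Γ hy hk h0 h0)) (limit_fd_N_div R hy hk1)
  have hn := limit_smooth hy (smooth_fd K.smooth_N (by decide : (1 : Fin 4) ≠ 0))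
  have hl := ((limit_fdd_N_div R hy h0 h0 h1).add
    (((HasHorizonLimit.const (1 / 2)).mul (limit_G1_div R hy hA)).mul hn)).sub
      ((t 2 (by decide) (by decide)).zero_add (t 3 (by decide) (by decide)))
  have hκ := κ_ne hy
  rw [fd_one] at hl
  convert limit_congr hy (fun x hx => hessN_angular_div hx A A) hl using 1
  field_simp
  ring

theorem limit_hessN_mixed_div (R : K.RegularHorizon) (hy : y ∈ K.hor) {A : Fin 4}
    (h0 : A ≠ 0) (h1 : A ≠ 1) : HasHorizonLimit (fun x => K.hessN 1 A x / K.N x) y 0 := by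
  have n1 : (1 : Fin 4) ≠ 0 := by decide
  have t : ∀ k : Fin 4, k ≠ 0 → k ≠ 1 → HasHorizonLimit (fun x => K.η x k * K.Γ k 1 A x *
      (K.fd K.N k x / K.N x)) y 0 := fun k hk hk1 =>
    .mul_zero ((converges_η hy k).mul (converges_Γ hy hk n1 h0)) (limit_fd_N_div R hy hk1)
  refine limit_congr hy (fun x hx => ?_) ((limit_fdd_N_div R hy h0 n1 h1).zero_sub
    ((t 2 (by decide) (by decide)).zero_add (t 3 (by decide) (by decide))))
  rw [hessN_angular_div hx, G1_one]; ring

/-- The combination of curvatures entering `G_χχ + G_nn`. -/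
theorem limit_electric_add_spatial (R : K.RegularHorizon) (hy : y ∈ K.hor) {A : Fin 4}
    (hA : A = 2 ∨ A = 3) :
    HasHorizonLimit (fun x => K.Rm 0 A 0 A x + K.Rm 1 A 1 A x) y 0 := by
  have h0 : A ≠ 0 := by rcases hA with rfl | rfl <;> decide
  have h1 : A ≠ 1 := by rcases hA with rfl | rfl <;> decide
  have n1 : (1 : Fin 4) ≠ 0 := by decide
  have G : ∀ m : Fin 4, m ≠ 0 → HasHorizonLimit (fun x => K.η x m *
      (((1 / 2) * K.G1 1 m A x) * ((1 / 2) * K.G1 1 m A x))) y 0 := fun m hm =>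
    .mul_zero (converges_η hy m) (HasHorizonLimit.zero_mul
      (.mul_zero (.const _) (limit_G1 R hy hm h0))
      ((Converges.const _).mul (limit_G1 R hy hm h0).converges))
  have T : ∀ m : Fin 4, m ≠ 0 → m ≠ 1 → HasHorizonLimit (fun x => K.η x m *
      (K.twist A m x * K.twist A m x)) y 0 := fun m hm hm1 =>
    .mul_zero (converges_η hy m) ((limit_twist R hy h0 hm h1 hm1).zero_mul
      (converges_twist R.rigid hy h0 hm))
  have W : HasHorizonLimit (fun x => K.p x * ((K.fd K.ω A x / K.N x) * (K.fd K.ω A x / K.N x)))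
      y 0 := .mul_zero (converges_smooth hy K.smooth_p)
        ((limit_fd_ω_div R hy h1).zero_mul (converges_ω_div R.rigid hy A))
  have H := (limit_hessN_div R hy hA).sub ((HasHorizonLimit.const (1 / 2)).mul
    (limit_smooth hy (smooth_G2 (K := K) n1 n1 h0 h0)))
  rw [sub_self] at H
  have hl := (((H.zero_sub W).zero_add (.mul_zero (.const (1 / 4)) ((T 2 (by decide)
    (by decide)).zero_add (T 3 (by decide) (by decide))))).zero_add
    (((G 1 n1).zero_add (G 2 (by decide))).zero_add (G 3 (by decide))))
  refine limit_congr hy (fun x hx => ?_) hl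
  -- The two remaining rotation terms, one from the twist and one from the shear, cancel.
  have e1 : K.η x 1 = 1 := rfl
  have hts : K.twist A 1 x * K.twist A 1 x = K.shear 1 A x * K.shear A 1 x := by
    rcases hA with rfl | rfl
    · rw [twist_eq x h0 n1, shear_eq x n1 h0, shear_eq x h0 n1, ntwist, nshear, nshear]
      simp
      ring
    · rw [(twist_one_three x).2, (shear_one_three x).2, MulZeroClass.zero_mul,
        MulZeroClass.mul_zero]
  rw [Rm_electric hx, Rm_spatial hx, shear_one_one]
  simp only [Γ_right_one, Γ_right_one', G1_one', G2_one', e1]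
  linear_combination (1 / 4) * hts

theorem limit_G2 (R : K.RegularHorizon) (hy : y ∈ K.hor) {A i j : Fin 4} (h0 : A ≠ 0) (h1 : A ≠ 1)
    (hi : i ≠ 0) (hj : j ≠ 0) : HasHorizonLimit (K.G2 1 A i j) y 0 := by
  have := limit_smooth hy (smooth_G2 (K := K) (i := 1) (by decide) h0 hi hj)
  have e : K.G2 1 A i j y = 0 := by
    have d : ∀ f : (Fin 4 → ℝ) → ℝ, SmoothOn K.S f → (∀ y ∈ K.hor, pd 1 f y = 0) →
        K.fdd f 1 A y = 0 := by
      intro f hf h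
      have t : ∀ a : Fin 4, a ≠ 1 → pd 1 (pd a f) y = 0 := fun a ha => by
        rw [pd_comm K.isOpen hf hy.1, pd_tangent h hy ha]
      fin_cases A
      · exact absurd rfl h0
      · exact absurd rfl h1
      · exact (fdd_of_ne y).2.1.trans (t 2 (by decide))
      · refine (fdd_of_ne y).2.2.trans ?_
        rw [t 2 (by decide), t 3 (by decide)]; ring
    have dp := d K.p K.smooth_p R.p
    have dq := d K.q K.smooth_q R.q
    have dr := d K.r K.smooth_r R.r
    simp only [G2, tab2, dp, dq, dr]
    fin_cases i <;> fin_cases j <;> simp_all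
  rwa [e] at this

/-- Here `A` and `B` are the two directions tangent to the horizon sections. -/
theorem limit_Ric_mixed (R : K.RegularHorizon) (hy : y ∈ K.hor) {A B : Fin 4}
    (hA : A = 2 ∧ B = 3 ∨ A = 3 ∧ B = 2) : HasHorizonLimit (K.Ric 1 A) y 0 := by
  have h0 : A ≠ 0 := by rcases hA with ⟨rfl, rfl⟩ | ⟨rfl, rfl⟩ <;> decide
  have h1 : A ≠ 1 := by rcases hA with ⟨rfl, rfl⟩ | ⟨rfl, rfl⟩ <;> decide
  have b0 : B ≠ 0 := by rcases hA with ⟨rfl, rfl⟩ | ⟨rfl, rfl⟩ <;> decide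
  have b1 : B ≠ 1 := by rcases hA with ⟨rfl, rfl⟩ | ⟨rfl, rfl⟩ <;> decide
  have n1 : (1 : Fin 4) ≠ 0 := by decide
  have hω := R.rigid
  -- The electric term.
  have hel : HasHorizonLimit (K.Rm 0 1 0 A) y 0 := by
    have W : HasHorizonLimit (fun x => K.p x * (K.fd K.ω 1 x / K.N x) * (K.fd K.ω A x / K.N x))
        y 0 := .mul_zero ((converges_smooth hy K.smooth_p).mul (converges_ω_div hω hy 1))
          (limit_fd_ω_div R hy h1)
    have T2 : HasHorizonLimit (fun x => K.η x 2 * K.twist 1 2 x * K.twist A 2 x) y 0 :=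
      .mul_zero ((converges_η hy 2).mul (converges_twist hω hy n1 (by decide)))
        (limit_twist R hy h0 (by decide) h1 (by decide))
    refine limit_congr hy (fun x hx => ?_) (((limit_hessN_mixed_div R hy h0 h1).zero_sub W).zero_add
      (.mul_zero (.const (1 / 4)) T2))
    rw [Rm_electric hx, twist_self, (twist_one_three x).1]; ring
  -- The spatial term.
  have hsp : HasHorizonLimit (K.Rm 1 B A B) y 0 := by
    have G : ∀ m : Fin 4, m ≠ 0 → HasHorizonLimit (fun x => K.η x m *
        (((1 / 2) * K.G1 1 m B x) * K.Γ m B A x - K.Γ m B B x * ((1 / 2) * K.G1 1 m A x))) y 0 :=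
      fun m hm => .mul_zero (converges_η hy m)
        (((HasHorizonLimit.mul_zero (.const _) (limit_G1 R hy hm b0)).zero_mul
          (converges_Γ hy hm b0 h0)).zero_sub (.mul_zero (converges_Γ hy hm b0 b0)
            (.mul_zero (.const _) (limit_G1 R hy hm h0))))
    have Sh : HasHorizonLimit (fun x => K.shear 1 B x * K.shear B A x
        - K.shear B B x * K.shear 1 A x) y 0 :=
      (HasHorizonLimit.mul_zero (converges_shear hω hy n1 b0) (limit_shear R hy b0 h0 b1 h1)).zero_sub
        ((limit_shear R hy b0 b0 b1 b1).zero_mul (converges_shear hω hy n1 h0))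
    refine limit_congr hy (fun x hx => ?_) (((HasHorizonLimit.mul_zero (.const (1 / 2))
      ((limit_G2 R hy b0 b1 b0 h0).zero_sub (limit_G2 R hy h0 h1 b0 b0))).zero_add
      (((G 1 n1).zero_add (G 2 (by decide))).zero_add (G 3 (by decide)))).zero_sub
      (.mul_zero (.const (1 / 4)) Sh))
    rw [Rm_spatial hx, G2_one', G2_one]
    simp only [Γ_right_one]
    ring
  refine limit_congr hy (fun x hx => ?_) ((hel.neg).add (.mul_zero (converges_η hy B) hsp)) |> fun h => by
    simpa using h
  rw [Ric_eq hx, Fin.sum_univ_four, Rm_self hx, Rm_swap hx 0 1 A 0, Rm_swap' hx 0 1 0 A]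
  have e0 : K.η x 0 = -1 := rfl
  rcases hA with ⟨rfl, rfl⟩ | ⟨rfl, rfl⟩
  · rw [Rm_self' hx, e0]; ring
  · rw [Rm_self' hx, e0]; ring

/-- The components that vanish by time reversal. -/
theorem Ric_time_reversal (hx : x ∈ K.reg) : K.Ric 0 1 x = 0 ∧ K.Ric 0 3 x = 0 := by
  have n1 : (1 : Fin 4) ≠ 0 := by decide
  have n2 : (2 : Fin 4) ≠ 0 := by decide
  have n3 : (3 : Fin 4) ≠ 0 := by decide
  have main : K.Rm 0 2 1 2 x = 0 ∧ K.Rm 0 3 1 3 x = 0 ∧ K.Rm 0 1 3 1 x = 0 ∧ K.Rm 0 2 3 2 x = 0 := by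
    rw [Rm_magnetic hx n2 n1 n2, Rm_magnetic hx n3 n1 n3, Rm_magnetic hx n1 n3 n1,
      Rm_magnetic hx n2 n3 n2]
    have t13 := (twist_one_three (K := K) x).1
    have t31 := (twist_one_three (K := K) x).2
    rcases K.static_or_axisymmetric with h | ⟨hq, h⟩
    · have h1 : ∀ a x, pd a K.ω x = 0 := fun a x => pd_eq_zero_of_forall h a x
      have h2 : ∀ a b x, pd a (pd b K.ω) x = 0 := fun a b x => pd_eq_zero_of_forall (h1 b) a x
      have hfd : ∀ i, K.fd K.ω i x = 0 := fun i => by simp [fd, h1]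
      have hfdd : ∀ i j, K.fdd K.ω i j x = 0 := fun i j => by simp [fdd, h2]
      have ht : ∀ i j : Fin 4, i ≠ 0 → j ≠ 0 → K.twist i j x = 0 := fun i j hi hj => by
        rw [twist_eq x hi hj, ntwist]; simp [hfd]
      have hr : ∀ i j, K.rot i j x = 0 := fun i j => by simp [rot, hfd, hfdd]
      have hrp : ∀ i j, K.rotp i j x = 0 := fun i j => by simp [rotp, hfd]
      simp [ht, hr, hrp]
    · have hb : K.b x = 0 := by simp [b, hq]
      have g2 : ∀ j k : Fin 4, j ≠ 0 → k ≠ 0 → K.G1 2 j k x = 0 := by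
        intro j k hj hk
        simp only [G1, tab1, fd_two, (h x).2.2.1, (h x).2.2.2, pd_eq_zero_of_forall hq, hb]
        fin_cases j <;> fin_cases k <;> simp_all
      have g23 : ∀ i, K.G1 i 2 3 x = 0 := by
        intro i; simp [G1, tab1, hb, fd, pd_eq_zero_of_forall hq]
      have g32 : ∀ i, K.G1 i 3 2 x = 0 := by
        intro i; rw [G1_symm, g23]
      have hfω : K.fd K.ω 2 x = 0 := by rw [fd_two, (h x).2.1]
      have hfN : K.fd K.N 2 x = 0 := by rw [fd_two, (h x).1]
      have hfp : K.fd K.p 2 x = 0 := by rw [fd_two, (h x).2.2.1]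
      have d2 : ∀ i : Fin 4, i ≠ 0 → K.fdd K.ω i 2 x = 0 := fun i hi => by
        rw [fdd_eq_of_axisymmetric hq _ _ hi n2, pd_eq_zero_of_forall fun x => (h x).2.1]
      have d2' : ∀ i : Fin 4, i ≠ 0 → K.fdd K.ω 2 i x = 0 := fun i hi => by
        rw [fdd_symm K.smooth_ω hx.1, d2 i hi]
      refine ⟨?_, ?_, ?_, ?_⟩ <;>
        simp [rot, rotp, hfω, hfN, hfp, d2, d2', t13, t31, twist_self, Γ, gam, g2, g23, g32, G1_one,
          G1_one']
  rw [Ric_eq hx, Ric_eq hx, Fin.sum_univ_four, Fin.sum_univ_four, main.1, main.2.1, main.2.2.1,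
    main.2.2.2, Rm_self hx, Rm_self hx, Rm_self' hx, Rm_self' hx]
  simp

/-- Where the third normal derivative of `ω` enters the curvature. -/
theorem limit_rot_one (R : K.RegularHorizon) (hy : y ∈ K.hor) : HasHorizonLimit (K.rot 1 1) y
    (pd 1 (pd 1 (pd 1 K.ω)) y / (2 * pd 1 K.N y)) := by
  have n1 : (1 : Fin 4) ≠ 0 := by decide
  rcases K.static_or_axisymmetric with h | ⟨hq, -⟩
  · have h1 : ∀ a x, pd a K.ω x = 0 := fun a x => pd_eq_zero_of_forall h a x
    have h2 : ∀ a b x, pd a (pd b K.ω) x = 0 := fun a b x => pd_eq_zero_of_forall (h1 b) a x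
    rw [pd_eq_zero_of_forall (h2 1 1), zero_div]
    refine limit_congr hy (fun x _ => ?_) (.const 0)
    simp [rot, fd, fdd, h1, h2]
  · have s0 := K.smooth_ω.pd K.isOpen 1
    have s1 := s0.pd K.isOpen 1
    have s2 := s1.pd K.isOpen 1
    have t0 := K.smooth_N.pd K.isOpen 1
    have t1 := t0.pd K.isOpen 1
    have d : ∀ {f x}, SmoothOn K.S f → x ∈ K.S → DifferentiableAt ℝ f x := fun h hx =>
      h.differentiableAt K.isOpen hx
    convert limit_rot_axisymmetric R.rigid hy hq n1 n1 using 1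
    have e : ∀ x ∈ K.S, pd 1 (fun x => pd 1 (pd 1 K.ω) x * K.N x - pd 1 K.ω x * pd 1 K.N x) x
        = pd 1 (pd 1 (pd 1 K.ω)) x * K.N x - pd 1 K.ω x * pd 1 (pd 1 K.N) x := by
      intro x hx
      rw [pd_mul_sub_mul 1 (d s1 hx) (d K.smooth_N hx) (d s0 hx) (d t0 hx)]; ring
    rw [pd_congr_on K.isOpen hy.1 1 e, pd_mul_sub_mul 1 (d s2 hy.1) (d K.smooth_N hy.1) (d s0 hy.1)
      (d t1 hy.1), N_hor hy, R.κ₂ y hy, R.rigid y hy]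
    have hκ := κ_ne hy
    field_simp
    ring

theorem limit_rot_three (R : K.RegularHorizon) (hy : y ∈ K.hor) :
    HasHorizonLimit (K.rot 3 3) y 0 := by
  have n3 : (3 : Fin 4) ≠ 0 := by decide
  have hd : HasHorizonLimit (fun x => K.fdd K.ω 3 3 x / K.N x) y 0 := by
    rcases K.static_or_axisymmetric with h | ⟨hq, -⟩
    · have h1 : ∀ a x, pd a K.ω x = 0 := fun a x => pd_eq_zero_of_forall h a x
      have h2 : ∀ a b x, pd a (pd b K.ω) x = 0 := fun a b x => pd_eq_zero_of_forall (h1 b) a x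
      refine limit_congr hy (fun x _ => ?_) (.const 0)
      simp [fdd, h2]
    · have h0 : ∀ y ∈ K.hor, pd 3 (pd 3 K.ω) y = 0 := fun y hy =>
        pd_tangent (fun y hy => R.rigid y hy 3) hy (by decide)
      have := limit_div hy ((K.smooth_ω.pd K.isOpen 3).pd K.isOpen 3) (h0 y hy)
      have e : pd 1 (pd 3 (pd 3 K.ω)) y = 0 := by
        rw [pd_comm K.isOpen (K.smooth_ω.pd K.isOpen 3) hy.1 1 3]
        refine pd_tangent (fun y hy => ?_) hy (by decide)
        rw [pd_comm K.isOpen K.smooth_ω hy.1]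
        exact pd_tangent (fun y hy => R.rigid y hy 1) hy (by decide)
      rw [e, zero_div] at this
      exact limit_congr hy (fun x _ => by rw [fdd_eq_of_axisymmetric hq _ _ n3 n3]) this
  refine limit_congr hy (fun x hx => ?_) (hd.zero_sub ((limit_fd_ω_div R hy (i := 3)
    (by decide)).zero_mul (limit_fd_N_div R hy (i := 3) (by decide)).converges))
  have hN := hx.2
  rw [rot]; field_simp

/-- The obstruction to block-diagonalisation: the third normal derivative of `ω`. -/
theorem limit_Ric_two (R : K.RegularHorizon) (hy : y ∈ K.hor) : HasHorizonLimit (K.Ric 0 2) y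
    (K.p y * pd 1 (pd 1 (pd 1 K.ω)) y / (4 * pd 1 K.N y)) := by
  have n1 : (1 : Fin 4) ≠ 0 := by decide
  have n2 : (2 : Fin 4) ≠ 0 := by decide
  have n3 : (3 : Fin 4) ≠ 0 := by decide
  have hω := R.rigid
  have c2 : Converges (fun x => (1 / 2) * (K.η x 2 * K.twist 1 2 x)) y :=
    (Converges.const _).mul ((converges_η hy 2).mul (converges_twist hω hy n1 n2))
  have fdp : ∀ {f : (Fin 4 → ℝ) → ℝ} {i : Fin 4}, SmoothOn K.S f → i ≠ 0 → Converges (K.fd f i) y :=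
    fun hf hi => converges_smooth hy (smooth_fd hf hi)
  have hp1 : HasHorizonLimit (K.fd K.p 1) y 0 := by
    have := limit_smooth hy (smooth_fd K.smooth_p n1)
    rwa [fd_one, R.p y hy] at this
  have h1 : HasHorizonLimit (K.Rm 0 1 2 1) y
      (K.p y * pd 1 (pd 1 (pd 1 K.ω)) y / (4 * pd 1 K.N y)) := by
    have hl := (((HasHorizonLimit.const (1 / 2)).mul ((limit_smooth hy K.smooth_p).mul
      (limit_rot_one R hy))).add (HasHorizonLimit.mul_zero (converges_ω_div hω hy 1) hp1)).add
      (HasHorizonLimit.mul_zero c2 (HasHorizonLimit.mul_zero (.const (1 / 2))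
        (limit_G1 R hy n2 n2)))
    convert limit_congr hy (fun x hx => ?_) hl using 1
    · rw [add_zero, add_zero]; ring
    · rw [Rm_magnetic hx n1 n2 n1, twist_self, (twist_one_three x).1, rotp]
      simp only [Γ_right_one, G1_one']
      simp
      ring
  have hz : HasHorizonLimit (K.Rm 0 3 2 3) y 0 := by
    have hrot := HasHorizonLimit.mul_zero (converges_smooth hy K.smooth_p) (limit_rot_three R hy)
    have hrp : HasHorizonLimit (K.rotp 3 3) y 0 :=
      ((limit_fd_ω_div R hy (i := 3) (by decide)).zero_mul (fdp K.smooth_p n3)).zero_add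
        ((limit_fd_ω_div R hy (i := 3) (by decide)).zero_mul (fdp K.smooth_p n3))
    have a1 : HasHorizonLimit (fun x => K.twist 2 1 x * (-(1 / 2) * K.G1 1 3 3 x)) y 0 :=
      .mul_zero (converges_twist hω hy n2 n1) (.mul_zero (.const _) (limit_G1 R hy n3 n3))
    have a2 : HasHorizonLimit (fun x => K.η x 2 * (K.twist 3 2 x * K.Γ 2 3 2 x)) y 0 :=
      .mul_zero (converges_η hy 2) ((limit_twist R hy n3 n2 (by decide) (by decide)).zero_mul
        (converges_Γ hy n2 n3 n2))
    have a3 : HasHorizonLimit (fun x => K.η x 3 * (K.twist 2 3 x * K.Γ 3 3 3 x)) y 0 :=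
      .mul_zero (converges_η hy 3) ((limit_twist R hy n2 n3 (by decide) (by decide)).zero_mul
        (converges_Γ hy n3 n3 n3))
    have hl := (HasHorizonLimit.mul_zero (.const (1 / 2)) (hrot.zero_add hrp)).zero_add
      (HasHorizonLimit.mul_zero (.const (1 / 2)) ((a2.zero_sub a1).zero_sub a3))
    refine limit_congr hy (fun x hx => ?_) hl
    have e1 : K.η x 1 = 1 := rfl
    rw [Rm_magnetic hx n3 n2 n3, twist_self, twist_self, (twist_one_three x).2, Γ_one x 3 3, e1]
    simp
    ring
  have hl := h1.add (HasHorizonLimit.mul_zero (converges_η hy 3) hz)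
  rw [add_zero] at hl
  refine limit_congr hy (fun x hx => ?_) hl
  have e1 : K.η x 1 = 1 := rfl
  rw [Ric_eq hx, Fin.sum_univ_four, Rm_self hx, Rm_self' hx, e1]
  ring

end KillingData

/-! ### The tetrad adapted to the Killing field -/

theorem eval2_smul (T : Tensor2) (x u v : Fin 4 → ℝ) (s t : ℝ) :
    eval2 T x (s • u) (t • v) = s * t * eval2 T x u v := by
  simp only [eval2, Pi.smul_apply, smul_eq_mul, Finset.mul_sum]
  refine Finset.sum_congr rfl fun a _ => Finset.sum_congr rfl fun b _ => by ring

theorem eval2_sum (T : Tensor2) (x : Fin 4 → ℝ) (E : Fin 4 → Fin 4 → ℝ) (c d : Fin 4 → ℝ) :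
    eval2 T x (fun a => ∑ i, c i * E a i) (fun a => ∑ i, d i * E a i)
      = ∑ i, ∑ j, c i * d j * contr2 E (T x) i j := by
  simp only [eval2, contr2, Finset.mul_sum, Finset.sum_mul]
  have h : ∀ F : Fin 4 → Fin 4 → Fin 4 → Fin 4 → ℝ,
      ∑ a, ∑ b, ∑ i, ∑ j, F a b i j = ∑ i, ∑ j, ∑ a, ∑ b, F a b i j := by
    intro F
    calc _ = ∑ a, ∑ i, ∑ b, ∑ j, F a b i j := Finset.sum_congr rfl fun a _ => Finset.sum_comm
      _ = ∑ i, ∑ a, ∑ b, ∑ j, F a b i j := Finset.sum_comm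
      _ = ∑ i, ∑ a, ∑ j, ∑ b, F a b i j := Finset.sum_congr rfl fun i _ =>
          Finset.sum_congr rfl fun a _ => Finset.sum_comm
      _ = _ := Finset.sum_congr rfl fun i _ => Finset.sum_comm
  calc _ = ∑ a, ∑ b, ∑ i, ∑ j, c i * d j * (E a i * E b j * T x a b) :=
        Finset.sum_congr rfl fun a _ => Finset.sum_congr rfl fun b _ => by
          rw [Finset.sum_comm]
          exact Finset.sum_congr rfl fun j _ => Finset.sum_congr rfl fun i _ => by ring
    _ = _ := h _

namespace KillingData
variable {K : KillingData} {f g : (Fin 4 → ℝ) → ℝ} {x y : Fin 4 → ℝ} {l Ω : ℝ}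

variable (K) in
/-- Coefficients, in the orthogonal frame, of the vectors `∂_t + Ω ∂_φ`, `∂_n`, `∂_φ`, `∂_z`. -/
def coeff (Ω : ℝ) (x : Fin 4 → ℝ) : Fin 4 → Fin 4 → ℝ :=
  ![![K.N x, 0, Ω - K.ω x, 0], ![0, 1, 0, 0], ![0, 0, 1, 0], ![0, 0, K.b x, 1]]

variable (K) in
/-- Lengths of the vectors `∂_t + Ω ∂_φ`, `∂_n`, `∂_φ`, `∂_z`. -/
def len (Ω : ℝ) (x : Fin 4 → ℝ) : Fin 4 → ℝ :=
  ![√|-K.N x ^ 2 + (Ω - K.ω x) ^ 2 * K.p x|, 1, √(K.p x), √(K.r x)]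

theorem r_pos (hx : x ∈ K.S) : 0 < K.r x := by
  have h1 := K.p_pos x hx
  have h2 := K.det_pos x hx
  have h3 : 0 < K.p x * K.r x := by nlinarith [sq_nonneg (K.q x)]
  exact (mul_pos_iff_of_pos_left h1).1 h3

theorem tetrad_eq (hx : x ∈ K.reg) (a : Fin 4) : tetrad K.metric Ω x a =
    (K.len Ω x a)⁻¹ • fun c => ∑ i, K.coeff Ω x a i * K.E x c i := by
  have hN := hx.2
  have hp := K.p_pos x hx.1
  have hr := r_pos hx.1
  have hv : (![![1, 0, Ω, 0], ![0, 1, 0, 0], ![0, 0, 1, 0], ![0, 0, 0, 1]] : Fin 4 → Fin 4 → ℝ) a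
      = fun c => ∑ i, K.coeff Ω x a i * K.E x c i := by
    ext c
    fin_cases a <;> fin_cases c <;> simp [coeff, E, Fin.sum_univ_four, b]
    all_goals field_simp
    all_goals ring
  rw [tetrad, normalize, hv, eval2_sum]
  congr 2
  simp only [contr2_metric hx]
  fin_cases a
  · simp only [len, coeff, Fin.sum_univ_four]
    simp
    congr 2
    · ring
    · ring
  · simp [len, coeff, Fin.sum_univ_four]
  · simp [len, coeff, Fin.sum_univ_four, abs_of_pos hp]
  · have : K.b x * K.b x * K.p x + (K.p x * K.r x - K.q x ^ 2) / K.p x = K.r x := by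
      rw [b]; field_simp; ring
    simp [len, coeff, Fin.sum_univ_four, this, abs_of_pos hr]

theorem frameComp_eq (hx : x ∈ K.reg) (T : Tensor2) (a b : Fin 4) :
    frameComp K.metric Ω T a b x = ∑ i, ∑ j, (K.coeff Ω x a i / K.len Ω x a) *
      (K.coeff Ω x b j / K.len Ω x b) * contr2 (K.E x) (T x) i j := by
  rw [frameComp, tetrad_eq hx, tetrad_eq hx, eval2_smul, eval2_sum, Finset.mul_sum]
  refine Finset.sum_congr rfl fun i _ => ?_
  rw [Finset.mul_sum]
  refine Finset.sum_congr rfl fun j _ => ?_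
  ring

variable (K) in
/-- The sign of the surface gravity. -/
def sgn (y : Fin 4 → ℝ) : ℝ := pd 1 K.N y / |pd 1 K.N y|

theorem sgn_mul_self (hy : y ∈ K.hor) : K.sgn y * K.sgn y = 1 := by
  have h := κ_ne hy
  rw [sgn, div_mul_div_comm, abs_mul_abs_self, div_self (mul_ne_zero h h)]

variable (K) in
/-- The coefficients of the tetrad in the orthogonal frame, at the horizon. -/
def coeffLim (y : Fin 4 → ℝ) : Fin 4 → Fin 4 → ℝ :=
  ![![K.sgn y, 0, 0, 0], ![0, 1, 0, 0], ![0, 0, (√(K.p y))⁻¹, 0],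
    ![0, 0, K.b y / √(K.r y), (√(K.r y))⁻¹]]

theorem limit_sgn (hy : y ∈ K.hor) : HasHorizonLimit (fun x => K.N x / |K.N x|) y (K.sgn y) := by
  have h := limit_div_normal hy K.smooth_N (N_hor hy)
  refine (h.div h.abs (abs_ne_zero.2 (κ_ne hy))).congr' ?_
  filter_upwards [self_mem_nhdsWithin] with n (hn : 0 < n)
  simp only [Pi.div_apply]
  rw [abs_div, abs_of_pos hn]
  exact div_div_div_cancel_right₀ hn.ne' _ _

theorem limit_sqrt (hf : HasHorizonLimit f y l) : HasHorizonLimit (fun x => √(f x)) y (√l) :=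
  (Real.continuous_sqrt.tendsto l).comp hf

theorem limit_inv (hf : HasHorizonLimit f y l) (hl : l ≠ 0) :
    HasHorizonLimit (fun x => (f x)⁻¹) y l⁻¹ := Tendsto.inv₀ hf hl

theorem limit_shift (hω : K.Rigid) (hy : y ∈ K.hor) (hΩ : K.ω y = Ω) :
    HasHorizonLimit (fun x => (Ω - K.ω x) / K.N x) y 0 := by
  have hs : SmoothOn K.S fun x => Ω - K.ω x := contDiffOn_const.sub K.smooth_ω
  have := limit_div hy hs (by rw [hΩ, sub_self])
  have e : pd 1 (fun x => Ω - K.ω x) y = 0 := by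
    rw [pd_sub 1 (f := fun _ => Ω) (differentiableAt_const _)
      (K.smooth_ω.differentiableAt K.isOpen hy.1), pd_const, hω y hy, sub_zero]
  rwa [e, zero_div] at this

/-- Near the horizon the length of the Killing field is `|N|` to leading order. -/
theorem limit_len_zero (hω : K.Rigid) (hy : y ∈ K.hor) (hΩ : K.ω y = Ω) :
    HasHorizonLimit (fun x => K.N x / K.len Ω x 0) y (K.sgn y) := by
  have h1 : HasHorizonLimit (fun x => |-1 + ((Ω - K.ω x) / K.N x) ^ 2 * K.p x|) y 1 := by
    have := (HasHorizonLimit.const (y := y) (-1)).add (((limit_shift hω hy hΩ).pow 2).mul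
      (limit_smooth hy K.smooth_p))
    have h : HasHorizonLimit (fun x => |-1 + ((Ω - K.ω x) / K.N x) ^ 2 * K.p x|) y
        |-1 + 0 ^ 2 * K.p y| := Tendsto.abs this
    convert h using 1
    norm_num
  have h2 := (limit_sgn hy).mul (limit_inv (limit_sqrt h1) (by simp))
  rw [Real.sqrt_one, inv_one, mul_one] at h2
  refine limit_congr hy (fun x hx => ?_) h2
  have hN := hx.2
  have e : -K.N x ^ 2 + (Ω - K.ω x) ^ 2 * K.p x
      = K.N x ^ 2 * (-1 + ((Ω - K.ω x) / K.N x) ^ 2 * K.p x) := by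
    field_simp
  have e2 : K.len Ω x 0 = |K.N x| * √|-1 + ((Ω - K.ω x) / K.N x) ^ 2 * K.p x| := by
    simp only [len, Matrix.cons_val_zero, e]
    rw [abs_mul, abs_of_nonneg (sq_nonneg (K.N x)), Real.sqrt_mul (sq_nonneg _),
      Real.sqrt_sq_eq_abs]
  rw [e2]; ring

theorem limit_coeff (hω : K.Rigid) (hy : y ∈ K.hor) (hΩ : K.ω y = Ω) (a i : Fin 4) :
    HasHorizonLimit (fun x => K.coeff Ω x a i / K.len Ω x a) y (K.coeffLim y a i) := by
  have h0 := limit_len_zero hω hy hΩ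
  have z : ∀ L : (Fin 4 → ℝ) → ℝ, HasHorizonLimit (fun x => 0 / L x) y 0 := fun L =>
    limit_congr hy (fun x _ => zero_div _) (.const 0)
  have h2 : HasHorizonLimit (fun x => (Ω - K.ω x) / K.len Ω x 0) y 0 := by
    refine limit_congr hy (fun x hx => ?_) ((limit_shift hω hy hΩ).zero_mul h0.converges)
    have hN := hx.2
    field_simp
  have hp := limit_inv (limit_sqrt (limit_smooth hy K.smooth_p))
    (Real.sqrt_pos.2 (K.p_pos y hy.1)).ne'
  have hr := limit_inv (limit_sqrt (limit_smooth hy K.smooth_r))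
    (Real.sqrt_pos.2 (r_pos hy.1)).ne'
  have hb := (limit_smooth hy (smooth_b (K := K))).mul hr
  have one : HasHorizonLimit (fun _ => (1 : ℝ) / 1) y 1 := by simpa using HasHorizonLimit.const 1
  fin_cases a <;> fin_cases i
  · exact h0
  · exact z _
  · exact h2
  · exact z _
  · exact z _
  · exact one
  · exact z _
  · exact z _
  · exact z _
  · exact z _
  · exact limit_congr hy (fun x _ => one_div _) hp
  · exact z _
  · exact z _
  · exact z _
  · exact hb
  · exact limit_congr hy (fun x _ => one_div _) hr

theorem Ric_symm (hx : x ∈ K.reg) (i k : Fin 4) : K.Ric i k x = K.Ric k i x := by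
  rw [Ric_eq hx, Ric_eq hx]
  refine Finset.sum_congr rfl fun j _ => ?_
  rw [Rm_pair hx]

theorem Ein_symm (hx : x ∈ K.reg) (i k : Fin 4) : K.Ein i k x = K.Ein k i x := by
  rw [Ein_eq, Ein_eq, Ric_symm hx, contr2_metric hx, contr2_metric hx]
  fin_cases i <;> fin_cases k <;> rfl

theorem Ein_eq_Ric (hx : x ∈ K.reg) {i k : Fin 4} (h : i ≠ k) : K.Ein i k x = K.Ric i k x := by
  rw [Ein_eq, contr2_metric hx]
  fin_cases i <;> fin_cases k <;> first | exact absurd rfl h | simp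

theorem Ein_add (hx : x ∈ K.reg) : K.Ein 0 0 x + K.Ein 1 1 x
    = K.η x 2 * (K.Rm 0 2 0 2 x + K.Rm 1 2 1 2 x) + K.η x 3 * (K.Rm 0 3 0 3 x + K.Rm 1 3 1 3 x) := by
  have e0 : K.η x 0 = -1 := rfl
  have e1 : K.η x 1 = 1 := rfl
  rw [Ein_eq, Ein_eq, contr2_metric hx, contr2_metric hx, Ric_eq hx, Ric_eq hx, Fin.sum_univ_four,
    Fin.sum_univ_four, Rm_self hx, Rm_self hx, Rm_swap hx 0 1 1 0, Rm_swap' hx 0 1 0 1, e0, e1]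
  simp
  ring

/-- The limit of the Einstein tensor at a regular horizon, in the tetrad of the Killing field
`∂_t + Ω ∂_φ`, where `Ω` is the angular velocity of the horizon. -/
theorem einstein_limit (R : K.RegularHorizon) (hy : y ∈ K.hor) (hΩ : K.ω y = Ω) :
    ∃ E : Matrix (Fin 4) (Fin 4) ℝ,
      (∀ a b, HasHorizonLimit (frameComp K.metric Ω (einstein K.metric) a b) y (E a b)) ∧
      E.IsSymm ∧ E 0 1 = 0 ∧ E 0 3 = 0 ∧ E 1 2 = 0 ∧ E 1 3 = 0 ∧ E 0 0 = -E 1 1 ∧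
      (E 0 2 = 0 ↔ pd 1 (pd 1 (pd 1 K.ω)) y = 0) := by
  choose L hL using fun i k => converges_Ein R hy i k
  have Lsymm : ∀ i k, L i k = L k i := fun i k =>
    (hL i k).unique (limit_congr hy (fun x hx => Ein_symm hx i k) (hL k i))
  have L01 : L 0 1 = 0 := (hL 0 1).unique (limit_congr hy (fun x hx => by
    rw [Ein_eq_Ric hx (by decide), (Ric_time_reversal hx).1]) (.const 0))
  have L03 : L 0 3 = 0 := (hL 0 3).unique (limit_congr hy (fun x hx => by
    rw [Ein_eq_Ric hx (by decide), (Ric_time_reversal hx).2]) (.const 0))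
  have L12 : L 1 2 = 0 := (hL 1 2).unique (limit_congr hy (fun x hx =>
    Ein_eq_Ric hx (by decide)) (limit_Ric_mixed R hy (Or.inl ⟨rfl, rfl⟩)))
  have L13 : L 1 3 = 0 := (hL 1 3).unique (limit_congr hy (fun x hx =>
    Ein_eq_Ric hx (by decide)) (limit_Ric_mixed R hy (Or.inr ⟨rfl, rfl⟩)))
  have L02 : L 0 2 = K.p y * pd 1 (pd 1 (pd 1 K.ω)) y / (4 * pd 1 K.N y) :=
    (hL 0 2).unique (limit_congr hy (fun x hx => Ein_eq_Ric hx (by decide)) (limit_Ric_two R hy))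
  have L00 : L 0 0 + L 1 1 = 0 := ((hL 0 0).add (hL 1 1)).unique (limit_congr hy
    (fun x hx => Ein_add hx) ((HasHorizonLimit.mul_zero (converges_η hy 2)
      (limit_electric_add_spatial R hy (Or.inl rfl))).zero_add (.mul_zero (converges_η hy 3)
        (limit_electric_add_spatial R hy (Or.inr rfl)))))
  have hbω : K.b y * L 0 2 = 0 := by
    have : K.b y * pd 1 (pd 1 (pd 1 K.ω)) y = 0 := by
      rcases K.static_or_axisymmetric with h | ⟨h, -⟩
      · rw [pd_eq_zero_of_forall (pd_eq_zero_of_forall (pd_eq_zero_of_forall h 1) 1), mul_zero]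
      · rw [b, h, zero_div, zero_mul]
    rw [L02]
    linear_combination (K.p y / (4 * pd 1 K.N y)) * this
  have hκ := κ_ne hy
  have hp := K.p_pos y hy.1
  have hs := sgn_mul_self hy
  have hs0 : K.sgn y ≠ 0 := fun h => by rw [h, zero_mul] at hs; exact zero_ne_one hs
  refine ⟨Matrix.of fun a b => ∑ i, ∑ j, K.coeffLim y a i * K.coeffLim y b j * L i j, ?_, ?_, ?_, ?_,
    ?_, ?_, ?_, ?_⟩
  · intro a b
    refine limit_congr hy (fun x hx => frameComp_eq hx _ a b) ?_
    exact HasHorizonLimit.sum _ fun i _ => HasHorizonLimit.sum _ fun j _ =>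
      ((limit_coeff R.rigid hy hΩ a i).mul (limit_coeff R.rigid hy hΩ b j)).mul (hL i j)
  · ext a b
    simp only [Matrix.transpose_apply, Matrix.of_apply]
    rw [Finset.sum_comm]
    refine Finset.sum_congr rfl fun i _ => Finset.sum_congr rfl fun j _ => ?_
    rw [Lsymm j i]; ring
  · simp [coeffLim, Fin.sum_univ_four, L01]
  · simp [coeffLim, Fin.sum_univ_four, L03]
    rcases mul_eq_zero.1 hbω with h | h
    · simp [h]
    · simp [h]
  · simp [coeffLim, Fin.sum_univ_four, L12]
  · simp [coeffLim, Fin.sum_univ_four, L12, L13]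
  · simp [coeffLim, Fin.sum_univ_four]
    rw [hs]; linarith
  · have h4 : (√(K.p y))⁻¹ ≠ 0 := inv_ne_zero (Real.sqrt_pos.2 hp).ne'
    have e : L 0 2 = 0 ↔ pd 1 (pd 1 (pd 1 K.ω)) y = 0 := by
      rw [L02, div_eq_zero_iff, mul_eq_zero, mul_eq_zero]
      simp [hp.ne', hκ]
    rw [← e]
    have h5 : √(K.p y) ≠ 0 := (Real.sqrt_pos.2 hp).ne'
    simp [coeffLim, Fin.sum_univ_four, hs0, h5]

/-- The Einstein equations carry the limits over to the energy density and the normal pressure. -/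
theorem matter_limit {E : Matrix (Fin 4) (Fin 4) ℝ} {T : Tensor2}
    (hy : y ∈ K.hor)
    (hT : ∀ x ∈ K.S, 0 < x 1 → einstein K.metric x = (8 * Real.pi) • T x) {a b : Fin 4}
    (hE : HasHorizonLimit (frameComp K.metric Ω (einstein K.metric) a b) y (E a b)) :
    HasHorizonLimit (frameComp K.metric Ω T a b) y ((8 * Real.pi)⁻¹ * E a b) := by
  refine Tendsto.congr' ?_ (Tendsto.const_mul ((8 * Real.pi)⁻¹) hE)
  filter_upwards [eventually_reg hy, self_mem_nhdsWithin] with n hn (hn0 : 0 < n)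
  have h := hT _ hn.1 (by simpa using hn0)
  have hpi : (8 * Real.pi) ≠ 0 := by positivity
  simp only [frameComp, eval2, h, Matrix.smul_apply, smul_eq_mul, Finset.mul_sum]
  refine Finset.sum_congr rfl fun a _ => Finset.sum_congr rfl fun b _ => ?_
  field_simp

end KillingData

/-! ### Taylor coefficients along a normal line -/

section taylor

/-- The partial derivative in the first variable. -/
def dfst (F : ℝ × ℝ → ℝ) (q : ℝ × ℝ) : ℝ := fderiv ℝ F q (1, 0)

/-- The partial derivative in the second variable. -/
def dsnd (F : ℝ × ℝ → ℝ) (q : ℝ × ℝ) : ℝ := fderiv ℝ F q (0, 1)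

variable {f g u v : ℝ → ℝ} {F : ℝ × ℝ → ℝ} {q : ℝ × ℝ} {a b : ℝ}

theorem smoothAt_nat {E : Type*} [NormedAddCommGroup E] [NormedSpace ℝ E] {h : E → ℝ} {x : E}
    (j : ℕ) (hh : ContDiffAt ℝ (⊤ : ℕ∞) h x) : ContDiffAt ℝ j h x :=
  hh.of_le (by exact_mod_cast le_top)

theorem smoothAt_deriv (hf : ContDiffAt ℝ (⊤ : ℕ∞) f a) : ContDiffAt ℝ (⊤ : ℕ∞) (deriv f) a := by
  have h : ContDiffAt ℝ (⊤ : ℕ∞) (fun x => fderiv ℝ f x 1) a :=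
    (hf.fderiv_right (by simp)).clm_apply contDiffAt_const
  exact h

theorem smoothAt_dfst (hF : ContDiffAt ℝ (⊤ : ℕ∞) F q) : ContDiffAt ℝ (⊤ : ℕ∞) (dfst F) q :=
  (hF.fderiv_right (by simp)).clm_apply contDiffAt_const

theorem smoothAt_dsnd (hF : ContDiffAt ℝ (⊤ : ℕ∞) F q) : ContDiffAt ℝ (⊤ : ℕ∞) (dsnd F) q :=
  (hF.fderiv_right (by simp)).clm_apply contDiffAt_const

theorem eventually_differentiableAt {E : Type*} [NormedAddCommGroup E] [NormedSpace ℝ E]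
    {h : E → ℝ} {x : E} (hh : ContDiffAt ℝ (⊤ : ℕ∞) h x) : ∀ᶠ y in 𝓝 x, DifferentiableAt ℝ h y := by
  filter_upwards [(smoothAt_nat 1 hh).eventually (by simp)] with y hy using hy.differentiableAt (by simp)

theorem smoothAt_comp (hF : ContDiffAt ℝ (⊤ : ℕ∞) F (u a, v a)) (hu : ContDiffAt ℝ (⊤ : ℕ∞) u a)
    (hv : ContDiffAt ℝ (⊤ : ℕ∞) v a) : ContDiffAt ℝ (⊤ : ℕ∞) (fun n => F (u n, v n)) a :=
  ContDiffAt.comp a hF (hu.prodMk hv)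

theorem hasDerivAt_comp {u' v' : ℝ} (hF : DifferentiableAt ℝ F (u a, v a))
    (hu : HasDerivAt u u' a) (hv : HasDerivAt v v' a) :
    HasDerivAt (fun n => F (u n, v n)) (dfst F (u a, v a) * u' + dsnd F (u a, v a) * v') a := by
  have h := HasFDerivAt.comp_hasDerivAt a (f := fun n => (u n, v n)) hF.hasFDerivAt
    (hu.prodMk hv)
  have e : ((u', v') : ℝ × ℝ) = u' • ((1, 0) : ℝ × ℝ) + v' • ((0, 1) : ℝ × ℝ) := by
    ext <;> simp
  rw [e, map_add, map_smul, map_smul, smul_eq_mul, smul_eq_mul, mul_comm, mul_comm v'] at h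
  exact h

theorem hasDerivAt_fst (hF : DifferentiableAt ℝ F (a, b)) :
    HasDerivAt (fun n => F (n, b)) (dfst F (a, b)) a := by
  simpa using hasDerivAt_comp (u := fun n => n) (v := fun _ => b) hF (hasDerivAt_id a)
    (hasDerivAt_const a b)

theorem hasDerivAt_snd (hF : DifferentiableAt ℝ F (a, b)) :
    HasDerivAt (fun n => F (a, n)) (dsnd F (a, b)) b := by
  simpa using hasDerivAt_comp (a := b) (u := fun _ => a) (v := fun n => n) hF
    (hasDerivAt_const b a) (hasDerivAt_id b)

theorem dsnd_dfst_comm (hF : ContDiffAt ℝ (⊤ : ℕ∞) F q) :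
    dfst (dsnd F) q = dsnd (dfst F) q := by
  have h1 : DifferentiableAt ℝ (fderiv ℝ F) q :=
    ContDiffAt.differentiableAt (n := ((⊤ : ℕ∞) : WithTop ℕ∞)) (hF.fderiv_right (by simp)) (by simp)
  have hsym : IsSymmSndFDerivAt ℝ F q := hF.isSymmSndFDerivAt
    (by rw [minSmoothness_of_isRCLikeNormedField]; exact WithTop.coe_le_coe.2 le_top)
  have key : ∀ w w' : ℝ × ℝ, fderiv ℝ (fun y => fderiv ℝ F y w') q w
      = fderiv ℝ (fderiv ℝ F) q w w' := by
    intro w w'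
    rw [fderiv_clm_apply h1 (differentiableAt_const _)]
    simp
  exact (key _ _).trans ((hsym.eq _ _).trans (key _ _).symm)

theorem deriv_comp_eventually (hF : ContDiffAt ℝ (⊤ : ℕ∞) F (u a, v a))
    (hu : ContDiffAt ℝ (⊤ : ℕ∞) u a) (hv : ContDiffAt ℝ (⊤ : ℕ∞) v a) :
    deriv (fun n => F (u n, v n)) =ᶠ[𝓝 a]
      fun n => dfst F (u n, v n) * deriv u n + dsnd F (u n, v n) * deriv v n := by
  have hc : ContinuousAt (fun n => (u n, v n)) a := hu.continuousAt.prodMk hv.continuousAt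
  filter_upwards [hc.eventually (eventually_differentiableAt hF), eventually_differentiableAt hu,
    eventually_differentiableAt hv] with n h1 h2 h3
  exact (hasDerivAt_comp h1 h2.hasDerivAt h3.hasDerivAt).deriv

theorem iteratedDeriv_two_mul (hf : ContDiffAt ℝ (⊤ : ℕ∞) f a) (hg : ContDiffAt ℝ (⊤ : ℕ∞) g a) :
    iteratedDeriv 2 (fun n => f n * g n) a
      = iteratedDeriv 2 f a * g a + 2 * deriv f a * deriv g a + f a * iteratedDeriv 2 g a := by
  rw [iteratedDeriv_fun_mul (smoothAt_nat _ hf) (smoothAt_nat _ hg)]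
  simp [Finset.sum_range_succ, Nat.choose, iteratedDeriv_one]
  ring

theorem iteratedDeriv_three_mul (hf : ContDiffAt ℝ (⊤ : ℕ∞) f a)
    (hg : ContDiffAt ℝ (⊤ : ℕ∞) g a) :
    iteratedDeriv 3 (fun n => f n * g n) a
      = iteratedDeriv 3 f a * g a + 3 * iteratedDeriv 2 f a * deriv g a
        + 3 * deriv f a * iteratedDeriv 2 g a + f a * iteratedDeriv 3 g a := by
  rw [iteratedDeriv_fun_mul (smoothAt_nat _ hf) (smoothAt_nat _ hg)]
  simp [Finset.sum_range_succ, Nat.choose, iteratedDeriv_one]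
  ring

/-- At a critical point of a curve, the second and third derivatives of a function along the curve
are given by its differential alone. -/
theorem iteratedDeriv_comp_critical (hF : ContDiffAt ℝ (⊤ : ℕ∞) F (u a, v a))
    (hu : ContDiffAt ℝ (⊤ : ℕ∞) u a) (hv : ContDiffAt ℝ (⊤ : ℕ∞) v a)
    (hu1 : deriv u a = 0) (hv1 : deriv v a = 0) {k : ℕ} (hk : k = 2 ∨ k = 3) :
    iteratedDeriv k (fun n => F (u n, v n)) a
      = dfst F (u a, v a) * iteratedDeriv k u a + dsnd F (u a, v a) * iteratedDeriv k v a := by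
  have hx := smoothAt_comp (smoothAt_dfst hF) hu hv
  have hy := smoothAt_comp (smoothAt_dsnd hF) hu hv
  have hu' := smoothAt_deriv hu
  have hv' := smoothAt_deriv hv
  have zero : ∀ {G : ℝ × ℝ → ℝ}, ContDiffAt ℝ (⊤ : ℕ∞) G (u a, v a) →
      deriv (fun n => G (u n, v n)) a = 0 := by
    intro G hG
    rw [(deriv_comp_eventually hG hu hv).self_of_nhds]
    simp only [hu1, hv1, mul_zero, add_zero]
  have hd1 : ∀ {h : ℝ → ℝ}, ContDiffAt ℝ (⊤ : ℕ∞) h a → DifferentiableAt ℝ h a :=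
    fun hh => hh.differentiableAt (by simp)
  rcases hk with rfl | rfl
  · rw [iteratedDeriv_succ', iteratedDeriv_one,
      (deriv_comp_eventually hF hu hv).deriv_eq,
      deriv_fun_add (hd1 (hx.mul hu')) (hd1 (hy.mul hv')),
      deriv_fun_mul (hd1 hx) (hd1 hu'), deriv_fun_mul (hd1 hy) (hd1 hv'), hu1, hv1,
      iteratedDeriv_succ', iteratedDeriv_one, iteratedDeriv_succ', iteratedDeriv_one]
    ring
  · rw [iteratedDeriv_succ', (deriv_comp_eventually hF hu hv).iteratedDeriv_eq,
      iteratedDeriv_fun_add (smoothAt_nat 2 (hx.mul hu')) (smoothAt_nat 2 (hy.mul hv')),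
      iteratedDeriv_two_mul hx hu', iteratedDeriv_two_mul hy hv', hu1, hv1,
      zero (smoothAt_dfst hF), zero (smoothAt_dsnd hF),
      iteratedDeriv_succ' (f := u), iteratedDeriv_succ' (f := v)]
    ring

theorem eventuallyEq_deriv_right (h : f =ᶠ[𝓝[>] a] g) : deriv f =ᶠ[𝓝[>] a] deriv g := by
  filter_upwards [eventually_eventually_nhdsWithin.2 h, self_mem_nhdsWithin] with n hn (hp : a < n)
  rw [isOpen_Ioi.nhdsWithin_eq hp] at hn
  exact Filter.EventuallyEq.deriv_eq hn

/-- Smooth functions which agree on one side of `a` have the same Taylor coefficients at `a`. -/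
theorem iteratedDeriv_eq_of_right (k : ℕ) {f g : ℝ → ℝ} (hf : ContDiffAt ℝ (⊤ : ℕ∞) f a)
    (hg : ContDiffAt ℝ (⊤ : ℕ∞) g a) (h : f =ᶠ[𝓝[>] a] g) :
    iteratedDeriv k f a = iteratedDeriv k g a := by
  induction k generalizing f g with
  | zero =>
    simp only [iteratedDeriv_zero]
    exact tendsto_nhds_unique ((hf.continuousAt.mono_left nhdsWithin_le_nhds).congr' h)
      (hg.continuousAt.mono_left nhdsWithin_le_nhds)
  | succ k ih =>
    rw [iteratedDeriv_succ', iteratedDeriv_succ']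
    exact ih (smoothAt_deriv hf) (smoothAt_deriv hg) (eventuallyEq_deriv_right h)

end taylor

/-! ### Horizon-penetrating coordinates -/

section extension

/-- What the components of a metric in coordinates `(v, x, ψ, y)` say about the functions
`x = X(n, z)` and `y = Y(n, z)`: the functions `A` and `B` drop out of the determinant, of the
components along the Killing fields, and of the `x`, `y` components of the inverse metric. -/
theorem pullback_relations {N ω p r xn xz yn yz : ℝ} {h J : Matrix (Fin 4) (Fin 4) ℝ}
    (hN : N ≠ 0) (hp : p ≠ 0) (hr : r ≠ 0)
    (hJ : J = !![1, J 0 1, 0, J 0 3; 0, xn, 0, xz; 0, J 2 1, 1, J 2 3; 0, yn, 0, yz])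
    (e : !![-(N ^ 2 - ω ^ 2 * p), 0, -(ω * p), 0; 0, 1, 0, 0; -(ω * p), 0, p, 0; 0, 0, 0, r]
      = J.transpose * h * J) :
    N * (N * -(p * r)) = (xn * yz - xz * yn) * ((xn * yz - xz * yn) * h.det) ∧
      h 0 2 = -(ω * p) ∧ h 2 2 = p ∧
      h⁻¹ 1 1 = xn * xn + xz * (xz * r⁻¹) ∧ h⁻¹ 1 3 = xn * yn + xz * (yz * r⁻¹) := by
  set g : Matrix (Fin 4) (Fin 4) ℝ :=
    !![-(N ^ 2 - ω ^ 2 * p), 0, -(ω * p), 0; 0, 1, 0, 0; -(ω * p), 0, p, 0; 0, 0, 0, r] with hg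
  have hdJ : J.det = xn * yz - xz * yn := by
    rw [hJ, Matrix.det_succ_column_zero]
    simp [Fin.sum_univ_succ, Matrix.det_fin_three, Fin.succAbove, Matrix.submatrix]
  have hdg : g.det = N * (N * -(p * r)) := by
    rw [hg, Matrix.det_succ_row_zero]
    simp [Fin.sum_univ_succ, Matrix.det_fin_three, Fin.succAbove, Matrix.submatrix]
    ring
  have hdet : N * (N * -(p * r)) = (xn * yz - xz * yn) * ((xn * yz - xz * yn) * h.det) := by
    rw [← hdg, e, Matrix.det_mul, Matrix.det_mul, Matrix.det_transpose, hdJ]; ring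
  have hu : IsUnit J.det := by
    refine isUnit_iff_ne_zero.2 fun h0 => ?_
    rw [← hdJ, h0, zero_mul] at hdet
    simp [hN, hp, hr] at hdet
  have hentry : ∀ i j, g i j = ∑ k, ∑ l, J k i * h k l * J l j := by
    intro i j
    rw [e, Matrix.mul_apply]
    simp only [Matrix.mul_apply, Finset.sum_mul, Matrix.transpose_apply]
    exact Finset.sum_comm
  have c0 : ∀ k, J k 0 = if k = 0 then 1 else 0 := by
    intro k; rw [hJ]; fin_cases k <;> rfl
  have c2 : ∀ k, J k 2 = if k = 2 then 1 else 0 := by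
    intro k; rw [hJ]; fin_cases k <;> rfl
  have h02 := hentry 0 2
  have h22 := hentry 2 2
  simp [c0, c2, hg] at h02 h22
  have hinv : g⁻¹ = !![-(N ^ 2)⁻¹, 0, -(ω / N ^ 2), 0; 0, 1, 0, 0;
      -(ω / N ^ 2), 0, p⁻¹ - ω ^ 2 / N ^ 2, 0; 0, 0, 0, r⁻¹] := by
    refine Matrix.inv_eq_right_inv ?_
    ext i j
    fin_cases i <;> fin_cases j <;> simp [hg, Matrix.mul_apply, Fin.sum_univ_four] <;>
      field_simp <;> ring
  have hh : h⁻¹ = J * g⁻¹ * J.transpose := by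
    have ht : IsUnit J.transpose.det := by rwa [Matrix.det_transpose]
    rw [e, Matrix.mul_inv_rev, Matrix.mul_inv_rev, ← Matrix.mul_assoc, ← Matrix.mul_assoc,
      Matrix.mul_nonsing_inv _ hu, Matrix.one_mul, Matrix.mul_assoc, Matrix.nonsing_inv_mul _ ht,
      Matrix.mul_one]
  have r1 : ∀ k, J 1 k = (![0, xn, 0, xz] : Fin 4 → ℝ) k := by
    intro k; rw [hJ]; fin_cases k <;> rfl
  have r3 : ∀ k, J 3 k = (![0, yn, 0, yz] : Fin 4 → ℝ) k := by
    intro k; rw [hJ]; fin_cases k <;> rfl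
  refine ⟨hdet, h02.symm, h22.symm, ?_, ?_⟩ <;> rw [hh, hinv] <;>
    simp [Matrix.mul_apply, Fin.sum_univ_four, r1, r3] <;> ring

theorem smoothAt_line {F : ℝ × ℝ → ℝ} {a b : ℝ} (hF : ContDiffAt ℝ (⊤ : ℕ∞) F (a, b)) :
    ContDiffAt ℝ (⊤ : ℕ∞) (fun n => F (n, b)) a :=
  smoothAt_comp (u := fun n => n) (v := fun _ => b) hF contDiffAt_id contDiffAt_const

theorem deriv_line {F : ℝ × ℝ → ℝ} {a b : ℝ} (hF : ContDiffAt ℝ (⊤ : ℕ∞) F (a, b)) :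
    deriv (fun n => F (n, b)) =ᶠ[𝓝 a] fun n => dfst F (n, b) := by
  have hc : ContinuousAt (fun n : ℝ => (n, b)) a := by fun_prop
  filter_upwards [hc.eventually (eventually_differentiableAt hF)] with n hn
  exact (hasDerivAt_fst hn).deriv

theorem dsnd_eq {F : ℝ × ℝ → ℝ} {f : ℝ → ℝ} {W : Set (ℝ × ℝ)} (hW : IsOpen W) {z f' : ℝ}
    (hz : ((0 : ℝ), z) ∈ W) (hF : ContDiffAt ℝ (⊤ : ℕ∞) F (0, z))
    (h : ∀ z, ((0 : ℝ), z) ∈ W → F (0, z) = f z) (hf : HasDerivAt f f' z) :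
    dsnd F (0, z) = f' := by
  have hc : ContinuousAt (fun n : ℝ => ((0 : ℝ), n)) z := by fun_prop
  refine (hasDerivAt_snd (hF.differentiableAt (by simp))).unique (hf.congr_of_eventuallyEq ?_)
  filter_upwards [hc.eventually (hW.mem_nhds hz)] with n hn using h n hn

end extension

namespace AxisymmetricHorizon
variable (H : AxisymmetricHorizon)

/-- A horizon-penetrating extension of the metric forces the third normal derivative of `ω` to
vanish. -/
theorem ω₃_eq_zero_of_extends {z₀ Ω : ℝ} (hΩ : ∀ z : ℝ, (0, z) ∈ H.U → H.ω (0, z) = Ω)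
    (hω₁ : H.ω₁ z₀ = 0) (hp : deriv (fun n => H.gφφ (n, z₀)) 0 = 0)
    (hext : H.ExtendsAcrossHorizonAt z₀) : H.ω₃ z₀ = 0 := by
  obtain ⟨W, V, A, B, X, Y, ĝ, hW, hWU, hz₀, hV, -, -, hX, hY, hXY, hmap, hĝ, hĝ', hJ⟩ := hext
  have sX : ∀ q ∈ W, ContDiffAt ℝ (⊤ : ℕ∞) X q := fun q hq => hX.contDiffAt (hW.mem_nhds hq)
  have sY : ∀ q ∈ W, ContDiffAt ℝ (⊤ : ℕ∞) Y q := fun q hq => hY.contDiffAt (hW.mem_nhds hq)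
  have sU : ∀ {F : ℝ × ℝ → ℝ}, ContDiffOn ℝ (⊤ : ℕ∞) F H.U → ∀ q ∈ W,
      ContDiffAt ℝ (⊤ : ℕ∞) F q := fun hF q hq => hF.contDiffAt (H.isOpen_U.mem_nhds (hWU hq))
  have s1 : ∀ {F : ℝ × ℝ → ℝ} {q}, ContDiffAt ℝ (⊤ : ℕ∞) F q → DifferentiableAt ℝ F q :=
    fun hF => hF.differentiableAt (by simp)
  -- the relations between the two forms of the metric, along each normal line
  have hrel : ∀ z, ((0 : ℝ), z) ∈ W → ∀ᶠ n in 𝓝[>] (0 : ℝ),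
      H.N (n, z) * (H.N (n, z) * -(H.gφφ (n, z) * H.gzz (n, z)))
        = (dfst X (n, z) * dsnd Y (n, z) - dsnd X (n, z) * dfst Y (n, z))
          * ((dfst X (n, z) * dsnd Y (n, z) - dsnd X (n, z) * dfst Y (n, z))
            * (ĝ (X (n, z), Y (n, z))).det) ∧
      ĝ (X (n, z), Y (n, z)) 0 2 = -(H.ω (n, z) * H.gφφ (n, z)) ∧
      ĝ (X (n, z), Y (n, z)) 2 2 = H.gφφ (n, z) ∧
      (ĝ (X (n, z), Y (n, z)))⁻¹ 1 1 = dfst X (n, z) * dfst X (n, z)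
        + dsnd X (n, z) * (dsnd X (n, z) * (H.gzz (n, z))⁻¹) ∧
      (ĝ (X (n, z), Y (n, z)))⁻¹ 1 3 = dfst X (n, z) * dfst Y (n, z)
        + dsnd X (n, z) * (dsnd Y (n, z) * (H.gzz (n, z))⁻¹) := by
    intro z hz
    have hc : ContinuousAt (fun n : ℝ => (n, z)) 0 := by fun_prop
    have hd : HasDerivAt (fun n => H.N (n, z)) (deriv (fun n => H.N (n, z)) 0) 0 :=
      ((smoothAt_line (sU H.smooth_N _ hz)).differentiableAt (by simp)).hasDerivAt
    have hN := (hd.eventually_ne (c := 0) (H.nonextremal z (hWU hz))).filter_mono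
      (nhdsWithin_mono _ fun n (hn : 0 < n) => hn.ne')
    filter_upwards [hN, (hc.eventually (hW.mem_nhds hz)).filter_mono nhdsWithin_le_nhds,
      self_mem_nhdsWithin] with n hNn hn (hpos : 0 < n)
    refine pullback_relations hNn (H.gφφ_pos _ (hWU hn)).ne' (H.gzz_pos _ (hWU hn)).ne' ?_
      (hJ ![0, n, 0, z] hn hpos)
    have dX := s1 (sX _ hn)
    have dY := s1 (sY _ hn)
    ext i j
    fin_cases i <;> fin_cases j <;>
      simp [pd, Function.update, (hasDerivAt_fst dX).deriv, (hasDerivAt_fst dY).deriv,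
        (hasDerivAt_snd dX).deriv, (hasDerivAt_snd dY).deriv]
  have hXz : ∀ z, ((0 : ℝ), z) ∈ W → dsnd X (0, z) = 0 := fun z hz =>
    dsnd_eq hW hz (sX _ hz) (fun z hz => (hXY z hz).1) (hasDerivAt_const z (0 : ℝ))
  have hYz : ∀ z, ((0 : ℝ), z) ∈ W → dsnd Y (0, z) = 1 := fun z hz =>
    dsnd_eq hW hz (sY _ hz) (fun z hz => (hXY z hz).2) (hasDerivAt_id z)
  have hV0 : ∀ z, ((0 : ℝ), z) ∈ W → ((0 : ℝ), z) ∈ V := fun z hz => by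
    have := hmap _ hz le_rfl
    rwa [(hXY z hz).1, (hXY z hz).2] at this
  have sV : ∀ {F : ℝ × ℝ → ℝ}, ContDiffOn ℝ (⊤ : ℕ∞) F V → ∀ z, ((0 : ℝ), z) ∈ W →
      ContDiffAt ℝ (⊤ : ℕ∞) F (0, z) := fun hF z hz => hF.contDiffAt (hV.mem_nhds (hV0 z hz))
  have sV' : ∀ {F : ℝ × ℝ → ℝ}, ContDiffOn ℝ (⊤ : ℕ∞) F V → ∀ z, ((0 : ℝ), z) ∈ W →
      ContDiffAt ℝ (⊤ : ℕ∞) F (X (0, z), Y (0, z)) := fun hF z hz => by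
    rw [(hXY z hz).1, (hXY z hz).2]; exact sV hF z hz
  have sVl : ∀ {F : ℝ × ℝ → ℝ}, ContDiffOn ℝ (⊤ : ℕ∞) F V → ∀ z, ((0 : ℝ), z) ∈ W →
      ContDiffAt ℝ (⊤ : ℕ∞) (fun n => F (X (n, z), Y (n, z))) 0 := fun hF z hz =>
    smoothAt_comp (u := fun n => X (n, z)) (v := fun n => Y (n, z)) (sV' hF z hz)
      (smoothAt_line (sX _ hz)) (smoothAt_line (sY _ hz))
  have sdet := contDiffOn_det hĝ
  have sinv := contDiffOn_inv_entry hĝ fun y hy => (hĝ' y hy).2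
  -- smoothness of the ingredients along a normal line
  have xn := fun z hz => smoothAt_line (smoothAt_dfst (sX (0, z) hz))
  have xz := fun z hz => smoothAt_line (smoothAt_dsnd (sX (0, z) hz))
  have yn := fun z hz => smoothAt_line (smoothAt_dfst (sY (0, z) hz))
  have yz := fun z hz => smoothAt_line (smoothAt_dsnd (sY (0, z) hz))
  have N := fun z hz => smoothAt_line (sU H.smooth_N (0, z) hz)
  have pr := fun z hz => (smoothAt_line ((sU H.smooth_gφφ (0, z) hz).mul
    (sU H.smooth_gzz (0, z) hz))).neg
  have ri : ∀ z, ((0 : ℝ), z) ∈ W → ContDiffAt ℝ (⊤ : ℕ∞) (fun n => (H.gzz (n, z))⁻¹) 0 :=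
    fun z hz => (smoothAt_line (sU H.smooth_gzz (0, z) hz)).inv
    (H.gzz_pos _ (hWU hz)).ne'
  have D := fun z hz => ((xn z hz).mul (yz z hz)).sub ((xz z hz).mul (yn z hz))
  have rdet := fun (z : ℝ) hz (k : ℕ) => iteratedDeriv_eq_of_right k
    ((N z hz).mul ((N z hz).mul (pr z hz))) ((D z hz).mul ((D z hz).mul (sVl sdet z hz)))
    ((hrel z hz).mono fun n h => h.1)
  have rP := fun (z : ℝ) hz (k : ℕ) => iteratedDeriv_eq_of_right k (sVl (sinv 1 1) z hz)
    (((xn z hz).mul (xn z hz)).add ((xz z hz).mul ((xz z hz).mul (ri z hz))))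
    ((hrel z hz).mono fun n h => h.2.2.2.1)
  have rQ := fun (z : ℝ) hz (k : ℕ) => iteratedDeriv_eq_of_right k (sVl (sinv 1 3) z hz)
    (((xn z hz).mul (yn z hz)).add ((xz z hz).mul ((yz z hz).mul (ri z hz))))
    ((hrel z hz).mono fun n h => h.2.2.2.2)
  -- the horizon is null, so `x` is critical there along the normal lines
  have hXn : ∀ z, ((0 : ℝ), z) ∈ W → dfst X (0, z) = 0 := by
    intro z hz
    have h := rdet z hz 0
    have hd := (hĝ' _ (hV0 z hz)).2
    simp only [iteratedDeriv_zero, H.lapse_zero z (hWU hz), hXz z hz, hYz z hz, (hXY z hz).1,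
      (hXY z hz).2, zero_mul, mul_one, sub_zero] at h
    simpa [hd] using h.symm
  have hP : ∀ z, ((0 : ℝ), z) ∈ W → (ĝ (0, z))⁻¹ 1 1 = 0 := by
    intro z hz
    have h := rP z hz 0
    simpa only [iteratedDeriv_zero, hXz z hz, hXn z hz, (hXY z hz).1, (hXY z hz).2, zero_mul,
      add_zero] using h
  have hQ : ∀ z, ((0 : ℝ), z) ∈ W → (ĝ (0, z))⁻¹ 1 3 = 0 := by
    intro z hz
    have h := rQ z hz 0
    simpa only [iteratedDeriv_zero, hXz z hz, hXn z hz, (hXY z hz).1, (hXY z hz).2, zero_mul,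
      add_zero] using h
  have hPy : dsnd (fun q => (ĝ q)⁻¹ 1 1) (0, z₀) = 0 :=
    dsnd_eq hW hz₀ (sV (sinv 1 1) z₀ hz₀) hP (hasDerivAt_const z₀ (0 : ℝ))
  have hQy : dsnd (fun q => (ĝ q)⁻¹ 1 3) (0, z₀) = 0 :=
    dsnd_eq hW hz₀ (sV (sinv 1 3) z₀ hz₀) hQ (hasDerivAt_const z₀ (0 : ℝ))
  have hd : ∀ {f : ℝ → ℝ}, ContDiffAt ℝ (⊤ : ℕ∞) f 0 → DifferentiableAt ℝ f 0 :=
    fun h => h.differentiableAt (by simp)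
  have xz1 : deriv (fun n => dsnd X (n, z₀)) 0 = 0 := by
    refine (deriv_line (smoothAt_dsnd (sX _ hz₀))).self_of_nhds.trans ?_
    beta_reduce
    rw [dsnd_dfst_comm (sX _ hz₀)]
    exact dsnd_eq hW hz₀ (smoothAt_dfst (sX _ hz₀)) hXn (hasDerivAt_const z₀ (0 : ℝ))
  replace xn := xn z₀ hz₀
  replace xz := xz z₀ hz₀
  replace yn := yn z₀ hz₀
  replace yz := yz z₀ hz₀
  replace N := N z₀ hz₀
  replace pr := pr z₀ hz₀
  replace ri := ri z₀ hz₀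
  replace D := D z₀ hz₀
  have X0 := hXn z₀ hz₀
  have Z0 := hXz z₀ hz₀
  have Y0 := hYz z₀ hz₀
  have N0 := H.lapse_zero z₀ (hWU hz₀)
  -- but not degenerate, since the determinant of the metric vanishes to second order only
  have X2 : deriv (fun n => dfst X (n, z₀)) 0 ≠ 0 := by
    intro h0
    have D1 : deriv (fun n => dfst X (n, z₀) * dsnd Y (n, z₀) - dsnd X (n, z₀) * dfst Y (n, z₀)) 0
        = 0 := by
      rw [deriv_fun_sub (hd (xn.mul yz)) (hd (xz.mul yn)), deriv_fun_mul (hd xn) (hd yz),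
        deriv_fun_mul (hd xz) (hd yn), h0, xz1, X0, Z0]
      ring
    have h := rdet z₀ hz₀ 2
    rw [iteratedDeriv_two_mul N (N.mul pr), iteratedDeriv_two_mul D (D.mul (sVl sdet z₀ hz₀)),
      D1, deriv_fun_mul (hd N) (hd pr), N0, X0, Z0] at h
    have h1 := H.nonextremal z₀ (hWU hz₀)
    have h2 := (H.gφφ_pos _ (hWU hz₀)).ne'
    have h3 := (H.gzz_pos _ (hWU hz₀)).ne'
    simp [h1, h2, h3] at h
  have u1 : deriv (fun n => X (n, z₀)) 0 = 0 := (deriv_line (sX _ hz₀)).self_of_nhds.trans X0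
  have cu := smoothAt_line (sX _ hz₀)
  have cv := smoothAt_line (sY _ hz₀)
  -- `ĝ^{xy}` vanishes on the horizon, so its normal derivative `X_nn Y_n` does too
  have Y1 : dfst Y (0, z₀) = 0 := by
    have h := rQ z₀ hz₀ 1
    rw [iteratedDeriv_one, iteratedDeriv_one,
      (deriv_comp_eventually (u := fun n => X (n, z₀)) (v := fun n => Y (n, z₀))
        (sV' (sinv 1 3) z₀ hz₀) cu cv).self_of_nhds,
      deriv_fun_add (hd (xn.mul yn)) (hd (xz.mul (yz.mul ri))), deriv_fun_mul (hd xn) (hd yn),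
      deriv_fun_mul (hd xz) (hd (yz.mul ri)), xz1, X0, Z0] at h
    simp only [(hXY z₀ hz₀).1, (hXY z₀ hz₀).2, hQy, u1, mul_zero, zero_mul, add_zero] at h
    exact (mul_eq_zero.1 h.symm).resolve_left X2
  have v1 : deriv (fun n => Y (n, z₀)) 0 = 0 := (deriv_line (sY _ hz₀)).self_of_nhds.trans Y1
  have u2 : iteratedDeriv 2 (fun n => X (n, z₀)) 0 = deriv (fun n => dfst X (n, z₀)) 0 := by
    rw [iteratedDeriv_succ', (deriv_line (sX _ hz₀)).iteratedDeriv_eq, iteratedDeriv_one]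
  have u3 : iteratedDeriv 3 (fun n => X (n, z₀)) 0
      = iteratedDeriv 2 (fun n => dfst X (n, z₀)) 0 := by
    rw [iteratedDeriv_succ', (deriv_line (sX _ hz₀)).iteratedDeriv_eq]
  have w1 : deriv (fun n => dsnd X (n, z₀) * (H.gzz (n, z₀))⁻¹) 0 = 0 := by
    rw [deriv_fun_mul (hd xz) (hd ri), xz1, Z0]; ring
  have comp := fun (F : ℝ × ℝ → ℝ) (hF : ContDiffOn ℝ (⊤ : ℕ∞) F V) (k : ℕ) hk =>
    iteratedDeriv_comp_critical (k := k) (u := fun n => X (n, z₀)) (v := fun n => Y (n, z₀))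
      (sV' hF z₀ hz₀) cu cv u1 v1 hk
  simp only [(hXY z₀ hz₀).1, (hXY z₀ hz₀).2] at comp
  have hP2 := rP z₀ hz₀ 2
  rw [comp _ (sinv 1 1) 2 (.inl rfl), iteratedDeriv_fun_add (smoothAt_nat 2 (xn.mul xn))
    (smoothAt_nat 2 (xz.mul (xz.mul ri))), iteratedDeriv_two_mul xn xn,
    iteratedDeriv_two_mul xz (xz.mul ri), hPy, u2, xz1, X0, Z0] at hP2
  have hP3 := rP z₀ hz₀ 3
  rw [comp _ (sinv 1 1) 3 (.inr rfl), iteratedDeriv_fun_add (smoothAt_nat 3 (xn.mul xn))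
    (smoothAt_nat 3 (xz.mul (xz.mul ri))), iteratedDeriv_three_mul xn xn,
    iteratedDeriv_three_mul xz (xz.mul ri), hPy, u3, xz1, w1, X0, Z0] at hP3
  -- for `P = ĝ^{xx}` the relations are `P_x X_nn = 2 X_nn²` and `P_x X_nnn = 6 X_nn X_nnn`
  have X3 : iteratedDeriv 3 (fun n => X (n, z₀)) 0 = 0 := by
    rw [u3]
    have hx : dfst (fun q => (ĝ q)⁻¹ 1 1) (0, z₀) = 2 * deriv (fun n => dfst X (n, z₀)) 0 :=
      mul_right_cancel₀ X2 (by linear_combination hP2)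
    rw [hx] at hP3
    refine (mul_eq_zero.1 (?_ : deriv (fun n => dfst X (n, z₀)) 0 * _ = 0)).resolve_left X2
    linear_combination (-1 / 4 : ℝ) * hP3
  -- `ω - Ω`, up to a factor, is a smooth function of `x` and `y` which vanishes on the horizon
  have sF : ContDiffOn ℝ (⊤ : ℕ∞) (fun q => ĝ q 0 2 + Ω * ĝ q 2 2) V :=
    (hĝ 0 2).add (contDiffOn_const.mul (hĝ 2 2))
  have sω := fun z hz => smoothAt_line (sU H.smooth_ω (0, z) hz)
  have sp := fun z hz => smoothAt_line (sU H.smooth_gφφ (0, z) hz)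
  have rF := fun (z : ℝ) hz (k : ℕ) => iteratedDeriv_eq_of_right k (sVl sF z hz)
    (((contDiffAt_const (c := Ω)).sub (sω z hz)).mul (sp z hz))
    ((hrel z hz).mono fun n h => by
      beta_reduce
      rw [h.2.1, h.2.2.1]
      ring)
  have hFy : dsnd (fun q => ĝ q 0 2 + Ω * ĝ q 2 2) (0, z₀) = 0 := by
    refine dsnd_eq hW hz₀ (sV sF z₀ hz₀) (fun z hz => ?_) (hasDerivAt_const z₀ (0 : ℝ))
    have h := rF z hz 0
    simpa only [iteratedDeriv_zero, hΩ z (hWU hz), (hXY z hz).1, (hXY z hz).2, sub_self,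
      zero_mul] using h
  have h := rF z₀ hz₀ 3
  have dω : deriv (fun n => Ω - H.ω (n, z₀)) = fun n => -deriv (fun n => H.ω (n, z₀)) n :=
    funext fun n => deriv_const_sub Ω
  rw [comp _ sF 3 (.inr rfl), iteratedDeriv_three_mul (contDiffAt_const.sub (sω z₀ hz₀))
    (sp z₀ hz₀), X3, hFy, hp, hΩ z₀ (hWU hz₀), iteratedDeriv_succ' (f := fun n => Ω - H.ω (n, z₀)),
    dω, iteratedDeriv_fun_neg, ← iteratedDeriv_succ'] at h
  rw [ω₁] at hω₁
  simp only [hω₁] at h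
  have h2 := (H.gφφ_pos _ (hWU hz₀)).ne'
  refine (mul_eq_zero.1 (?_ : H.ω₃ z₀ * H.gφφ (0, z₀) = 0)).resolve_right h2
  rw [ω₃]
  linear_combination h

end AxisymmetricHorizon

/-! ### Static and axisymmetric horizons -/

section lines

theorem deriv_update (μ : Fin 4) (f : (Fin 4 → ℝ) → ℝ) (x : Fin 4 → ℝ) :
    deriv (fun n => f (Function.update x μ n)) = fun n => pd μ f (Function.update x μ n) := by
  ext n
  simp [pd]

theorem iteratedDeriv_two_update (f : (Fin 4 → ℝ) → ℝ) (x : Fin 4 → ℝ) :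
    iteratedDeriv 2 (fun n => f (Function.update x 1 n)) (x 1) = pd 1 (pd 1 f) x := by
  simp only [iteratedDeriv_succ', iteratedDeriv_zero, deriv_update, Function.update_eq_self]

theorem iteratedDeriv_three_update (f : (Fin 4 → ℝ) → ℝ) (x : Fin 4 → ℝ) :
    iteratedDeriv 3 (fun n => f (Function.update x 1 n)) (x 1) = pd 1 (pd 1 (pd 1 f)) x := by
  simp only [iteratedDeriv_succ', iteratedDeriv_zero, deriv_update, Function.update_eq_self]

end lines

/-- A function whose differential vanishes on the horizon is constant on a connected section. -/
theorem KillingData.exists_eq_const (K : KillingData) {E : Type*} [NormedAddCommGroup E]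
    [NormedSpace ℝ E] {s : Set E} (hs : IsOpen s) (hs' : IsPreconnected s) {c : E → Fin 4 → ℝ}
    (hc : Differentiable ℝ c) (hcs : ∀ y ∈ s, c y ∈ K.hor) {f : (Fin 4 → ℝ) → ℝ}
    (hf : SmoothOn K.S f) (h : ∀ y ∈ K.hor, ∀ a, pd a f y = 0) :
    ∃ k, ∀ y ∈ s, f (c y) = k := by
  have key : ∀ y ∈ s, HasFDerivAt (fun y => f (c y)) (0 : E →L[ℝ] ℝ) y := by
    intro y hy
    have hd := hf.differentiableAt K.isOpen (hcs y hy).1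
    have h0 : fderiv ℝ f (c y) = 0 := by
      refine ContinuousLinearMap.coe_injective (LinearMap.pi_ext fun a t => ?_)
      have e : (Pi.single a t : Fin 4 → ℝ) = t • Pi.single a 1 := by
        rw [← Pi.single_smul, smul_eq_mul, mul_one]
      rw [ContinuousLinearMap.coe_coe, e, map_smul, ← pd_eq_fderiv a hd, h _ (hcs y hy) a]
      simp
    have := hd.hasFDerivAt.comp y (hc y).hasFDerivAt
    rw [h0, ContinuousLinearMap.zero_comp] at this
    exact this
  exact hs.exists_is_const_of_fderiv_eq_zero hs'
    (fun y hy => (key y hy).differentiableAt.differentiableWithinAt) fun y hy => (key y hy).fderiv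

namespace StaticHorizon
variable (H : StaticHorizon)

theorem contDiffOn_lift {f : ℝ × ℝ × ℝ → ℝ} (hf : ContDiffOn ℝ (⊤ : ℕ∞) f H.U) :
    SmoothOn {x | (x 1, x 2, x 3) ∈ H.U} fun x => f (x 1, x 2, x 3) :=
  hf.comp (t := H.U) (f := fun x : Fin 4 → ℝ => (x 1, x 2, x 3)) (by fun_prop) fun _ hx => hx

/-- A static horizon, its metric functions seen as functions of all four coordinates. -/
def toKillingData : KillingData where
  S := {x | (x 1, x 2, x 3) ∈ H.U}
  isOpen := H.isOpen_U.preimage (by fun_prop)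
  N x := H.N (x 1, x 2, x 3)
  ω _ := 0
  p x := H.gφφ (x 1, x 2, x 3)
  q x := H.gφz (x 1, x 2, x 3)
  r x := H.gzz (x 1, x 2, x 3)
  smooth_N := H.contDiffOn_lift H.smooth_N
  smooth_ω := contDiffOn_const
  smooth_p := H.contDiffOn_lift H.smooth_gφφ
  smooth_q := H.contDiffOn_lift H.smooth_gφz
  smooth_r := H.contDiffOn_lift H.smooth_gzz
  p_pos _ hx := H.gφφ_pos _ hx
  det_pos _ hx := H.det_pos _ hx
  pd_zero x := by simp [pd]
  static_or_axisymmetric := Or.inl fun _ => rfl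
  lapse_zero x hx h := by
    change (x 1, x 2, x 3) ∈ H.U at hx
    rw [h] at hx ⊢
    exact H.lapse_zero _ hx
  nonextremal x hx h := by
    change (x 1, x 2, x 3) ∈ H.U at hx
    rw [h] at hx
    simpa [pd, h] using H.nonextremal _ hx

theorem toKillingData_metric : H.toKillingData.metric = H.metric := by
  ext x i j
  simp [KillingData.metric, metric, toKillingData]

theorem toKillingData_hor : H.toKillingData.hor = H.horizon := by
  ext x
  exact and_comm

/-- The horizon point with coordinates `y = (φ, z)`, at `t = 0`. -/
def point (y : ℝ × ℝ) : Fin 4 → ℝ := ![0, 0, y.1, y.2]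

theorem point_mem {y : ℝ × ℝ} (hy : (0, y) ∈ H.U) : point y ∈ H.toKillingData.hor := ⟨hy, rfl⟩

theorem pd_one_point (f : ℝ × ℝ × ℝ → ℝ) (y : ℝ × ℝ) :
    pd 1 (fun x => f (x 1, x 2, x 3)) (point y) = deriv (fun n => f (n, y)) 0 := by
  simp [pd, point]

theorem conclusions (hfin : FiniteCurvatureScalars H.metric H.horizon) :
      (∃ κ : ℝ, ∀ y : ℝ × ℝ, (0, y) ∈ H.U → H.κh y = κ) ∧
      (∀ y : ℝ × ℝ, (0, y) ∈ H.U →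
        H.κ₂ y = 0 ∧
        deriv (fun n => H.gzz (n, y)) 0 = 0 ∧
        deriv (fun n => H.gφφ (n, y)) 0 = 0 ∧
        deriv (fun n => H.gφz (n, y)) 0 = 0) ∧
      (∀ p ∈ H.horizon, ∃ E : Matrix (Fin 4) (Fin 4) ℝ,
        (∀ a b, HasHorizonLimit (frameComp H.metric 0 (einstein H.metric) a b) p (E a b)) ∧
        E.IsSymm ∧ E 0 1 = 0 ∧ E 0 2 = 0 ∧ E 0 3 = 0 ∧ E 1 2 = 0 ∧ E 1 3 = 0 ∧
        E 0 0 = -E 1 1) ∧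
      (∀ T : Tensor2, EinsteinEquations H.metric T H.exterior →
        ∀ p ∈ H.horizon, ∃ ρ pₙ : ℝ,
          HasHorizonLimit (frameComp H.metric 0 T 0 0) p ρ ∧
          HasHorizonLimit (frameComp H.metric 0 T 1 1) p pₙ ∧ ρ = -pₙ) := by
  rw [← toKillingData_metric, ← toKillingData_hor] at hfin ⊢
  have R := KillingData.regularHorizon hfin
  have hE := fun y hy => KillingData.einstein_limit R (y := y) hy (Ω := 0) rfl
  refine ⟨?_, fun y hy => ⟨?_, ?_, ?_, ?_⟩, fun y hy => ?_, fun T hT y hy => ?_⟩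
  · obtain ⟨κ, hκ⟩ := H.toKillingData.exists_eq_const (s := {y : ℝ × ℝ | (0, y) ∈ H.U}) (c := point)
      (H.isOpen_U.preimage (by fun_prop)) H.connected
      (by unfold point; refine differentiable_pi.2 fun i => ?_; fin_cases i <;> simp)
      (fun y hy => H.point_mem hy)
      (H.toKillingData.smooth_N.pd H.toKillingData.isOpen 1) R.zeroth_law
    exact ⟨κ, fun y hy => (pd_one_point H.N y).symm.trans (hκ y hy)⟩
  · have h := R.κ₂ _ (H.point_mem hy)
    rw [← iteratedDeriv_two_update] at h
    simpa [toKillingData, point, κ₂] using h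
  · exact (pd_one_point H.gzz y).symm.trans (R.r _ (H.point_mem hy))
  · exact (pd_one_point H.gφφ y).symm.trans (R.p _ (H.point_mem hy))
  · exact (pd_one_point H.gφz y).symm.trans (R.q _ (H.point_mem hy))
  · obtain ⟨E, h1, h2, h3, h4, h5, h6, h7, h8⟩ := hE y hy
    refine ⟨E, h1, h2, h3, h8.2 ?_, h4, h5, h6, h7⟩
    exact open KillingData in
      pd_eq_zero_of_forall (pd_eq_zero_of_forall (pd_eq_zero_of_forall (fun _ => rfl) 1) 1) 1 y
  · obtain ⟨E, h1, -, -, -, -, -, h7, -⟩ := hE y hy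
    have hT' : ∀ x ∈ H.toKillingData.S, 0 < x 1 →
        einstein H.toKillingData.metric x = (8 * Real.pi) • T x := fun x hx hn => hT x ⟨hn, hx⟩
    exact ⟨_, _, KillingData.matter_limit hy hT' (h1 0 0), KillingData.matter_limit hy hT' (h1 1 1),
      by rw [h7]; ring⟩

end StaticHorizon

namespace AxisymmetricHorizon
variable (H : AxisymmetricHorizon)

theorem contDiffOn_lift {f : ℝ × ℝ → ℝ} (hf : ContDiffOn ℝ (⊤ : ℕ∞) f H.U) :
    SmoothOn {x | (x 1, x 3) ∈ H.U} fun x => f (x 1, x 3) :=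
  hf.comp (t := H.U) (f := fun x : Fin 4 → ℝ => (x 1, x 3)) (by fun_prop) fun _ hx => hx

/-- An axisymmetric horizon, its metric functions seen as functions of all four coordinates. -/
def toKillingData : KillingData where
  S := {x | (x 1, x 3) ∈ H.U}
  isOpen := H.isOpen_U.preimage (by fun_prop)
  N x := H.N (x 1, x 3)
  ω x := H.ω (x 1, x 3)
  p x := H.gφφ (x 1, x 3)
  q _ := 0
  r x := H.gzz (x 1, x 3)
  smooth_N := H.contDiffOn_lift H.smooth_N
  smooth_ω := H.contDiffOn_lift H.smooth_ω
  smooth_p := H.contDiffOn_lift H.smooth_gφφ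
  smooth_q := contDiffOn_const
  smooth_r := H.contDiffOn_lift H.smooth_gzz
  p_pos _ hx := H.gφφ_pos _ hx
  det_pos _ hx := by
    have := mul_pos (H.gφφ_pos _ hx) (H.gzz_pos _ hx)
    simpa using this
  pd_zero x := by simp [pd]
  static_or_axisymmetric := Or.inr ⟨fun _ => rfl, fun x => by simp [pd]⟩
  lapse_zero x hx h := by
    change (x 1, x 3) ∈ H.U at hx
    rw [h] at hx ⊢
    exact H.lapse_zero _ hx
  nonextremal x hx h := by
    change (x 1, x 3) ∈ H.U at hx
    rw [h] at hx
    simpa [pd, h] using H.nonextremal _ hx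

theorem toKillingData_metric : H.toKillingData.metric = H.metric := by
  ext x i j
  simp [KillingData.metric, metric, toKillingData]

theorem toKillingData_hor : H.toKillingData.hor = H.horizon := by
  ext x
  exact and_comm

/-- The horizon point with coordinate `z`, at `t = φ = 0`. -/
def point (z : ℝ) : Fin 4 → ℝ := ![0, 0, 0, z]

theorem differentiable_point : Differentiable ℝ point := by
  unfold point
  refine differentiable_pi.2 fun i => ?_
  fin_cases i <;> simp

theorem point_mem {z : ℝ} (hz : (0, z) ∈ H.U) : point z ∈ H.toKillingData.hor := ⟨hz, rfl⟩

theorem pd_one_point (f : ℝ × ℝ → ℝ) (z : ℝ) :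
    pd 1 (fun x => f (x 1, x 3)) (point z) = deriv (fun n => f (n, z)) 0 := by
  simp [pd, point]

theorem conclusions (hfin : FiniteCurvatureScalars H.metric H.horizon) :
      (∃ κ : ℝ, ∀ z : ℝ, (0, z) ∈ H.U → H.κh z = κ) ∧
      (∀ z : ℝ, (0, z) ∈ H.U →
        H.ω₁ z = 0 ∧
        H.κ₂ z = 0 ∧
        deriv (fun n => H.gzz (n, z)) 0 = 0 ∧
        deriv (fun n => H.gφφ (n, z)) 0 = 0) ∧
      ∃ Ω : ℝ, (∀ z : ℝ, (0, z) ∈ H.U → H.ω (0, z) = Ω) ∧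
        (∀ p ∈ H.horizon, ∃ E : Matrix (Fin 4) (Fin 4) ℝ,
          (∀ a b, HasHorizonLimit (frameComp H.metric Ω (einstein H.metric) a b) p (E a b)) ∧
          E.IsSymm ∧ E 0 1 = 0 ∧ E 0 3 = 0 ∧ E 1 2 = 0 ∧ E 1 3 = 0 ∧
          E 0 0 = -E 1 1 ∧
          (E 0 2 = 0 ↔ H.ω₃ (p 3) = 0) ∧
          (H.ExtendsAcrossHorizonAt (p 3) → E 0 2 = 0)) ∧
        (∀ T : Tensor2, EinsteinEquations H.metric T H.exterior →
          ∀ p ∈ H.horizon, ∃ ρ pₙ : ℝ,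
            HasHorizonLimit (frameComp H.metric Ω T 0 0) p ρ ∧
            HasHorizonLimit (frameComp H.metric Ω T 1 1) p pₙ ∧ ρ = -pₙ) := by
  rw [← toKillingData_metric, ← toKillingData_hor] at hfin ⊢
  have R := KillingData.regularHorizon hfin
  have const := fun {f : (Fin 4 → ℝ) → ℝ} => H.toKillingData.exists_eq_const (f := f)
    (s := {z : ℝ | (0, z) ∈ H.U}) (H.isOpen_U.preimage (by fun_prop)) H.connected
    differentiable_point fun z hz => H.point_mem hz
  have hω₁ : ∀ z : ℝ, (0, z) ∈ H.U → H.ω₁ z = 0 := fun z hz =>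
    (pd_one_point H.ω z).symm.trans (R.rigid _ (H.point_mem hz) 1)
  have hgφφ : ∀ z : ℝ, (0, z) ∈ H.U → deriv (fun n => H.gφφ (n, z)) 0 = 0 := fun z hz =>
    (pd_one_point H.gφφ z).symm.trans (R.p _ (H.point_mem hz))
  obtain ⟨Ω, hΩ⟩ : ∃ Ω : ℝ, ∀ z : ℝ, (0, z) ∈ H.U → H.ω (0, z) = Ω :=
    const H.toKillingData.smooth_ω R.rigid
  have hE := fun y hy => KillingData.einstein_limit R (y := y) hy (Ω := Ω) (by
    have h2 : (0, y 3) ∈ H.U := by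
      have h := hy.1
      change (y 1, y 3) ∈ H.U at h
      rwa [hy.2] at h
    change H.ω (y 1, y 3) = Ω
    rw [hy.2, hΩ _ h2])
  refine ⟨?_, fun z hz => ⟨hω₁ z hz, ?_, ?_, hgφφ z hz⟩, Ω, hΩ, fun y hy => ?_, fun T hT y hy => ?_⟩
  · obtain ⟨κ, hκ⟩ := const (H.toKillingData.smooth_N.pd H.toKillingData.isOpen 1) R.zeroth_law
    exact ⟨κ, fun z hz => (pd_one_point H.N z).symm.trans (hκ z hz)⟩
  · have h := R.κ₂ _ (H.point_mem hz)
    rw [← iteratedDeriv_two_update] at h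
    simpa [toKillingData, point, κ₂] using h
  · exact (pd_one_point H.gzz z).symm.trans (R.r _ (H.point_mem hz))
  · obtain ⟨E, h1, h2, h3, h4, h5, h6, h7, h8⟩ := hE y hy
    have h9 : E 0 2 = 0 ↔ H.ω₃ (y 3) = 0 := by
      rw [h8, ← iteratedDeriv_three_update, hy.2]
      simp [toKillingData, ω₃]
    refine ⟨E, h1, h2, h3, h4, h5, h6, h7, h9, fun hext => h9.2 ?_⟩
    have hU : (0, y 3) ∈ H.U := by
      have h := hy.1
      change (y 1, y 3) ∈ H.U at h
      rwa [hy.2] at h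
    exact H.ω₃_eq_zero_of_extends hΩ (hω₁ _ hU) (hgφφ _ hU) hext
  · obtain ⟨E, h1, -, -, -, -, -, h7, -⟩ := hE y hy
    have hT' : ∀ x ∈ H.toKillingData.S, 0 < x 1 →
        einstein H.toKillingData.metric x = (8 * Real.pi) • T x := fun x hx hn => hT x ⟨hn, hx⟩
    exact ⟨_, _, KillingData.matter_limit hy hT' (h1 0 0), KillingData.matter_limit hy hT' (h1 1 1),
      by rw [h7]; ring⟩

end AxisymmetricHorizon

end NearHorizon

end

open NearHorizon in
theorem mainTheorem5 :
    -- static horizons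
    (∀ H : StaticHorizon, FiniteCurvatureScalars H.metric H.horizon →
      (∃ κ : ℝ, ∀ y : ℝ × ℝ, (0, y) ∈ H.U → H.κh y = κ) ∧
      (∀ y : ℝ × ℝ, (0, y) ∈ H.U →
        H.κ₂ y = 0 ∧
        deriv (fun n => H.gzz (n, y)) 0 = 0 ∧
        deriv (fun n => H.gφφ (n, y)) 0 = 0 ∧
        deriv (fun n => H.gφz (n, y)) 0 = 0) ∧
      (∀ p ∈ H.horizon, ∃ E : Matrix (Fin 4) (Fin 4) ℝ,
        (∀ a b, HasHorizonLimit (frameComp H.metric 0 (einstein H.metric) a b) p (E a b)) ∧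
        E.IsSymm ∧ E 0 1 = 0 ∧ E 0 2 = 0 ∧ E 0 3 = 0 ∧ E 1 2 = 0 ∧ E 1 3 = 0 ∧
        E 0 0 = -E 1 1) ∧
      (∀ T : Tensor2, EinsteinEquations H.metric T H.exterior →
        ∀ p ∈ H.horizon, ∃ ρ pₙ : ℝ,
          HasHorizonLimit (frameComp H.metric 0 T 0 0) p ρ ∧
          HasHorizonLimit (frameComp H.metric 0 T 1 1) p pₙ ∧ ρ = -pₙ)) ∧
    -- stationary axisymmetric time-reversible horizons
    (∀ H : AxisymmetricHorizon, FiniteCurvatureScalars H.metric H.horizon →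
      (∃ κ : ℝ, ∀ z : ℝ, (0, z) ∈ H.U → H.κh z = κ) ∧
      (∀ z : ℝ, (0, z) ∈ H.U →
        H.ω₁ z = 0 ∧
        H.κ₂ z = 0 ∧
        deriv (fun n => H.gzz (n, z)) 0 = 0 ∧
        deriv (fun n => H.gφφ (n, z)) 0 = 0) ∧
      ∃ Ω : ℝ, (∀ z : ℝ, (0, z) ∈ H.U → H.ω (0, z) = Ω) ∧
        (∀ p ∈ H.horizon, ∃ E : Matrix (Fin 4) (Fin 4) ℝ,
          (∀ a b, HasHorizonLimit (frameComp H.metric Ω (einstein H.metric) a b) p (E a b)) ∧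
          E.IsSymm ∧ E 0 1 = 0 ∧ E 0 3 = 0 ∧ E 1 2 = 0 ∧ E 1 3 = 0 ∧
          E 0 0 = -E 1 1 ∧
          (E 0 2 = 0 ↔ H.ω₃ (p 3) = 0) ∧
          (H.ExtendsAcrossHorizonAt (p 3) → E 0 2 = 0)) ∧
        (∀ T : Tensor2, EinsteinEquations H.metric T H.exterior →
          ∀ p ∈ H.horizon, ∃ ρ pₙ : ℝ,
            HasHorizonLimit (frameComp H.metric Ω T 0 0) p ρ ∧
            HasHorizonLimit (frameComp H.metric Ω T 1 1) p pₙ ∧ ρ = -pₙ)) :=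
  ⟨StaticHorizon.conclusions, AxisymmetricHorizon.conclusions⟩
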